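/- **Setting.** Let $\mathsf d\ge 1$, $\mathcal Z=\mathbb Z^{\mathsf d}\times\{-1,1\}$; for $J=(j,\sigma)\in\mathcal Z$ put $|J|=|j|$ (Euclidean length), $\bar J=(j,-\sigma)$, $\langle J\rangle=\langle j\rangle=\max\{|j|,c\}$ with $c>0$. The weight $f$ is positive and increasing on $[c,\infty)$, tends to $+\infty$, and for a constant $C_f<1$ satisfies $f(\sum_l x_l)\le f(x_q)+C_f\sum_{l\ne q}f(x_l)$ for all finite families $x_l\ge c$ with $x_q=\max_l x_l$. Let $\|u\|_s=\big(\sum_{J\in\mathcal Z}|u_J|^2e^{2sf(\langle J\rangle)}\big)^{1/2}$, $W_s=\{u\in\mathbb C^{\mathcal Z}:\|u\|_s<\infty\}$, $B_s(r)=\{u:\|u\|_s<r\}$, and let $s_0$ satisfy $\sum_{J\in\mathcal Z}e^{(2C_f-2)s_0f(\langle J\rangle)}<\frac13$. For a function $F$ of $u$ let $(X_F)_{(j,\sigma)}=-\sigma i\,\partial F/\partial u_{(j,-\sigma)}$ and $|F|_{r,s}=\frac1r\sup_{u\in B_s(r)}\|X_F(u)\|_s$. For $1\le d_1\le d_2\le\infty$,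 $\mathcal P_{d_1,d_2}$ is the set of formal series $P=\sum_{d_1\le k\le d_2}\sum_{J_1,\dots,J_k\in\mathcal Z}P_{J_1\dots J_k}u_{J_1}\cdots u_{J_k}$ with $P_{J_1\dots J_k}=0$ unless $\sum_l\sigma_lj_l=0$, with $\overline{P_{J_1\dots J_k}}=P_{\bar J_1\dots\bar J_k}$, and with $|P_{J_1\dots J_k}|\le A^k$ for some constant $A$. Let $H=H_0+P$ with $H_0=\sum_j\omega_ju_{(j,1)}u_{(j,-1)}$ (that is, $\sum_j\omega_j|u_j|^2$) and $P\in\mathcal P_{3,\infty}$. The real frequencies $\omega_j$, the constants $C_0,C_2,\delta,\gamma,\tau,p>0$, $\beta>1$, $C_1$, and a partition $\mathcal Z=\bigcup_\alpha\Omega_\alpha$ satisfy: * (A.1) $\frac1{C_0}\le\omega_j/|j|^\beta\le C_0$ for all sufficiently large $|j|$. * (A.2) For all sufficiently large integers $N$, all $k$ and all $J_1,\dots,J_k$ with $|J_l|\le N$: if $\sum_l\sigma_l\omega_{j_l}\ne0$ then $|\sum_l\sigma_l\omega_{j_l}|\ge\gamma N^{-\tau k^p}$. If $\sum_{l=1}^k\sigma_l\omega_{j_l}=0$,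 for any $k$ and any $J_1,\dots,J_k\in\mathcal Z$, then $k$ is even and there is a permutation $\pi$ of $\{1,\dots,k\}$ with $\omega_{j_{\pi(i)}}=\omega_{j_{\pi(i+k/2)}}$ and $\sigma_{\pi(i)}=-\sigma_{\pi(i+k/2)}$ for $i\le k/2$. * (A.3) One block $\Omega_0$ lies in $\{|J|\le C_0\}$; $\sup_{J\in\Omega_\alpha}|J|-\inf_{J\in\Omega_\alpha}|J|\le C_1$ for $\alpha\ne0$; and $|\omega_{j_1}-\omega_{j_2}|\ge C_2(|j_1|^\delta+|j_2|^\delta)$ if $(j_1,\sigma_1)$ and $(j_2,\sigma_2)$ lie in different blocks. For an integer $N$, an index $J$ is called low if $|J|\le N$ and high otherwise. A multi-index $(J_1,\dots,J_k)$ is in case R0 if all $J_l$ are low and $\sum_l\sigma_l\omega_{j_l}=0$; it is in case R2 if exactly two of the $J_l$ are high and these two have opposite signs $\sigma$ and lie in the same block. A polynomial is in $N$-cutting normal form if it contains only monomials in case R0 or R2. $\Pi^>$ is the projection onto the high modes. A canonical transformation on $B_s(r)$ is a holomorphic map into $W_s$ whose derivative preserves the symplectic form $\sum_j(v_{(j,1)}w_{(j,-1)}-v_{(j,-1)}w_{(j,1)})$.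 Put $$C_{\mathrm{fin}}=2^{p+2}\Big(\tau\big(1+\tfrac\beta\delta\big)+1\Big),\qquad \kappa_s=\min\{C_{\mathrm{fin}},\,(1-C_f)(s-s_0)\},$$ and define $r_{d,N}=\rho^{\,C_{\mathrm{fin}}}$, where, with $d'=d/2$, $\rho>0$ is given by $\big(\rho\,(d'N)^{d'^p}\big)^{d'}=e^{-f(N)}$. (If $N$ is balanced with $d$ by $d'^p\ln(d'N)=f(N)/d'$, this says $\rho=e^{-2f(N)/d'}$.) **Theorem (Normal Form Lemma).** There are $D,N_0$ such that for every $d\ge D$ and every integer $N\ge N_0$ for which $\omega_j\ne\omega_k$ whenever $|j|\le N<|k|$, there are maps $\mathcal T_d,\mathcal T_d^{-1}$, a polynomial $Z_d=Z_0+Z_>$ with $Z_d,Z_0,Z_>\in\mathcal P_{3,d}$, and a series $R_d\in\mathcal P_{3,\infty}$, such that $Z_d$ is in $N$-cutting normal form, $Z_0$ contains only monomials in case R0, $Z_>$ contains only monomials in case R2, and for all $s>s_0$ and all $0<r\le r_{d,N}$: 1. $\mathcal T_d$ and $\mathcal T_d^{-1}$ are canonical transformations on $B_s(r)$, map $B_s(r)$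 into $B_s(2r)$, satisfy $\mathcal T_d^{-1}\mathcal T_du=u=\mathcal T_d\mathcal T_d^{-1}u$ for $u\in B_s(r)$, and map real sequences of $B_s(r)$ (those with $u_{(j,-1)}=\overline{u_{(j,1)}}$) to real sequences; 2. the series $P$ converges absolutely on $B_s(2r)$, the series $Z_d,Z_>,R_d$ converge absolutely on $B_s(r)$, and $H\circ\mathcal T_d=H_0+Z_d+R_d$ at every $u\in B_s(r)$ at which $H_0$ is defined in the sense that $\sum_J|\omega_j||u_J|^2<\infty$; for such $u$ the same sum for $\mathcal T_du$ is finite; 3. $|R_d|_{r,s}\le e^{-\kappa_sf(N)}$; 4. $\sup_{u\in B_s(r)}\|(\mathrm{Id}-\Pi^>)X_{Z_>}(u)\|_s\le e^{-\kappa_sf(N)}$. In particular, for $s\ge s_0+C_{\mathrm{fin}}/(1-C_f)$ both bounds are $e^{-C_{\mathrm{fin}}f(N)}$. -/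

import Mathlib

open scoped ENNReal ComplexConjugate

noncomputable section

namespace NormalForm

/-- The index set `ℤ^m × {-1, 1}`; the sign is a unit of `ℤ`. -/
abbrev Idx (m : ℕ) : Type := (Fin m → ℤ) × ℤˣ

/-- Sequences `u = (u_J)` of complex numbers. -/
abbrev Seq (m : ℕ) : Type := Idx m → ℂ

variable {m : ℕ}

/-- The Euclidean length `|j|`. -/
def len (j : Fin m → ℤ) : ℝ := Real.sqrt (∑ l, (j l : ℝ) ^ 2)

/-- The conjugate index `(j, -σ)` of `(j, σ)`. -/
def bar (J : Idx m) : Idx m := (J.1, -J.2)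

/-- The sign `σ` as a complex number. -/
def sgn (J : Idx m) : ℂ := ((J.2 : ℤ) : ℂ)

/-- The exponent `f (⟨j⟩)` of the weight, where `⟨j⟩ = max {|j|, c}`. -/
def wt (f : ℝ → ℝ) (c : ℝ) (J : Idx m) : ℝ := f (max (len J.1) c)

/-- The assumptions on the weight function `f`; only its values on `[c, ∞)` matter. -/
structure WeightAssumption (f : ℝ → ℝ) (c Cf : ℝ) : Prop where
  c_pos : 0 < c
  pos : ∀ x, c ≤ x → 0 < f x
  mono : MonotoneOn f (Set.Ici c)
  tendsto : Filter.Tendsto f Filter.atTop Filter.atTop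
  Cf_lt_one : Cf < 1
  sub : ∀ (n : ℕ) (x : Fin n → ℝ) (q : Fin n), (∀ l, c ≤ x l) → (∀ l, x l ≤ x q) →
    f (∑ l, x l) ≤ f (x q) + Cf * ∑ l ∈ Finset.univ.erase q, f (x l)

/-- The condition on the threshold `s₀`:
`∑_J exp ((2 C_f - 2) s₀ f (⟨J⟩))` converges and is smaller than `1 / 3`. -/
def IsThreshold (m : ℕ) (f : ℝ → ℝ) (c Cf s₀ : ℝ) : Prop :=
  Summable (fun J : Idx m => Real.exp ((2 * Cf - 2) * s₀ * wt f c J)) ∧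
    ∑' J : Idx m, Real.exp ((2 * Cf - 2) * s₀ * wt f c J) < 1 / 3

/-- The norm `‖u‖_s = (∑_J |u_J|² exp (2 s f (⟨J⟩)))^{1/2}`, with value `∞` outside `W_s`. -/
def wNorm (f : ℝ → ℝ) (c s : ℝ) (u : Seq m) : ℝ≥0∞ :=
  (∑' J : Idx m, ENNReal.ofReal (‖u J‖ ^ 2 * Real.exp (2 * s * wt f c J))) ^ (1 / 2 : ℝ)

/-- The open ball `B_s(r)` of `W_s` with centre `0`. -/
def wBall (f : ℝ → ℝ) (c s r : ℝ) : Set (Seq m) :=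
  {u | wNorm f c s u < ENNReal.ofReal r}

/-- The Hamiltonian vector field `(X_F)_{(j,σ)} = - σ i ∂F / ∂u_{(j,-σ)}`. -/
def hamVec (F : Seq m → ℂ) (u : Seq m) : Seq m := fun J =>
  -(sgn J * Complex.I * deriv (fun z : ℂ => F (Function.update u (bar J) z)) (u (bar J)))

/-- `|F|_{r,s} = (1 / r) sup_{u ∈ B_s(r)} ‖X_F(u)‖_s`. -/
def fieldNorm (f : ℝ → ℝ) (c r s : ℝ) (F : Seq m → ℂ) : ℝ≥0∞ :=
  (⨆ u ∈ (wBall f c s r : Set (Seq m)), wNorm f c s (hamVec F u)) / ENNReal.ofReal r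

/-- Coefficients `P_{J_1, …, J_k}`, for all degrees `k`, of a formal power series in the `u_J`. -/
abbrev Coeff (m : ℕ) : Type := (k : ℕ) → (Fin k → Idx m) → ℂ

/-- The momentum `∑_l σ_l j_l` of a multi-index. -/
def momentum {k : ℕ} (J : Fin k → Idx m) : Fin m → ℤ := ∑ l, ((J l).2 : ℤ) • (J l).1

/-- The class `𝒫_{d₁, d₂}` (with `d₂ = ⊤` allowed): degrees between `d₁` and `d₂`, momentum
conservation, reality, and bounded coefficients in each degree. The bound is at most geometric
in the degree, so that the series converges near `0`; for finite `d₂` this just says that the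
coefficients are bounded. -/
structure InP (P : Coeff m) (d₁ : ℕ) (d₂ : ℕ∞) : Prop where
  degree : ∀ k J, P k J ≠ 0 → d₁ ≤ k ∧ (k : ℕ∞) ≤ d₂
  moment : ∀ k J, P k J ≠ 0 → momentum J = 0
  reality : ∀ k J, conj (P k J) = P k (fun l => bar (J l))
  bounded : ∃ A : ℝ, ∀ k J, ‖P k J‖ ≤ A ^ k

/-- The monomials of the series at `u`, over all degrees and multi-indices. -/
def term (P : Coeff m) (u : Seq m) (x : Σ k : ℕ, (Fin k → Idx m)) : ℂ :=
  P x.1 x.2 * ∏ l, u (x.2 l)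

/-- Absolute convergence of the series at `u`. -/
def Converges (P : Coeff m) (u : Seq m) : Prop := Summable (term P u)

/-- The value of the series at `u`. -/
def eval (P : Coeff m) (u : Seq m) : ℂ := ∑' x, term P u x

/-- The quadratic Hamiltonian `H₀ = ∑_j ω_j u_{(j,1)} u_{(j,-1)}`, that is `∑_j ω_j |u_j|²`. -/
def H0 (ω : (Fin m → ℤ) → ℝ) (u : Seq m) : ℂ := ∑' j, (ω j : ℂ) * (u (j, 1) * u (j, -1))

/-- `∑_J |ω_j| |u_J|² < ∞`: the sequences at which `H₀` is defined. -/
def FiniteEnergy (ω : (Fin m → ℤ) → ℝ) (u : Seq m) : Prop :=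
  Summable (fun J : Idx m => |ω J.1| * ‖u J‖ ^ 2)

/-- The divisor `∑_l σ_l ω_{j_l}` of a multi-index. -/
def divisor (ω : (Fin m → ℤ) → ℝ) {k : ℕ} (J : Fin k → Idx m) : ℝ :=
  ∑ l, (((J l).2 : ℤ) : ℝ) * ω (J l).1

/-- The assumptions on the frequencies; the blocks `Ω_α` are the fibres of `blk`. -/
structure FrequencyAssumption (ω : (Fin m → ℤ) → ℝ) {A : Type*} (blk : Idx m → A)
    (C₀ C₁ C₂ β δ γ τ p : ℝ) : Prop where
  C₀_pos : 0 < C₀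
  C₂_pos : 0 < C₂
  one_lt_β : 1 < β
  δ_pos : 0 < δ
  γ_pos : 0 < γ
  τ_pos : 0 < τ
  p_pos : 0 < p
  growth : ∃ ρ : ℝ, ∀ j, ρ ≤ len j → 1 / C₀ ≤ ω j / len j ^ β ∧ ω j / len j ^ β ≤ C₀
  diophantine : ∃ N₀ : ℕ, ∀ N : ℕ, N₀ ≤ N → ∀ (k : ℕ) (J : Fin k → Idx m),
    (∀ l, len (J l).1 ≤ N) → divisor ω J ≠ 0 → γ / (N : ℝ) ^ (τ * (k : ℝ) ^ p) ≤ |divisor ω J|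
  /- A vanishing divisor has an even number `n + n` of terms, which cancel in pairs. -/
  resonance : ∀ (k : ℕ) (J : Fin k → Idx m), divisor ω J = 0 →
    ∃ (n : ℕ) (π : Fin n ⊕ Fin n ≃ Fin k), ∀ i : Fin n,
      ω (J (π (Sum.inl i))).1 = ω (J (π (Sum.inr i))).1 ∧
        (J (π (Sum.inl i))).2 = -(J (π (Sum.inr i))).2
  blocks : ∃ α₀ : A, (∀ J, blk J = α₀ → len J.1 ≤ C₀) ∧
    ∀ J K, blk J = blk K → blk J ≠ α₀ → len J.1 - len K.1 ≤ C₁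
  separation : ∀ J K, blk J ≠ blk K → C₂ * (len J.1 ^ δ + len K.1 ^ δ) ≤ |ω J.1 - ω K.1|

/-- All modes are low and the divisor vanishes. -/
def IsR0 (ω : (Fin m → ℤ) → ℝ) (N : ℕ) {k : ℕ} (J : Fin k → Idx m) : Prop :=
  (∀ l, len (J l).1 ≤ N) ∧ divisor ω J = 0

/-- Exactly two modes are high; they have opposite signs and lie in the same block. -/
def IsR2 {A : Type*} (blk : Idx m → A) (N : ℕ) {k : ℕ} (J : Fin k → Idx m) : Prop :=
  ∃ a b : Fin k, a ≠ b ∧ (∀ l, (N : ℝ) < len (J l).1 ↔ l = a ∨ l = b) ∧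
    (J a).2 = -(J b).2 ∧ blk (J a) = blk (J b)

/-- `N`-cutting normal form. -/
def IsCuttingNormalForm (ω : (Fin m → ℤ) → ℝ) {A : Type*} (blk : Idx m → A) (N : ℕ)
    (Z : Coeff m) : Prop :=
  ∀ k J, Z k J ≠ 0 → IsR0 ω N J ∨ IsR2 blk N J

/-- The projection `Id - Π^>` onto the low modes `|J| ≤ N`. -/
def lowPart (N : ℕ) (u : Seq m) : Seq m :=
  open Classical in fun J => if len J.1 ≤ N then u J else 0

/-- The isometry `(x_J) ↦ (exp (-s f (⟨J⟩)) x_J)` of `ℓ²` onto `W_s`. -/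
def fromL2 (f : ℝ → ℝ) (c s : ℝ) (x : lp (fun _ : Idx m => ℂ) 2) : Seq m := fun J =>
  (Real.exp (-(s * wt f c J)) : ℂ) * x J

/-- The symplectic form `∑_j (v_{(j,1)} w_{(j,-1)} - v_{(j,-1)} w_{(j,1)})`. -/
def symp (v w : Seq m) : ℂ := ∑' j : Fin m → ℤ, (v (j, 1) * w (j, -1) - v (j, -1) * w (j, 1))

/-- `T` is a canonical transformation on `B_s(r)`: there it is a (Fréchet) holomorphic map into
`W_s`, written as `Φ` in the coordinates of `ℓ²`, and its derivative preserves the symplectic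
form. -/
def IsCanonicalOn (f : ℝ → ℝ) (c s r : ℝ) (T : Seq m → Seq m) : Prop :=
  ∃ Φ : lp (fun _ : Idx m => ℂ) 2 → lp (fun _ : Idx m => ℂ) 2,
    DifferentiableOn ℂ Φ (Metric.ball 0 r) ∧
    (∀ x ∈ Metric.ball (0 : lp (fun _ : Idx m => ℂ) 2) r,
      T (fromL2 f c s x) = fromL2 f c s (Φ x)) ∧
    ∀ x ∈ Metric.ball (0 : lp (fun _ : Idx m => ℂ) 2) r, ∀ v w,
      symp (fromL2 f c s (fderiv ℂ Φ x v)) (fromL2 f c s (fderiv ℂ Φ x w)) =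
        symp (fromL2 f c s v) (fromL2 f c s w)

/-- Real sequences: `u_{(j,-1)}` is the conjugate of `u_{(j,1)}`. -/
def IsReal (u : Seq m) : Prop := ∀ j, u (j, -1) = conj (u (j, 1))

/-- `C_fin = 2^(p+2) (τ (1 + β / δ) + 1)`. -/
def Cfin (β δ τ p : ℝ) : ℝ := (2 : ℝ) ^ (p + 2) * (τ * (1 + β / δ) + 1)

/-- The radius `r` that belongs to `d` and `N`: with `d' = d / 2` and `r = r' ^ C_fin` it is given
by `(r' (d' N)^(d'^p))^d' = exp (-f N)`. -/
def radius (f : ℝ → ℝ) (β δ τ p : ℝ) (d N : ℕ) : ℝ :=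
  (Real.exp (-(f N / ((d : ℝ) / 2))) * ((d : ℝ) / 2 * N) ^ (-((d : ℝ) / 2) ^ p)) ^ Cfin β δ τ p

end NormalForm

end

open scoped ENNReal ComplexConjugate

noncomputable section

namespace NormalForm

variable {m : ℕ}

/-! A single time-one flow does all the work. Let `χ` be a polynomial generator of degree between 3
and `d`, and `L` the Lie derivative along its Hamiltonian field. Then `H ∘ T = H₀ + S` with `S = ∑
LⁿP / n! + ∑ Lⁿ(L H₀) / (n + 1)!`. The term `L H₀` multiplies each coefficient of `χ` by `I` times
its divisor. Every other contribution to degree `k + 1` involves `χ` only up to degree `k`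
(`lie_congr`, `known_congr`), so the coefficients of `χ` can be found degree by degree
(`exists_homological`). They are chosen such that `S` vanishes on all monomials of degree at most
`d` with at most two high modes outside R0 and R2. What is left up to degree `d` is either normal
form or has at least three high modes.

The divisors are bounded below in `FrequencyAssumption.exists_divisor_bound`. If all modes lie below
a power of `d N`, the Diophantine condition applies. Otherwise momentum conservation forces two high
modes, whose frequencies dominate the sum. The coefficients of `χ` and `S` therefore grow
geometrically, like `M ^ k` with `M` proportional to `d ^ 3` times the divisor constant.

Vector fields are estimated by a Young inequality with momentum constraint (`l2_tsum_dmon_le`,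
`nrm_tsum_le`). In each monomial the index of largest length carries the weight of the norm. By the
subadditivity of `f` the other factors need only the lighter weight `sideWt`, and the threshold
condition makes these factors summable. If one of them is high, a factor `exp (-(1 - Cf) (s - s₀) f
N)` is gained (`expWt_le_of_two_le_highs`). This covers the field of monomials with three high modes
and the low components of the field of R2 monomials. Monomials of degree above `d` gain `(8 M r) ^
(d - 1)`, and the radius is designed to bring this below `exp (-Cfin f N)` (`exists_radius_bound`).

On the analytic side, the flow comes from Picard–Lindelöf, and Taylor's formula along it identifies
the time-one map with a Lie series (`Gen.ev_lieSer`), which is holomorphic. It is symplectic because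
the second derivative of `χ` is symmetric, and the flow of `-χ` inverts it. `H₀` need not be defined
on all of `W_s`. The estimates are therefore proved for abstract weights (`Tame`) and used a second
time with `energyWt`, whose space consists of the sequences of finite energy in `W_s`. -/

/-! ### Words, monomials and sums over factorizations -/

/-- Words in the indices; they label the monomials of a series. -/
abbrev Word (m : ℕ) : Type := List (Idx m)

/-- Series with coefficients labelled by words. -/
abbrev Ser (m : ℕ) : Type := Word m → ℂ

/-- The momentum of a word. -/
def mom (w : Word m) : Fin m → ℤ := (w.map fun J => (J.2 : ℤ) • J.1).sum

@[simp] lemma mom_nil : mom ([] : Word m) = 0 := rfl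

@[simp] lemma mom_cons (J : Idx m) (w : Word m) : mom (J :: w) = (J.2 : ℤ) • J.1 + mom w := by
  simp [mom]

@[simp] lemma mom_append (v w : Word m) : mom (v ++ w) = mom v + mom w := by
  simp [mom]

/-- The monomial `u^w`. -/
def mon {R : Type*} [CommMonoid R] (u : Idx m → R) (w : Word m) : R := (w.map u).prod

section mon

variable {R : Type*} [CommMonoid R]

@[simp] lemma mon_nil (u : Idx m → R) : mon u [] = 1 := rfl

@[simp] lemma mon_cons (u : Idx m → R) (J : Idx m) (w : Word m) :
    mon u (J :: w) = u J * mon u w := by simp [mon]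

@[simp] lemma mon_append (u : Idx m → R) (v w : Word m) : mon u (v ++ w) = mon u v * mon u w := by
  simp [mon]

end mon

/-- The sum of `g v₁ v₂` over all factorizations `w = v₁ v₂`. -/
def splitSum {R : Type*} [AddCommMonoid R] (g : Word m → Word m → R) (w : Word m) : R :=
  ∑ i : Fin (w.length + 1), g (w.take i) (w.drop i)

/-- The sum of `g v₁ J v₂` over all factorizations `w = v₁ J v₂`. -/
def posSum {R : Type*} [AddCommMonoid R] (g : Word m → Idx m → Word m → R) (w : Word m) : R :=
  ∑ i : Fin w.length, g (w.take i) (w.get i) (w.drop (i + 1))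

section sums

variable {R : Type*} [AddCommMonoid R]

lemma splitSum_cons (g : Word m → Word m → R) (J : Idx m) (w : Word m) :
    splitSum g (J :: w) = g [] (J :: w) + splitSum (fun v => g (J :: v)) w := by
  simp [splitSum, Fin.sum_univ_succ (n := w.length + 1)]

@[simp] lemma posSum_nil (g : Word m → Idx m → Word m → R) : posSum g [] = 0 := by
  simp [posSum]

lemma posSum_cons (g : Word m → Idx m → Word m → R) (J : Idx m) (w : Word m) :
    posSum g (J :: w) = g [] J w + posSum (fun v => g (J :: v)) w := by
  simp [posSum, Fin.sum_univ_succ (n := w.length)]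

lemma splitSum_congr {g h : Word m → Word m → R} {w : Word m}
    (H : ∀ v₁ v₂, v₁ ++ v₂ = w → g v₁ v₂ = h v₁ v₂) : splitSum g w = splitSum h w :=
  Finset.sum_congr rfl fun _ _ => H _ _ (List.take_append_drop _ _)

lemma splitSum_eq_zero {g : Word m → Word m → R} {w : Word m}
    (H : ∀ v₁ v₂, v₁ ++ v₂ = w → g v₁ v₂ = 0) : splitSum g w = 0 :=
  Finset.sum_eq_zero fun _ _ => H _ _ (List.take_append_drop _ _)

/-- Pairs of words are words with a marked gap. -/
def splitEquiv : (Word m × Word m) ≃ Σ w : Word m, Fin (w.length + 1) where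
  toFun p := ⟨p.1 ++ p.2, ⟨p.1.length, by simp⟩⟩
  invFun x := (x.1.take x.2, x.1.drop x.2)
  left_inv p := by simp
  right_inv x := by
    obtain ⟨w, i, hi⟩ := x
    refine Sigma.ext (by simp) ?_
    rw [Fin.heq_ext_iff (by simp)]
    simp; omega

/-- Triples of a word, an index and a word are words with a marked position. -/
def posEquiv : (Word m × Idx m × Word m) ≃ Σ w : Word m, Fin w.length where
  toFun p := ⟨p.1 ++ p.2.1 :: p.2.2, ⟨p.1.length, by simp⟩⟩
  invFun x := (x.1.take x.2, x.1.get x.2, x.1.drop (x.2 + 1))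
  left_inv p := by simp
  right_inv x := by
    obtain ⟨w, i, hi⟩ := x
    refine Sigma.ext (by simp) ?_
    rw [Fin.heq_ext_iff (by simp)]
    simp; omega

variable [TopologicalSpace R]

/-- A word has finitely many gaps, so regrouping along `splitEquiv` only sums over finite fibres.
The same statement serves complex series and their majorants in `[0, ∞]`. -/
lemma hasSum_splitSum [ContinuousAdd R] [RegularSpace R] {g : Word m → Word m → R} {a : R}
    (h : HasSum (fun p : Word m × Word m => g p.1 p.2) a) : HasSum (splitSum g) a := by
  have h' := (splitEquiv.symm.hasSum_iff (f := fun p : Word m × Word m => g p.1 p.2)).2 h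
  exact h'.sigma fun w => hasSum_fintype _

lemma hasSum_posSum [ContinuousAdd R] [RegularSpace R] {g : Word m → Idx m → Word m → R} {a : R}
    (h : HasSum (fun p : Word m × Idx m × Word m => g p.1 p.2.1 p.2.2) a) :
    HasSum (posSum g) a := by
  have h' := (posEquiv.symm.hasSum_iff
    (f := fun p : Word m × Idx m × Word m => g p.1 p.2.1 p.2.2)).2 h
  exact h'.sigma fun w => hasSum_fintype _

end sums

lemma tsum_splitSum (g : Word m → Word m → ℝ≥0∞) :
    ∑' w, splitSum g w = ∑' p : Word m × Word m, g p.1 p.2 :=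
  (hasSum_splitSum ENNReal.summable.hasSum).tsum_eq

lemma tsum_posSum (g : Word m → Idx m → Word m → ℝ≥0∞) :
    ∑' w, posSum g w = ∑' p : Word m × Idx m × Word m, g p.1 p.2.1 p.2.2 :=
  (hasSum_posSum ENNReal.summable.hasSum).tsum_eq

lemma splitSum_le_splitSum {R : Type*} [AddCommMonoid R] [PartialOrder R] [IsOrderedAddMonoid R]
    {g h : Word m → Word m → R} {w : Word m} (H : ∀ v₁ v₂, v₁ ++ v₂ = w → g v₁ v₂ ≤ h v₁ v₂) :
    splitSum g w ≤ splitSum h w :=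
  Finset.sum_le_sum fun _ _ => H _ _ (List.take_append_drop _ _)

lemma norm_splitSum_le (g : Word m → Word m → ℂ) (w : Word m) :
    ‖splitSum g w‖ ≤ splitSum (fun v₁ v₂ => ‖g v₁ v₂‖) w := norm_sum_le _ _

/-- The index `J` with sign `σ` for which `σ j` is the momentum of `w`. -/
def jn (w : Word m) (σ : ℤˣ) : Idx m := ((σ : ℤ) • mom w, σ)

lemma eq_jn {J : Idx m} {w : Word m} (h : mom w = (J.2 : ℤ) • J.1) : J = jn w J.2 := by
  refine Prod.ext ?_ rfl
  simp only [jn, h, smul_smul]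
  rcases Int.units_eq_one_or J.2 with h | h <;> simp [h]

lemma mom_eq_jn (w : Word m) (σ : ℤˣ) : mom w = ((jn w σ).2 : ℤ) • (jn w σ).1 := by
  rcases Int.units_eq_one_or σ with h | h <;> simp [jn, h]

lemma jn_injective (w : Word m) : Function.Injective (jn w) := fun _ _ h => congrArg Prod.snd h

/-- A sum over indices whose signed momentum is that of `w` has at most two terms. -/
lemma tsum_eq_sum_jn {R : Type*} [AddCommMonoid R] [TopologicalSpace R] (w : Word m)
    (g : Idx m → R) (hg : ∀ J, g J ≠ 0 → mom w = (J.2 : ℤ) • J.1) :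
    ∑' J, g J = ∑ σ, g (jn w σ) := by
  have h : Function.support g ⊆ Set.range (jn w) := fun J hJ => ⟨J.2, (eq_jn (hg J hJ)).symm⟩
  rw [← (jn_injective w).tsum_eq h]
  exact tsum_fintype _

/-! ### The Lie derivative as an operation on coefficients -/

/-- The coefficients of the Hamiltonian vector field of a series. -/
def hamCoeff (χ : Ser m) (J : Idx m) (b : Word m) : ℂ :=
  -(sgn J * Complex.I) * splitSum (fun p r => χ (p ++ bar J :: r)) b

/-- The Lie derivative of the series `F` along the Hamiltonian vector field of `χ`. -/
def lie (χ F : Ser m) : Ser m := fun w =>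
  -- An index `J` of a word of `F` is replaced by a word `b` of the field component `J`. When `χ`
  -- conserves momentum, `b` determines `J` up to its sign, so the sum over all `J` reduces to the
  -- two candidates `jn b σ`.
  splitSum (fun p v => splitSum (fun b r =>
    ∑ σ : ℤˣ, F (p ++ jn b σ :: r) * hamCoeff χ (jn b σ) b) v) w

lemma norm_sgn (J : Idx m) : ‖sgn J‖ = 1 := by
  rcases Int.units_eq_one_or J.2 with h | h <;> simp [sgn, h]

@[simp] lemma bar_bar (J : Idx m) : bar (bar J) = J := by simp [bar]

lemma exists_of_splitSum_ne_zero {R : Type*} [AddCommMonoid R] {g : Word m → Word m → R}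
    {w : Word m} (h : splitSum g w ≠ 0) : ∃ p r, p ++ r = w ∧ g p r ≠ 0 := by
  by_contra! H
  exact h (splitSum_eq_zero fun p r hpr => H p r hpr)

lemma exists_of_hamCoeff_ne_zero {χ : Ser m} {J : Idx m} {b : Word m} (h : hamCoeff χ J b ≠ 0) :
    ∃ p r, p ++ r = b ∧ χ (p ++ bar J :: r) ≠ 0 :=
  exists_of_splitSum_ne_zero (right_ne_zero_of_mul h)

lemma exists_of_lie_ne_zero {χ F : Ser m} {w : Word m} (h : lie χ F w ≠ 0) :
    ∃ p b r σ, p ++ (b ++ r) = w ∧ F (p ++ jn b σ :: r) ≠ 0 ∧ hamCoeff χ (jn b σ) b ≠ 0 := by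
  obtain ⟨p, v, rfl, h₁⟩ := exists_of_splitSum_ne_zero h
  obtain ⟨b, r, rfl, h₂⟩ := exists_of_splitSum_ne_zero h₁
  obtain ⟨σ, -, h₃⟩ := Finset.exists_ne_zero_of_sum_ne_zero h₂
  exact ⟨p, b, r, σ, rfl, left_ne_zero_of_mul h₃, right_ne_zero_of_mul h₃⟩

/-- The coefficients vanish unless the degree is at least `ℓ` and the momentum is `μ`. -/
def SuppOn (ℓ : ℕ) (μ : Fin m → ℤ) (F : Ser m) : Prop :=
  ∀ w, F w ≠ 0 → ℓ ≤ w.length ∧ mom w = μ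

lemma SuppOn.mom_of_hamCoeff_ne_zero {ℓ : ℕ} {χ : Ser m} (hχ : SuppOn ℓ 0 χ) {J : Idx m}
    {b : Word m} (h : hamCoeff χ J b ≠ 0) : mom b = (J.2 : ℤ) • J.1 := by
  obtain ⟨p, r, rfl, h₁⟩ := exists_of_hamCoeff_ne_zero h
  have := (hχ _ h₁).2
  simp only [mom_append, mom_cons, bar, Units.val_neg, neg_smul] at this ⊢
  rw [← sub_eq_zero, ← this]
  abel

lemma SuppOn.le_length_of_hamCoeff_ne_zero {ℓ : ℕ} {μ : Fin m → ℤ} {χ : Ser m}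
    (hχ : SuppOn (ℓ + 1) μ χ) {J : Idx m} {b : Word m} (h : hamCoeff χ J b ≠ 0) :
    ℓ ≤ b.length := by
  obtain ⟨p, r, rfl, h₁⟩ := exists_of_hamCoeff_ne_zero h
  have := (hχ _ h₁).1
  simp at this ⊢
  omega

/-- The field of a generator of degree at least 3 has degree at least 2, so replacing one index
never shortens a word. The inserted word has the signed momentum of the index it replaces. -/
lemma SuppOn.lie {ℓ : ℕ} {μ : Fin m → ℤ} {χ F : Ser m} (hχ : SuppOn 3 0 χ)
    (hF : SuppOn ℓ μ F) : SuppOn ℓ μ (lie χ F) := by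
  intro w hw
  obtain ⟨p, b, r, σ, rfl, h₁, h₂⟩ := exists_of_lie_ne_zero hw
  have h₃ := hχ.le_length_of_hamCoeff_ne_zero h₂
  obtain ⟨h₄, h₅⟩ := hF _ h₁
  rw [mom_append, mom_cons, ← mom_eq_jn] at h₅
  simp only [List.length_append, List.length_cons, mom_append] at h₄ ⊢
  exact ⟨by omega, h₅⟩

lemma SuppOn.iterate_lie {ℓ : ℕ} {μ : Fin m → ℤ} {χ F : Ser m} (hχ : SuppOn 3 0 χ)
    (hF : SuppOn ℓ μ F) (n : ℕ) : SuppOn ℓ μ ((NormalForm.lie χ)^[n] F) := by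
  induction n with
  | zero => exact hF
  | succ n ih => rw [Function.iterate_succ_apply']; exact hχ.lie ih

/-- Two series agree up to degree `k`. -/
def AgreeTo (k : ℕ) (F G : Ser m) : Prop := ∀ w : Word m, w.length ≤ k → F w = G w

/-- The lengths of the two words that enter a coefficient of degree `k + 1` add up to at most `k +
3`. Both are at least 3 in nonzero terms, so neither exceeds `k`. This triangular structure makes
the homological equations solvable recursively. -/
lemma lie_congr {k : ℕ} {μ : Fin m → ℤ} {χ χ' F F' : Ser m} (hχ' : SuppOn 3 0 χ') (hF : SuppOn 3 μ F) (hF' : SuppOn 3 μ F') (h : AgreeTo k χ χ')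
    (h' : AgreeTo k F F') : AgreeTo (k + 1) (lie χ F) (lie χ' F') := by
  intro w hw
  refine splitSum_congr fun p v hv => splitSum_congr fun b r hb => Finset.sum_congr rfl ?_
  rintro σ -
  subst hb hv
  simp only [List.length_append] at hw
  -- If `b` fills the word up to at most one index, `F` is evaluated at a word of length at most 2
  -- and vanishes.
  by_cases hb : k ≤ b.length
  · have hz : ∀ G : Ser m, SuppOn 3 μ G → G (p ++ jn b σ :: r) = 0 := by
      intro G hG
      by_contra hne
      have := (hG _ hne).1
      simp at this
      omega
    rw [hz F hF, hz F' hF', zero_mul, zero_mul]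
  · have e₁ : hamCoeff χ (jn b σ) b = hamCoeff χ' (jn b σ) b := by
      refine congrArg _ (splitSum_congr ?_)
      rintro s t rfl
      refine h _ ?_
      simp at hb ⊢
      omega
    by_cases hz : hamCoeff χ' (jn b σ) b = 0
    · rw [e₁, hz, mul_zero, mul_zero]
    · have := hχ'.le_length_of_hamCoeff_ne_zero hz
      rw [e₁, h' (p ++ jn b σ :: r) (by simp; omega)]

lemma iterate_lie_congr {k : ℕ} {μ : Fin m → ℤ} {χ χ' F F' : Ser m} (hχ : SuppOn 3 0 χ)
    (hχ' : SuppOn 3 0 χ') (hF : SuppOn 3 μ F) (hF' : SuppOn 3 μ F') (h : AgreeTo k χ χ')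
    (h' : AgreeTo k F F') (n : ℕ) : AgreeTo (k + 1) ((lie χ)^[n + 1] F) ((lie χ')^[n + 1] F') := by
  induction n with
  | zero => exact lie_congr hχ' hF hF' h h'
  | succ n ih =>
    rw [Function.iterate_succ_apply' _ (n + 1), Function.iterate_succ_apply' _ (n + 1)]
    exact lie_congr hχ' (hχ.iterate_lie hF _) (hχ'.iterate_lie hF' _) h
      fun w hw => ih w (hw.trans (Nat.le_succ k))

/-! ### Reality of series and Lie derivatives -/

/-- The series with coefficients `conj (F (bar w))`. -/
def star' (F : Ser m) : Ser m := fun w => conj (F (w.map bar))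

@[simp] lemma mom_map_bar (w : Word m) : mom (w.map bar) = -mom w := by
  induction w with
  | nil => simp
  | cons J w ih => simp [ih, bar]; abel

lemma jn_map_bar (b : Word m) (σ : ℤˣ) : jn (b.map bar) σ = bar (jn b (-σ)) := by
  simp [jn, bar]

lemma splitSum_map_bar {R : Type*} [AddCommMonoid R] (g : Word m → Word m → R) (w : Word m) :
    splitSum g (w.map bar) = splitSum (fun p r => g (p.map bar) (r.map bar)) w := by
  induction w generalizing g with
  | nil => simp [splitSum]
  | cons J w ih =>
    rw [List.map_cons, splitSum_cons, splitSum_cons, ih]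
    simp

lemma conj_splitSum (g : Word m → Word m → ℂ) (w : Word m) :
    conj (splitSum g w) = splitSum (fun p r => conj (g p r)) w := map_sum _ _ _

lemma conj_hamCoeff_bar (χ : Ser m) (J : Idx m) (b : Word m) :
    conj (hamCoeff χ (bar J) (b.map bar)) = hamCoeff (star' χ) J b := by
  rw [hamCoeff, hamCoeff, splitSum_map_bar, map_mul, conj_splitSum]
  have : (starRingEnd ℂ) (-(sgn (bar J) * Complex.I)) = -(sgn J * Complex.I) := by
    simp [sgn, bar]
  rw [this]
  congr 1
  exact splitSum_congr fun p r _ => by simp [star']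

lemma star'_lie (χ F : Ser m) : star' (lie χ F) = lie (star' χ) (star' F) := by
  funext w
  simp only [star', lie]
  rw [splitSum_map_bar, conj_splitSum]
  refine splitSum_congr fun p v _ => ?_
  rw [splitSum_map_bar, conj_splitSum]
  refine splitSum_congr fun b r _ => ?_
  -- Barring a word negates its momentum, which exchanges the two candidates for the replaced index.
  rw [map_sum, ← Equiv.sum_comp (Equiv.neg ℤˣ)]
  refine Finset.sum_congr rfl fun σ _ => ?_
  rw [map_mul, Equiv.neg_apply, jn_map_bar, neg_neg, conj_hamCoeff_bar]
  simp

lemma star'_iterate_lie (χ F : Ser m) (n : ℕ) :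
    star' ((lie χ)^[n] F) = (lie (star' χ))^[n] (star' F) := by
  induction n with
  | zero => rfl
  | succ n ih => rw [Function.iterate_succ_apply', Function.iterate_succ_apply', star'_lie, ih]

lemma hamCoeff_neg (χ : Ser m) (J : Idx m) (b : Word m) :
    hamCoeff (-χ) J b = -hamCoeff χ J b := by
  simp [hamCoeff, splitSum]

/-! ### Coefficient bounds for iterated Lie derivatives -/

/-- Since the generator has degree at most `d`, the inserted word is short. The number of its
possible lengths is counted by `d` and not by the length of the whole word. -/
lemma splitSum_le_of_length {g : Word m → Word m → ℝ} {w : Word m} {d : ℕ} {C : ℝ} (hC : 0 ≤ C)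
    (h : ∀ p r, p ++ r = w → g p r ≤ if p.length < d then C else 0) : splitSum g w ≤ d * C := by
  calc splitSum g w ≤ ∑ i : Fin (w.length + 1), if (i : ℕ) < d then C else 0 := by
        refine Finset.sum_le_sum fun i _ => (h _ _ (List.take_append_drop _ _)).trans ?_
        rw [List.length_take, min_eq_left (by omega)]
    _ ≤ d * C := by
        rw [Fin.sum_univ_eq_sum_range (fun i => if i < d then C else 0), ← Finset.sum_filter,
          Finset.sum_const, nsmul_eq_mul]
        gcongr
        rw [← Finset.card_range d]
        exact Finset.card_le_card fun i hi => by simpa using (Finset.mem_filter.1 hi).2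

lemma norm_hamCoeff_le {χ : Ser m} {X M : ℝ} (hχ : ∀ w, ‖χ w‖ ≤ X * M ^ w.length) (J : Idx m)
    (b : Word m) : ‖hamCoeff χ J b‖ ≤ (b.length + 1) * (X * M ^ (b.length + 1)) := by
  rw [hamCoeff, norm_mul, norm_neg, norm_mul, norm_sgn, Complex.norm_I, one_mul, one_mul]
  refine (norm_splitSum_le _ _).trans ?_
  calc splitSum (fun p r => ‖χ (p ++ bar J :: r)‖) b
      ≤ splitSum (fun _ _ => X * M ^ (b.length + 1)) b := by
        refine splitSum_le_splitSum ?_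
        rintro p r rfl
        refine (hχ _).trans_eq ?_
        simp [add_assoc]
    _ = _ := by simp [splitSum]

/-- The inserted word has at most `k + 1` starting points and fewer than `d` lengths. There are two
signs, and the partial derivative of `χ` contributes another factor `d`. The two words involved have
together two letters more than `w`, hence `M ^ 2`. -/
lemma norm_lie_le {χ F : Ser m} {d k : ℕ} {X M B : ℝ} (hX : 0 ≤ X) (hM : 0 ≤ M) (hB : 0 ≤ B)
    (hs : SuppOn 3 0 χ) (hχ : ∀ w, ‖χ w‖ ≤ X * M ^ w.length) (hd : ∀ w, χ w ≠ 0 → w.length ≤ d)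
    (hF : ∀ w : Word m, w.length ≤ k → ‖F w‖ ≤ B * M ^ w.length) (w : Word m)
    (hw : w.length ≤ k) :
    ‖lie χ F w‖ ≤ 2 * d ^ 2 * (X * M ^ 2) * (k + 1) * (B * M ^ w.length) := by
  have hC : (0 : ℝ) ≤ d * X * B * M ^ (w.length + 2) := by positivity
  calc ‖lie χ F w‖ ≤ splitSum (fun p v => (d : ℝ) * (2 * (d * X * B * M ^ (w.length + 2)))) w := by
        refine (norm_splitSum_le _ _).trans (splitSum_le_splitSum fun p v hv => ?_)
        refine (norm_splitSum_le _ _).trans (splitSum_le_of_length (by positivity) ?_)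
        intro b r hb
        subst hb hv
        have key : ∀ σ : ℤˣ, ‖F (p ++ jn b σ :: r) * hamCoeff χ (jn b σ) b‖ ≤
            if b.length < d then d * X * B * M ^ ((p ++ (b ++ r)).length + 2) else 0 := by
          intro σ
          by_cases hz : hamCoeff χ (jn b σ) b = 0
          · rw [hz, mul_zero, norm_zero]
            split_ifs
            · exact hC
            · exact le_rfl
          have h₂ := hs.le_length_of_hamCoeff_ne_zero hz
          have h₃ : b.length < d := by
            obtain ⟨s, t, rfl, h₁⟩ := exists_of_hamCoeff_ne_zero hz
            have := hd _ h₁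
            simp at this ⊢
            omega
          rw [if_pos h₃, norm_mul]
          have h₄ : ((b.length + 1 : ℕ) : ℝ) ≤ d := by exact_mod_cast h₃
          push_cast at h₄
          calc _ ≤ (B * M ^ (p ++ jn b σ :: r).length) *
                ((b.length + 1) * (X * M ^ (b.length + 1))) := by
                gcongr
                · refine hF _ ?_
                  simp at hw ⊢
                  omega
                · exact norm_hamCoeff_le hχ _ _
            _ ≤ (B * M ^ (p ++ jn b σ :: r).length) * (d * (X * M ^ (b.length + 1))) := by gcongr
            _ = _ := by
                simp only [List.length_append, List.length_cons]
                ring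
        refine (norm_sum_le _ _).trans ((Finset.sum_le_sum fun σ _ => key σ).trans_eq ?_)
        rw [Finset.sum_const, Finset.card_univ, Fintype.card_units_int]
        split_ifs <;> simp
    _ = 2 * d ^ 2 * (X * M ^ 2) * (w.length + 1) * (B * M ^ w.length) := by
        simp [splitSum]
        ring
    _ ≤ _ := by gcongr

lemma norm_iterate_lie_le {χ F : Ser m} {d k : ℕ} {X M B : ℝ} (hX : 0 ≤ X) (hM : 0 ≤ M)
    (hB : 0 ≤ B) (hs : SuppOn 3 0 χ) (hχ : ∀ w, ‖χ w‖ ≤ X * M ^ w.length)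
    (hd : ∀ w, χ w ≠ 0 → w.length ≤ d)
    (hF : ∀ w : Word m, w.length ≤ k → ‖F w‖ ≤ B * M ^ w.length) (n : ℕ) (w : Word m)
    (hw : w.length ≤ k) :
    ‖(lie χ)^[n] F w‖ ≤ (2 * d ^ 2 * (X * M ^ 2) * (k + 1)) ^ n * (B * M ^ w.length) := by
  induction n generalizing w with
  | zero => simpa using hF w hw
  | succ n ih =>
    rw [Function.iterate_succ_apply']
    refine (norm_lie_le hX hM (B := (2 * d ^ 2 * (X * M ^ 2) * (k + 1)) ^ n * B) (by positivity)
      hs hχ hd (fun v hv => (ih v hv).trans_eq (by ring)) w hw).trans_eq ?_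
    ring

/-- The iterated Lie derivatives grow at most like `n! 2^{-n}`. -/
lemma norm_iterate_lie_div_factorial_le {χ F : Ser m} {d : ℕ} {X M B : ℝ} (hX : 0 ≤ X)
    (hM : 0 ≤ M) (hB : 0 ≤ B) (hs : SuppOn 3 0 χ) (hχ : ∀ w, ‖χ w‖ ≤ X * M ^ w.length)
    (hd : ∀ w, χ w ≠ 0 → w.length ≤ d) (hx : 2 * d ^ 2 * (X * M ^ 2) ≤ 1 / 4)
    (hF : ∀ w, ‖F w‖ ≤ B * M ^ w.length) (n : ℕ) (w : Word m) :
    ‖(lie χ)^[n] F w‖ / n.factorial ≤ (1 / 2) ^ n * (2 * B * (2 * M) ^ w.length) := by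
  have h := norm_iterate_lie_le (k := w.length) hX hM hB hs hχ hd (fun v _ => hF v) n w le_rfl
  have e : (2 * d ^ 2 * (X * M ^ 2) * (w.length + 1)) ^ n ≤
      (1 / 2) ^ n * (((w.length + 1 : ℕ) : ℝ) / 2) ^ n := by
    rw [← mul_pow]
    refine pow_le_pow_left₀ (by positivity) ?_ n
    push_cast
    nlinarith [(Nat.cast_nonneg w.length : (0 : ℝ) ≤ w.length)]
  -- The factorial turns the `n`-th power of the length into an exponential of the length, by `tⁿ /
  -- n! ≤ exp t` and `exp (1 / 2) ≤ 2`. The geometric rate `M` is merely doubled, uniformly in `n`.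
  have e₂ : (((w.length + 1 : ℕ) : ℝ) / 2) ^ n / n.factorial ≤ 2 ^ (w.length + 1) := by
    refine (Real.pow_div_factorial_le_exp _ (by positivity) n).trans ?_
    rw [div_eq_mul_inv, Real.exp_nat_mul]
    refine pow_le_pow_left₀ (Real.exp_pos _).le ?_ _
    have := Real.exp_bound_div_one_sub_of_interval (x := (2 : ℝ)⁻¹) (by norm_num) (by norm_num)
    norm_num at this ⊢
    linarith
  calc _ ≤ ((1 / 2) ^ n * (((w.length + 1 : ℕ) : ℝ) / 2) ^ n) * (B * M ^ w.length) /
        n.factorial := by gcongr; exact h.trans (by gcongr)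
    _ = (1 / 2) ^ n * ((((w.length + 1 : ℕ) : ℝ) / 2) ^ n / n.factorial) * (B * M ^ w.length) := by
        ring
    _ ≤ (1 / 2) ^ n * 2 ^ (w.length + 1) * (B * M ^ w.length) := by gcongr
    _ = _ := by rw [mul_pow]; ring

/-! ### The homological equations -/

/-- The divisor of a word. -/
def wdiv (ω : (Fin m → ℤ) → ℝ) (w : Word m) : ℝ := (w.map fun J => ((J.2 : ℤ) : ℝ) * ω J.1).sum

/-- The Lie derivative of `H₀` along the Hamiltonian vector field of `χ`. -/
def lieH0 (ω : (Fin m → ℤ) → ℝ) (χ : Ser m) : Ser m := fun w => Complex.I * wdiv ω w * χ w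

/-- The part of the transformed Hamiltonian that is determined by the lower degrees of `χ`. -/
def known (ω : (Fin m → ℤ) → ℝ) (P χ : Ser m) : Ser m := fun w =>
  P w + ∑' n : ℕ, ((lie χ)^[n + 1] P w / (n + 1).factorial +
    (lie χ)^[n + 1] (lieH0 ω χ) w / (n + 2).factorial)

lemma wdiv_map_bar (ω : (Fin m → ℤ) → ℝ) (w : Word m) : wdiv ω (w.map bar) = -wdiv ω w := by
  induction w with
  | nil => simp [wdiv]
  | cons J w ih =>
    simp only [wdiv, List.map_cons, List.sum_cons] at ih ⊢
    rw [ih]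
    simp [bar]
    ring

lemma SuppOn.lieH0 {ω : (Fin m → ℤ) → ℝ} {χ : Ser m} (hχ : SuppOn 3 0 χ) :
    SuppOn 3 0 (lieH0 ω χ) := fun w hw => hχ w (right_ne_zero_of_mul hw)

lemma star'_lieH0 {ω : (Fin m → ℤ) → ℝ} {χ : Ser m} (hχ : star' χ = χ) :
    star' (lieH0 ω χ) = lieH0 ω χ := by
  funext w
  have := congrFun hχ w
  simp only [star'] at this
  simp [star', lieH0, wdiv_map_bar, this]

lemma SuppOn.known {ω : (Fin m → ℤ) → ℝ} {P χ : Ser m} (hP : SuppOn 3 0 P) (hχ : SuppOn 3 0 χ) :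
    SuppOn 3 0 (known ω P χ) := by
  intro w hw
  by_contra hne
  have h : ∀ F : Ser m, SuppOn 3 0 F → F w = 0 := fun F hF => by
    by_contra h
    exact hne (hF w h)
  refine hw ?_
  rw [NormalForm.known, h P hP, tsum_congr (β := ℕ) (g := fun _ => 0), tsum_zero, add_zero]
  intro n
  rw [h _ (hχ.iterate_lie hP _), h _ (hχ.iterate_lie hχ.lieH0 _)]
  simp

lemma star'_known {ω : (Fin m → ℤ) → ℝ} {P χ : Ser m} (hP : star' P = P) (hχ : star' χ = χ) :
    star' (known ω P χ) = known ω P χ := by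
  funext w
  have h : ∀ (F : Ser m), star' F = F → ∀ n, conj ((lie χ)^[n] F (w.map bar)) =
      (lie χ)^[n] F w := fun F hF n => by
    have := congrFun (star'_iterate_lie χ F n) w
    rwa [hχ, hF] at this
  simp only [star', known, map_add]
  rw [Complex.conj_tsum]
  congr 1
  · exact h P hP 0
  · refine tsum_congr fun n => ?_
    rw [map_add, map_div₀, map_div₀, h P hP, h _ (star'_lieH0 hχ)]
    simp

/-- Apart from `P` itself, only Lie derivatives of order at least one enter `known`, and each of
them gains a degree. The only contribution of the top degree of `χ` is `lieH0 ω χ`, which is left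
out. -/
lemma known_congr {k : ℕ} {ω : (Fin m → ℤ) → ℝ} {P χ χ' : Ser m} (hP : SuppOn 3 0 P)
    (hχ : SuppOn 3 0 χ) (hχ' : SuppOn 3 0 χ') (h : AgreeTo k χ χ') :
    AgreeTo (k + 1) (known ω P χ) (known ω P χ') := by
  intro w hw
  have hE : AgreeTo k (lieH0 ω χ) (lieH0 ω χ') := fun v hv => by simp only [lieH0, h v hv]
  simp only [known]
  congr 1
  refine tsum_congr fun n => ?_
  rw [iterate_lie_congr hχ hχ' hP hP h (fun _ _ => rfl) n w hw,
    iterate_lie_congr hχ hχ' hχ.lieH0 hχ'.lieH0 h hE n w hw]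

lemma hasSum_exp_sub_one (y : ℝ) :
    HasSum (fun n : ℕ => y ^ (n + 1) / (n + 1).factorial) (Real.exp y - 1) := by
  have := (hasSum_nat_add_iff' 1).2 (Real.exp_eq_exp_ℝ ▸ NormedSpace.expSeries_div_hasSum_exp y)
  simpa using this

/-- The corrections to `P` sum to at most `(exp y - 1) (3 / 2)` times the bound, which is `3 / 8` of
it because `y ≤ 1 / 8`. As `P` uses up only half, the bound `B` reproduces itself in the induction
over the degree. -/
lemma norm_known_le {ω : (Fin m → ℤ) → ℝ} {P χ : Ser m} {d : ℕ} {X M B : ℝ} (hX : 0 ≤ X)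
    (hM : 0 ≤ M) (hB : 0 ≤ B) (hs : SuppOn 3 0 χ) (hχ : ∀ w, ‖χ w‖ ≤ X * M ^ w.length)
    (hd : ∀ w, χ w ≠ 0 → w.length ≤ d) (hx : 2 * d ^ 2 * (X * M ^ 2) * (d + 1) ≤ 1 / 8)
    (hP : ∀ w, ‖P w‖ ≤ B / 2 * M ^ w.length) (hE : ∀ w, ‖lieH0 ω χ w‖ ≤ B * M ^ w.length)
    (w : Word m) (hw : w.length ≤ d) : ‖known ω P χ w‖ ≤ B * M ^ w.length := by
  set y : ℝ := 2 * d ^ 2 * (X * M ^ 2) * (d + 1)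
  have hy : 0 ≤ y := by positivity
  have h₁ := fun n => norm_iterate_lie_le hX hM (by positivity : 0 ≤ B / 2) hs hχ hd
    (fun v (_ : v.length ≤ d) => hP v) n w hw
  have h₂ := fun n => norm_iterate_lie_le hX hM hB hs hχ hd (fun v (_ : v.length ≤ d) => hE v) n w hw
  have hC : 0 ≤ B * M ^ w.length := by positivity
  have h₃ : ‖∑' n : ℕ, ((lie χ)^[n + 1] P w / (n + 1).factorial +
      (lie χ)^[n + 1] (lieH0 ω χ) w / (n + 2).factorial)‖ ≤
      (Real.exp y - 1) * (3 / 2 * (B * M ^ w.length)) := by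
    refine tsum_of_norm_bounded ((hasSum_exp_sub_one y).mul_right _) fun n => ?_
    have hf : ((n + 1).factorial : ℝ) ≤ (n + 2).factorial := by
      exact_mod_cast Nat.factorial_le (Nat.le_succ _)
    calc _ ≤ ‖(lie χ)^[n + 1] P w‖ / (n + 1).factorial +
          ‖(lie χ)^[n + 1] (lieH0 ω χ) w‖ / (n + 2).factorial := by
          refine (norm_add_le _ _).trans_eq ?_
          simp
      _ ≤ y ^ (n + 1) * (B / 2 * M ^ w.length) / (n + 1).factorial +
          y ^ (n + 1) * (B * M ^ w.length) / (n + 1).factorial := by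
          gcongr
          · exact h₁ _
          · exact h₂ _
      _ = _ := by ring
  have h₄ : Real.exp y - 1 ≤ 1 / 4 := by
    have := Real.abs_exp_sub_one_le (x := y) (by rw [abs_of_nonneg hy]; linarith)
    rw [abs_of_nonneg hy] at this
    linarith [le_abs_self (Real.exp y - 1)]
  calc ‖known ω P χ w‖ ≤ B / 2 * M ^ w.length + 1 / 4 * (3 / 2 * (B * M ^ w.length)) :=
        (norm_add_le _ _).trans (add_le_add (hP w) (h₃.trans (by gcongr)))
    _ ≤ _ := by nlinarith

/-- The homological equations up to degree `k` can be solved. -/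
lemma exists_homological {ω : (Fin m → ℤ) → ℝ} {P : Ser m} {nr : Word m → Prop} {d : ℕ}
    {D M B : ℝ} (hD : 0 ≤ D) (hM : 0 ≤ M) (hB : 0 ≤ B)
    (hnr : ∀ w, nr (w.map bar) ↔ nr w)
    (hdiv : ∀ w : Word m, nr w → mom w = 0 → w.length ≤ d → 1 ≤ D * |wdiv ω w|)
    (hx : 2 * d ^ 2 * (D * B * M ^ 2) * (d + 1) ≤ 1 / 8) (hPs : SuppOn 3 0 P) (hPr : star' P = P)
    (hP : ∀ w, ‖P w‖ ≤ B / 2 * M ^ w.length) (k : ℕ) (hk : k ≤ d) :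
    ∃ χ : Ser m, SuppOn 3 0 χ ∧ star' χ = χ ∧ (∀ w, χ w ≠ 0 → w.length ≤ k) ∧
      (∀ w, ‖χ w‖ ≤ D * B * M ^ w.length) ∧ (∀ w, ‖lieH0 ω χ w‖ ≤ B * M ^ w.length) ∧
      (∀ w, nr w → w.length ≤ k → lieH0 ω χ w = -known ω P χ w) ∧ ∀ w, ¬nr w → χ w = 0 := by
  classical
  -- The induction carries the solution formula instead of the equation: it prescribes all
  -- coefficients up to degree `k`, including the zeros at the resonant words.
  suffices h : ∃ χ : Ser m, SuppOn 3 0 χ ∧ star' χ = χ ∧ (∀ w, χ w ≠ 0 → w.length ≤ k) ∧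
      (∀ w, ‖χ w‖ ≤ D * B * M ^ w.length) ∧ (∀ w, ‖lieH0 ω χ w‖ ≤ B * M ^ w.length) ∧
      (∀ w : Word m, w.length ≤ k →
        χ w = if nr w then Complex.I * known ω P χ w / wdiv ω w else 0) by
    obtain ⟨χ, h₁, h₂, h₃, h₄, h₅, h₆⟩ := h
    refine ⟨χ, h₁, h₂, h₃, h₄, h₅, fun w hw hl => ?_, fun w hw => ?_⟩
    · rw [lieH0, h₆ w hl, if_pos hw]
      by_cases hz : known ω P χ w = 0
      · simp [hz]
      have := hdiv w hw (hPs.known h₁ w hz).2 (hl.trans hk)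
      have hne : (wdiv ω w : ℂ) ≠ 0 := by
        rw [Ne, Complex.ofReal_eq_zero]
        intro h0
        rw [h0] at this
        norm_num at this
      field_simp
      rw [Complex.I_sq]
    · by_cases hl : w.length ≤ k
      · rw [h₆ w hl, if_neg hw]
      · by_contra hne
        exact hl (h₃ w hne)
  induction k with
  | zero =>
    have hz : SuppOn 3 0 (0 : Ser m) := fun w hw => absurd rfl hw
    refine ⟨0, hz, by funext; simp [star'], fun w hw => absurd rfl hw, fun w => ?_, fun w => ?_,
      fun w hw => ?_⟩
    · simp only [Pi.zero_apply, norm_zero]; positivity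
    · simp only [lieH0, Pi.zero_apply, mul_zero, norm_zero]; positivity
    · have : known ω P 0 w = 0 := by
        by_contra hne
        have := (hPs.known hz w hne).1
        omega
      simp [this]
  | succ k ih =>
    obtain ⟨χ, h₁, h₂, h₃, h₄, h₅, h₆⟩ := ih (by omega)
    have hQ := norm_known_le (by positivity) hM hB h₁ h₄ (fun w hw => (h₃ w hw).trans (by omega))
      hx hP h₅
    have hQs : SuppOn 3 0 (known ω P χ) := hPs.known h₁
    have hQr := star'_known (ω := ω) hPr h₂
    -- All degrees are recomputed from the old `known`. Nothing changes up to degree `k`, so `known`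
    -- stays the same up to degree `k + 1`, and the formula then holds with `χ'` on both sides.
    set χ' : Ser m := fun w => if w.length ≤ k + 1 then
      (if nr w then Complex.I * known ω P χ w / wdiv ω w else 0) else 0 with hχ'
    have hne : ∀ w, χ' w ≠ 0 → w.length ≤ k + 1 ∧ nr w ∧ known ω P χ w ≠ 0 ∧
        χ' w = Complex.I * known ω P χ w / wdiv ω w := by
      intro w hw
      simp only [hχ'] at hw ⊢
      split_ifs at hw ⊢ with g₁ g₂
      · exact ⟨g₁, g₂, fun h0 => hw (by simp [h0]), rfl⟩
      · exact absurd rfl hw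
      · exact absurd rfl hw
    have hs' : SuppOn 3 0 χ' := fun w hw => hQs w (hne w hw).2.2.1
    have hag : AgreeTo k χ χ' := fun w hw => by
      simp only [hχ']
      rw [if_pos (by omega), h₆ w hw]
    have hQQ := known_congr (ω := ω) hPs h₁ hs' hag
    have hdv : ∀ w, χ' w ≠ 0 → 1 ≤ D * |wdiv ω w| := fun w hw =>
      hdiv w (hne w hw).2.1 (hs' w hw).2 ((hne w hw).1.trans hk)
    have hdpos : ∀ w, χ' w ≠ 0 → 0 < |wdiv ω w| := fun w hw => by
      rcases (abs_nonneg (wdiv ω w)).lt_or_eq with h | h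
      · exact h
      · have := hdv w hw
        rw [← h] at this
        norm_num at this
    refine ⟨χ', hs', ?_, fun w hw => (hne w hw).1, fun w => ?_, fun w => ?_, fun w hw => ?_⟩
    -- Conjugation changes the sign of `I` and barring changes the sign of the divisor, so the
    -- quotient is preserved.
    · funext w
      have := congrFun hQr w
      simp only [star'] at this
      simp only [star', hχ', List.length_map, hnr, apply_ite (starRingEnd ℂ), map_div₀, map_mul,
        this, Complex.conj_I, Complex.conj_ofReal, wdiv_map_bar, map_zero]
      simp [neg_div_neg_eq]
    · by_cases hw : χ' w = 0
      · rw [hw, norm_zero]; positivity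
      · rw [(hne w hw).2.2.2, norm_div, norm_mul, Complex.norm_I, one_mul, Complex.norm_real,
          Real.norm_eq_abs, div_le_iff₀ (hdpos w hw)]
        calc _ ≤ B * M ^ w.length := hQ w ((hne w hw).1.trans hk)
          _ ≤ (D * |wdiv ω w|) * (B * M ^ w.length) :=
              le_mul_of_one_le_left (by positivity) (hdv w hw)
          _ = _ := by ring
    · by_cases hw : χ' w = 0
      · rw [lieH0, hw, mul_zero, norm_zero]; positivity
      · rw [lieH0, (hne w hw).2.2.2, norm_mul, norm_mul, norm_div, norm_mul, Complex.norm_I,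
          one_mul, one_mul, Complex.norm_real, Real.norm_eq_abs,
          mul_div_cancel₀ _ (hdpos w hw).ne']
        exact hQ w ((hne w hw).1.trans hk)
    · rw [← hQQ w hw]
      simp only [hχ']
      rw [if_pos hw]

/-! ### Lengths, frequencies and small divisors -/

lemma len_nonneg (j : Fin m → ℤ) : 0 ≤ len j := Real.sqrt_nonneg _

lemma len_eq_norm (j : Fin m → ℤ) : len j = ‖WithLp.toLp 2 (fun l => (j l : ℝ))‖ := by
  simp [len, EuclideanSpace.norm_eq]

lemma len_add_le (i j : Fin m → ℤ) : len (i + j) ≤ len i + len j := by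
  rw [len_eq_norm, len_eq_norm, len_eq_norm]
  refine le_trans (le_of_eq ?_) (norm_add_le _ _)
  congr 1
  ext l
  simp

@[simp] lemma len_zero : len (0 : Fin m → ℤ) = 0 := by simp [len]

@[simp] lemma len_units_smul (σ : ℤˣ) (j : Fin m → ℤ) : len ((σ : ℤ) • j) = len j := by
  rcases Int.units_eq_one_or σ with h | h <;> simp [h, len]

lemma len_sum_le {ι : Type*} (s : Finset ι) (g : ι → Fin m → ℤ) :
    len (∑ l ∈ s, g l) ≤ ∑ l ∈ s, len (g l) := by
  classical
  induction s using Finset.induction_on with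
  | empty => simp
  | insert a s ha ih =>
    rw [Finset.sum_insert ha, Finset.sum_insert ha]
    exact (len_add_le _ _).trans (add_le_add le_rfl ih)

lemma abs_apply_le_len (j : Fin m → ℤ) (l : Fin m) : |(j l : ℝ)| ≤ len j := by
  rw [len, ← Real.sqrt_sq_eq_abs]
  exact Real.sqrt_le_sqrt (Finset.single_le_sum (f := fun l => (j l : ℝ) ^ 2)
    (fun _ _ => sq_nonneg _) (Finset.mem_univ l))

lemma finite_len_le (R : ℝ) : {j : Fin m → ℤ | len j ≤ R}.Finite := by
  refine (Set.Finite.pi' (t := fun _ : Fin m => Set.Icc (-⌈R⌉) ⌈R⌉)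
    fun _ => Set.finite_Icc _ _).subset ?_
  intro j hj l
  have h := (abs_le.1 ((abs_apply_le_len j l).trans (hj.trans (Int.le_ceil R))))
  exact ⟨by exact_mod_cast h.1, by exact_mod_cast h.2⟩

section frequencies

variable {ω : (Fin m → ℤ) → ℝ} {A : Type*} {blk : Idx m → A} {C₀ C₁ C₂ β δ γ τ p : ℝ}

/-- The frequencies are comparable to `|j|^β`, up to finitely many of them. -/
lemma FrequencyAssumption.exists_comparable (hω : FrequencyAssumption ω blk C₀ C₁ C₂ β δ γ τ p) :
    ∃ C : ℝ, 1 ≤ C ∧ (∀ j, |ω j| ≤ C * max (len j) 1 ^ β) ∧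
      (∀ j, max (len j) 1 ^ β ≤ C * (|ω j| + 1)) ∧
      ∀ j, C ≤ len j → len j ^ β ≤ C₀ * ω j := by
  obtain ⟨ρ, hρ⟩ := hω.growth
  obtain ⟨Ω, hΩ⟩ := ((finite_len_le (m := m) (max ρ 1)).image fun j => |ω j|).bddAbove
  have hΩ' : ∀ j, len j ≤ max ρ 1 → |ω j| ≤ Ω := fun j hj => hΩ ⟨j, hj, rfl⟩
  have hC₀ := hω.C₀_pos
  have hβ : 0 ≤ β := by linarith [hω.one_lt_β]
  have hbig : ∀ j, max ρ 1 ≤ len j → len j ^ β ≤ C₀ * ω j ∧ ω j ≤ C₀ * len j ^ β := by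
    intro j hj
    have h1 : 0 < len j ^ β := Real.rpow_pos_of_pos
      (lt_of_lt_of_le one_pos ((le_max_right _ _).trans hj)) _
    obtain ⟨h2, h3⟩ := hρ j ((le_max_left _ _).trans hj)
    rw [div_le_div_iff₀ hC₀ h1] at h2
    rw [div_le_iff₀ h1] at h3
    exact ⟨by linarith, h3⟩
  have hmx : 0 ≤ max ρ 1 := zero_le_one.trans (le_max_right _ _)
  have hm0 : 0 ≤ (max ρ 1) ^ β := Real.rpow_nonneg hmx _
  refine ⟨1 + |Ω| + C₀ + max ρ 1 + (max ρ 1) ^ β, by linarith [abs_nonneg Ω], fun j => ?_,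
    fun j => ?_, fun j hj => ?_⟩
  · have h1 : (1 : ℝ) ≤ max (len j) 1 ^ β := Real.one_le_rpow (le_max_right _ _) hβ
    rcases le_total (len j) (max ρ 1) with h | h
    · nlinarith [hΩ' j h, le_abs_self Ω, abs_nonneg Ω]
    · have hlen : 1 ≤ len j := (le_max_right _ _).trans h
      have h2 := hbig j h
      rw [max_eq_left hlen] at h1 ⊢
      rw [abs_of_nonneg (by nlinarith)]
      nlinarith [abs_nonneg Ω]
  · rcases le_total (len j) (max ρ 1) with h | h
    · have h2 : max (len j) 1 ^ β ≤ (max ρ 1) ^ β :=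
        Real.rpow_le_rpow (le_trans zero_le_one (le_max_right _ _))
          (max_le h (le_max_right _ _)) hβ
      nlinarith [abs_nonneg Ω, abs_nonneg (ω j)]
    · rw [max_eq_left ((le_max_right _ _).trans h)]
      nlinarith [abs_nonneg Ω, abs_nonneg (ω j), hbig j h, le_abs_self (ω j)]
  · exact (hbig j (by linarith [abs_nonneg Ω])).1

/-- A vanishing divisor with at most two high modes is in one of the two resonant cases. -/
lemma FrequencyAssumption.resonant_of_divisor_eq_zero
    (hω : FrequencyAssumption ω blk C₀ C₁ C₂ β δ γ τ p) {N : ℕ}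
    (hN : ∀ j k, len j ≤ N → (N : ℝ) < len k → ω j ≠ ω k) {k : ℕ} (J : Fin k → Idx m)
    (hH : (Finset.univ.filter fun l => (N : ℝ) < len (J l).1).card ≤ 2)
    (h0 : divisor ω J = 0) : IsR0 ω N J ∨ IsR2 blk N J := by
  classical
  by_cases hlow : ∀ l, len (J l).1 ≤ N
  · exact Or.inl ⟨hlow, h0⟩
  right
  push Not at hlow
  obtain ⟨a, ha⟩ := hlow
  obtain ⟨n, π, hπ⟩ := hω.resonance k J h0
  have hpart : ∃ b, b ≠ a ∧ ω (J a).1 = ω (J b).1 ∧ (J a).2 = -(J b).2 := by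
    obtain ⟨x, rfl⟩ := π.surjective a
    rcases x with i | i
    · exact ⟨π (Sum.inr i), by simp, (hπ i).1, (hπ i).2⟩
    · exact ⟨π (Sum.inl i), by simp, (hπ i).1.symm, by rw [(hπ i).2, neg_neg]⟩
  obtain ⟨b, hba, hωab, hσ⟩ := hpart
  -- Equal frequencies cannot lie on both sides of the cut, so the resonant partner of a high mode
  -- is high. These two are then all the high modes, and the separation of the blocks puts them into
  -- one block.
  have hb : (N : ℝ) < len (J b).1 := by
    by_contra hb
    exact hN _ _ (not_lt.1 hb) ha hωab.symm
  have hpair : ({a, b} : Finset (Fin k)) = Finset.univ.filter fun l => (N : ℝ) < len (J l).1 := by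
    refine Finset.eq_of_subset_of_card_le ?_ ?_
    · intro l hl
      simp only [Finset.mem_insert, Finset.mem_singleton] at hl
      rcases hl with rfl | rfl <;> simpa
    · rwa [Finset.card_pair hba.symm]
  refine ⟨a, b, hba.symm, fun l => ?_, hσ, ?_⟩
  · have := Finset.ext_iff.1 hpair l
    simpa using this.symm
  · by_contra hne
    have h1 := hω.separation _ _ hne
    rw [hωab, sub_self, abs_zero] at h1
    have h2 : 0 < len (J a).1 ^ δ := Real.rpow_pos_of_pos ((Nat.cast_nonneg N).trans_lt ha) _
    have h3 : 0 ≤ len (J b).1 ^ δ := Real.rpow_nonneg (len_nonneg _) _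
    nlinarith [hω.C₂_pos]

lemma len_le_of_momentum_eq_zero {k : ℕ} {J : Fin k → Idx m} (h : momentum J = 0) (a : Fin k) :
    len (J a).1 ≤ ∑ l ∈ Finset.univ.erase a, len (J l).1 := by
  rw [momentum, ← Finset.add_sum_erase _ _ (Finset.mem_univ a), add_eq_zero_iff_eq_neg] at h
  rw [← len_units_smul (J a).2, h, ← neg_one_smul ℤ]
  refine (len_units_smul (-1) _).trans_le ((len_sum_le _ _).trans_eq ?_)
  exact Finset.sum_congr rfl fun l _ => len_units_smul _ _

set_option maxHeartbeats 1000000 in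
/-- Lower bound for the divisors with at most two high modes outside of the resonant cases. -/
lemma FrequencyAssumption.exists_divisor_bound
    (hω : FrequencyAssumption ω blk C₀ C₁ C₂ β δ γ τ p) :
    ∃ (C : ℝ) (N₀ : ℕ), 1 ≤ C ∧ ∀ N : ℕ, N₀ ≤ N →
      (∀ j k, len j ≤ N → (N : ℝ) < len k → ω j ≠ ω k) → ∀ d : ℕ, 1 ≤ d →
      ∀ (k : ℕ) (J : Fin k → Idx m), k ≤ d → momentum J = 0 →
      (Finset.univ.filter fun l => (N : ℝ) < len (J l).1).card ≤ 2 →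
      ¬IsR0 ω N J → ¬IsR2 blk N J →
      1 ≤ (1 + (C * d * N) ^ (τ * (1 + β / δ) * (d : ℝ) ^ p) / γ) * |divisor ω J| := by
  classical
  obtain ⟨C₃, hC₃, hω1, -, hω2⟩ := hω.exists_comparable
  obtain ⟨N₁, hN₁⟩ := hω.diophantine
  have hC₀ := hω.C₀_pos
  have hC₂ := hω.C₂_pos
  have hβ := hω.one_lt_β
  have hδ := hω.δ_pos
  have hγ := hω.γ_pos
  have hτ := hω.τ_pos
  have hp := hω.p_pos
  -- The second and third terms make the two high modes outweigh the low ones for equal signs and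
  -- for different blocks, respectively.
  set C₄ : ℝ := 1 + 2 * C₀ * C₃ + 2 * C₃ / C₂ with hC₄
  have hq : 0 < 2 * C₃ / C₂ := by positivity
  have hC₄1 : 1 ≤ C₄ := by nlinarith
  refine ⟨2 * C₄, max N₁ (max 1 ⌈C₃⌉₊), by linarith, ?_⟩
  intro N hN hsep d hd k J hk hmom hH hR0 hR2
  have hNN₁ : N₁ ≤ N := (le_max_left _ _).trans hN
  have hN1 : (1 : ℝ) ≤ N := by
    exact_mod_cast (le_max_left _ _).trans ((le_max_right _ _).trans hN)
  have hNC : C₃ ≤ N := (Nat.le_ceil _).trans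
    (by exact_mod_cast (le_max_right _ _).trans ((le_max_right _ _).trans hN))
  have hd1 : (1 : ℝ) ≤ d := by exact_mod_cast hd
  set e : ℝ := 1 + β / δ with he
  have he0 : 0 < β / δ := by positivity
  set y : ℝ := C₄ * d * N with hy
  have hdN : (1 : ℝ) ≤ d * N := by nlinarith
  have hy1 : 1 ≤ y := by rw [hy, mul_assoc]; nlinarith
  have hyd : d * N ≤ y := by rw [hy, mul_assoc]; nlinarith
  -- Below this second threshold the Diophantine condition is used with `N'` in place of `N`, which
  -- yields the exponent `τ (1 + β / δ)`. Above it, `|j| ^ δ` already exceeds `y ^ β`, the size of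
  -- the low frequencies.
  set N' : ℕ := ⌈y ^ e⌉₊ with hN'
  have hye : y ^ e ≤ N' := Nat.le_ceil _
  have hyy : y ≤ y ^ e := by
    conv_lhs => rw [← Real.rpow_one y]
    exact Real.rpow_le_rpow_of_exponent_le hy1 (by linarith)
  have hyβ : y ^ (β / δ) ≤ y ^ e := Real.rpow_le_rpow_of_exponent_le hy1 (by linarith)
  have hNN' : (N : ℝ) ≤ N' := by nlinarith
  have hdiv : divisor ω J ≠ 0 := fun h0 =>
    (hω.resonant_of_divisor_eq_zero hsep J hH h0).elim hR0 hR2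
  have hC0 : 0 ≤ (2 * C₄ * d * N) ^ (τ * e * (d : ℝ) ^ p) / γ := by positivity
  by_cases hall : ∀ l, len (J l).1 ≤ N'
  · have h1 := hN₁ N' (hNN₁.trans (by exact_mod_cast hNN')) k J hall hdiv
    have hN'pos : (1 : ℝ) ≤ N' := hN1.trans hNN'
    have h2 : (N' : ℝ) ≤ (2 * C₄ * d * N) ^ e := by
      have h3 : (N' : ℝ) < y ^ e + 1 := Nat.ceil_lt_add_one (by positivity)
      have h4 : (2 * C₄ * d * N) ^ e = 2 ^ e * y ^ e := by
        rw [← Real.mul_rpow (by norm_num) (by linarith), hy]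
        ring_nf
      have h5 : (2 : ℝ) ≤ 2 ^ e := by
        conv_lhs => rw [← Real.rpow_one 2]
        exact Real.rpow_le_rpow_of_exponent_le (by norm_num) (by linarith)
      rw [h4]
      nlinarith
    have h3 : (N' : ℝ) ^ (τ * (k : ℝ) ^ p) ≤ (2 * C₄ * d * N) ^ (τ * e * (d : ℝ) ^ p) := by
      calc (N' : ℝ) ^ (τ * (k : ℝ) ^ p) ≤ (N' : ℝ) ^ (τ * (d : ℝ) ^ p) := by
            refine Real.rpow_le_rpow_of_exponent_le hN'pos ?_
            gcongr
        _ ≤ ((2 * C₄ * d * N) ^ e) ^ (τ * (d : ℝ) ^ p) := by gcongr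
        _ = _ := by
            rw [← Real.rpow_mul (by positivity)]
            ring_nf
    have h4 : 0 < (N' : ℝ) ^ (τ * (k : ℝ) ^ p) := by positivity
    rw [div_le_iff₀ h4] at h1
    have h5 : γ ≤ |divisor ω J| * (2 * C₄ * d * N) ^ (τ * e * (d : ℝ) ^ p) :=
      h1.trans (by gcongr)
    have h6 : 1 ≤ (2 * C₄ * d * N) ^ (τ * e * (d : ℝ) ^ p) / γ * |divisor ω J| := by
      rw [div_mul_eq_mul_div, le_div_iff₀ hγ]
      linarith
    nlinarith [abs_nonneg (divisor ω J)]
  · suffices h : 1 ≤ |divisor ω J| by nlinarith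
    push Not at hall
    obtain ⟨a, ha⟩ := hall
    have haN : (N : ℝ) < len (J a).1 := hNN'.trans_lt ha
    -- The other modes have to balance the momentum of `a`. If all were low, their lengths would sum
    -- to at most `d N`, which is below `N'`.
    have hb : ∃ b, b ≠ a ∧ (N : ℝ) < len (J b).1 := by
      by_contra! hb
      have h1 := len_le_of_momentum_eq_zero hmom a
      have h2 : ∑ l ∈ Finset.univ.erase a, len (J l).1 ≤ ∑ l ∈ Finset.univ.erase a, (N : ℝ) :=
        Finset.sum_le_sum fun l hl => hb l (Finset.ne_of_mem_erase hl)
      rw [Finset.sum_const, nsmul_eq_mul, Finset.card_erase_of_mem (Finset.mem_univ a),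
        Finset.card_univ, Fintype.card_fin] at h2
      have h3 : ((k - 1 : ℕ) : ℝ) ≤ d := by exact_mod_cast (by omega)
      nlinarith
    obtain ⟨b, hba, hbN⟩ := hb
    have hpair : ({a, b} : Finset (Fin k)) =
        Finset.univ.filter fun l => (N : ℝ) < len (J l).1 := by
      refine Finset.eq_of_subset_of_card_le ?_ ?_
      · intro l hl
        simp only [Finset.mem_insert, Finset.mem_singleton] at hl
        rcases hl with rfl | rfl <;> simpa
      · rwa [Finset.card_pair hba.symm]
    have hiff : ∀ l, (N : ℝ) < len (J l).1 ↔ l = a ∨ l = b := fun l => by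
      simpa using (Finset.ext_iff.1 hpair l).symm
    have hωa := hω2 _ (hNC.trans haN.le)
    have hωb := hω2 _ (hNC.trans hbN.le)
    have hrest : |∑ l ∈ (Finset.univ.erase a).erase b, (((J l).2 : ℤ) : ℝ) * ω (J l).1| ≤
        d * (C₃ * (N : ℝ) ^ β) := by
      refine (Finset.abs_sum_le_sum_abs _ _).trans ?_
      refine (Finset.sum_le_card_nsmul _ _ (C₃ * (N : ℝ) ^ β) ?_).trans ?_
      · intro l hl
        simp only [Finset.mem_erase] at hl
        have hl' : len (J l).1 ≤ N := by
          by_contra h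
          exact ((hiff l).1 (not_le.1 h)).elim hl.2.1 hl.1
        have hs : |(((J l).2 : ℤ) : ℝ)| = 1 := by
          rcases Int.units_eq_one_or (J l).2 with h | h <;> simp [h]
        rw [abs_mul, hs, one_mul]
        refine (hω1 _).trans ?_
        have hβ0 : 0 ≤ β := by linarith
        gcongr
        exact max_le hl' hN1
      · rw [nsmul_eq_mul]
        gcongr
        refine (Finset.card_le_univ _).trans ?_
        simpa using hk
    have hdec : divisor ω J = (((J a).2 : ℤ) : ℝ) * ω (J a).1 + ((((J b).2 : ℤ) : ℝ) * ω (J b).1 +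
        ∑ l ∈ (Finset.univ.erase a).erase b, (((J l).2 : ℤ) : ℝ) * ω (J l).1) := by
      rw [divisor, ← Finset.add_sum_erase _ _ (Finset.mem_univ a),
        ← Finset.add_sum_erase _ _ (Finset.mem_erase.2 ⟨hba, Finset.mem_univ b⟩)]
    have hNβ : 1 ≤ (N : ℝ) ^ β := Real.one_le_rpow hN1 (by linarith)
    have hdNβ : (d : ℝ) * N ^ β ≤ (d * N : ℝ) ^ β := by
      rw [Real.mul_rpow (by linarith) (by linarith)]
      gcongr
      conv_lhs => rw [← Real.rpow_one (d : ℝ)]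
      exact Real.rpow_le_rpow_of_exponent_le hd1 hβ.le
    have hyC : C₄ * (d * N ^ β) ≤ y ^ β := by
      rw [hy, mul_assoc, Real.mul_rpow (by linarith) (by linarith)]
      have : C₄ ≤ C₄ ^ β := by
        conv_lhs => rw [← Real.rpow_one C₄]
        exact Real.rpow_le_rpow_of_exponent_le hC₄1 hβ.le
      gcongr
    have hone : 1 ≤ (d : ℝ) * (C₃ * (N : ℝ) ^ β) :=
      one_le_mul_of_one_le_of_one_le hd1 (one_le_mul_of_one_le_of_one_le hC₃ hNβ)
    have hdNβ0 : 0 < (d : ℝ) * N ^ β := by positivity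
    -- the two high modes dominate
    suffices h : 2 * (d * (C₃ * (N : ℝ) ^ β)) ≤
        |(((J a).2 : ℤ) : ℝ) * ω (J a).1 + (((J b).2 : ℤ) : ℝ) * ω (J b).1| by
      rw [hdec, ← add_assoc]
      have := abs_sub_abs_le_abs_sub
        ((((J a).2 : ℤ) : ℝ) * ω (J a).1 + (((J b).2 : ℤ) : ℝ) * ω (J b).1)
        (-∑ l ∈ (Finset.univ.erase a).erase b, (((J l).2 : ℤ) : ℝ) * ω (J l).1)
      rw [abs_neg, sub_neg_eq_add] at this
      linarith
    -- With opposite signs the word is not in R2, so the two modes lie in different blocks and their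
    -- frequencies are separated. With equal signs both frequencies are nonnegative and add up.
    by_cases hσ : (J a).2 = -(J b).2
    · have hblk : blk (J a) ≠ blk (J b) := fun h => hR2 ⟨a, b, hba.symm, hiff, hσ, h⟩
      have h1 := hω.separation _ _ hblk
      have h2 : |(((J a).2 : ℤ) : ℝ) * ω (J a).1 + (((J b).2 : ℤ) : ℝ) * ω (J b).1| =
          |ω (J a).1 - ω (J b).1| := by
        rw [hσ]
        rcases Int.units_eq_one_or (J b).2 with h | h
        · rw [h, ← abs_neg]
          congr 1
          push_cast
          ring
        · rw [h]
          congr 1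
          push_cast
          ring
      rw [h2]
      refine le_trans ?_ h1
      have h3 : 0 ≤ len (J b).1 ^ δ := Real.rpow_nonneg (len_nonneg _) _
      have h4 : y ^ β ≤ len (J a).1 ^ δ := by
        calc y ^ β = (y ^ (β / δ)) ^ δ := by
              rw [← Real.rpow_mul (by linarith), div_mul_cancel₀ _ hδ.ne']
          _ ≤ len (J a).1 ^ δ := by
              gcongr
              linarith
      have h5 : 2 * C₃ / C₂ * (d * N ^ β) ≤ len (J a).1 ^ δ := by
        refine le_trans ?_ (hyC.trans h4)
        gcongr
        rw [hC₄]
        nlinarith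
      have h6 : C₂ * (2 * C₃ / C₂ * (d * N ^ β)) = 2 * (d * (C₃ * (N : ℝ) ^ β)) := by
        field_simp
      rw [← h6]
      gcongr
      linarith
    · have hσ' : (J a).2 = (J b).2 := by
        rcases Int.units_eq_one_or (J a).2 with h | h <;>
          rcases Int.units_eq_one_or (J b).2 with h' | h' <;> simp_all
      have ha0 : 0 ≤ len (J a).1 ^ β := Real.rpow_nonneg (len_nonneg _) _
      have hb0 : 0 ≤ len (J b).1 ^ β := Real.rpow_nonneg (len_nonneg _) _
      have hs : |(((J b).2 : ℤ) : ℝ)| = 1 := by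
        rcases Int.units_eq_one_or (J b).2 with h | h <;> simp [h]
      rw [hσ', ← mul_add, abs_mul, hs, one_mul]
      refine le_trans ?_ (le_abs_self _)
      have h4 : y ^ β ≤ len (J a).1 ^ β := by
        gcongr
        linarith
      have h5 : C₀ * (2 * (d * (C₃ * (N : ℝ) ^ β))) ≤ C₀ * ω (J a).1 := by
        refine le_trans ?_ ((hyC.trans h4).trans hωa)
        calc C₀ * (2 * (d * (C₃ * (N : ℝ) ^ β))) = (2 * C₀ * C₃) * (d * N ^ β) := by ring
          _ ≤ _ := by
            gcongr
            rw [hC₄]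
            linarith
      have h6 := le_of_mul_le_mul_left h5 hC₀
      have h7 : 0 ≤ ω (J b).1 := by
        by_contra h
        nlinarith
      linarith

end frequencies

/-! ### The norm of `ℓ²` with values in `[0, ∞]` -/

section ennreal

variable {ι : Type*}

lemma sum_mul_sq_le (s : Finset ι) (f g : ι → ℝ≥0∞) :
    (∑ i ∈ s, f i * g i) ^ 2 ≤ (∑ i ∈ s, f i ^ 2) * ∑ i ∈ s, g i ^ 2 := by
  have h := ENNReal.inner_le_Lp_mul_Lq s f g (p := 2) (q := 2) (by norm_num [Real.holderConjugate_iff])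
  have e : ∀ x : ℝ≥0∞, (x ^ (1 / 2 : ℝ)) ^ 2 = x := fun x => by
    rw [← ENNReal.rpow_natCast, ← ENNReal.rpow_mul]; norm_num
  calc _ ≤ _ := pow_le_pow_left' h 2
    _ = _ := by
      rw [mul_pow, e, e]
      norm_cast

/-- The Cauchy–Schwarz inequality for sums in `[0, ∞]`. -/
lemma tsum_mul_sq_le (f g : ι → ℝ≥0∞) :
    (∑' i, f i * g i) ^ 2 ≤ (∑' i, f i ^ 2) * ∑' i, g i ^ 2 := by
  have h : ∀ s : Finset ι, (∑ i ∈ s, f i * g i) ≤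
      ((∑' i, f i ^ 2) * ∑' i, g i ^ 2) ^ (1 / 2 : ℝ) := by
    intro s
    have h1 : (∑ i ∈ s, f i * g i) ^ 2 ≤ (∑' i, f i ^ 2) * ∑' i, g i ^ 2 :=
      (sum_mul_sq_le s f g).trans (mul_le_mul' (ENNReal.sum_le_tsum s) (ENNReal.sum_le_tsum s))
    calc _ = ((∑ i ∈ s, f i * g i) ^ 2) ^ (1 / 2 : ℝ) := by
          rw [← ENNReal.rpow_natCast, ← ENNReal.rpow_mul]; norm_num
      _ ≤ _ := by gcongr
  calc _ ≤ (((∑' i, f i ^ 2) * ∑' i, g i ^ 2) ^ (1 / 2 : ℝ)) ^ 2 :=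
        pow_le_pow_left' (ENNReal.summable.tsum_le_of_sum_le h) 2
    _ = _ := by rw [← ENNReal.rpow_natCast, ← ENNReal.rpow_mul]; norm_num

/-- The norm of `ℓ²`, with values in `[0, ∞]`. -/
def l2 (z : ι → ℝ≥0∞) : ℝ≥0∞ := (∑' J, z J ^ 2) ^ (1 / 2 : ℝ)

lemma l2_sq (z : ι → ℝ≥0∞) : l2 z ^ 2 = ∑' J, z J ^ 2 := by
  rw [l2, ← ENNReal.rpow_natCast, ← ENNReal.rpow_mul]; norm_num

lemma l2_le_iff {z : ι → ℝ≥0∞} {C : ℝ≥0∞} : l2 z ≤ C ↔ ∑' J, z J ^ 2 ≤ C ^ 2 := by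
  rw [← l2_sq]
  exact ((ENNReal.pow_right_strictMono two_ne_zero).le_iff_le).symm

lemma l2_mono {y z : ι → ℝ≥0∞} (h : ∀ J, y J ≤ z J) : l2 y ≤ l2 z := by
  unfold l2
  gcongr with J
  exact h J

lemma le_l2 (z : ι → ℝ≥0∞) (J : ι) : z J ≤ l2 z := by
  have : z J ^ 2 ≤ l2 z ^ 2 := by rw [l2_sq]; exact ENNReal.le_tsum (f := fun J => z J ^ 2) J
  exact (ENNReal.pow_right_strictMono two_ne_zero).le_iff_le.1 this

lemma l2_const_mul (c : ℝ≥0∞) (z : ι → ℝ≥0∞) : l2 (fun J => c * z J) = c * l2 z := by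
  simp only [l2, mul_pow]
  rw [ENNReal.tsum_mul_left, ENNReal.mul_rpow_of_nonneg _ _ (by norm_num), ← ENNReal.rpow_natCast,
    ← ENNReal.rpow_mul]
  norm_num

lemma tsum_mul_le_l2 (f g : ι → ℝ≥0∞) : ∑' i, f i * g i ≤ l2 f * l2 g := by
  have h := tsum_mul_sq_le f g
  rw [← l2_sq f, ← l2_sq g, ← mul_pow] at h
  exact (ENNReal.pow_right_strictMono two_ne_zero).le_iff_le.1 h

lemma l2_add_le (y z : ι → ℝ≥0∞) : l2 (fun J => y J + z J) ≤ l2 y + l2 z := by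
  rw [l2_le_iff]
  calc ∑' J, (y J + z J) ^ 2 = ∑' J, y J ^ 2 + 2 * ∑' J, y J * z J + ∑' J, z J ^ 2 := by
        rw [← ENNReal.tsum_mul_left, ← ENNReal.tsum_add, ← ENNReal.tsum_add]
        exact tsum_congr fun J => by ring
    _ ≤ l2 y ^ 2 + 2 * (l2 y * l2 z) + l2 z ^ 2 := by
        rw [l2_sq, l2_sq]
        gcongr
        exact tsum_mul_le_l2 y z
    _ = _ := by ring

end ennreal

/-! ### Derivatives of monomials and convolution estimates -/

section mon

variable {R : Type*} [CommSemiring R]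

lemma mon_smul (θ : R) (u : Idx m → R) (w : Word m) :
    mon (fun J => θ * u J) w = θ ^ w.length * mon u w := by
  induction w with
  | nil => simp
  | cons J w ih => rw [mon_cons, mon_cons, ih, List.length_cons]; ring

/-- The derivative of the monomial `u^w` in the direction `h`. -/
def dmon (u h : Idx m → R) (w : Word m) : R := posSum (fun p I r => mon u p * h I * mon u r) w

@[simp] lemma dmon_nil (u h : Idx m → R) : dmon u h [] = 0 := by simp [dmon]

@[simp] lemma dmon_cons (u h : Idx m → R) (J : Idx m) (w : Word m) :
    dmon u h (J :: w) = h J * mon u w + u J * dmon u h w := by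
  rw [dmon, posSum_cons, dmon, posSum, posSum, Finset.mul_sum]
  simp [mul_assoc]

lemma dmon_mul_mon (b a y : Idx m → R) (w : Word m) :
    dmon b a w * mon y w = dmon (fun J => b J * y J) (fun J => a J * y J) w := by
  have h : ∀ w : Word m, mon b w * mon y w = mon (fun J => b J * y J) w := fun w => by
    induction w with
    | nil => simp
    | cons J w ih => simp only [mon_cons, ← ih]; ring
  induction w with
  | nil => simp
  | cons J w ih => simp only [dmon_cons, mon_cons, ← ih, ← h]; ring

lemma dmon_smul (θ : R) (b a : Idx m → R) (w : Word m) :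
    dmon (fun J => θ * b J) (fun J => θ * a J) w = θ ^ w.length * dmon b a w := by
  induction w with
  | nil => simp
  | cons J w ih => rw [dmon_cons, dmon_cons, mon_smul, ih, List.length_cons]; ring

end mon

lemma posSum_congr {R : Type*} [AddCommMonoid R] {g h : Word m → Idx m → Word m → R} {w : Word m}
    (H : ∀ p I r, p ++ I :: r = w → g p I r = h p I r) : posSum g w = posSum h w := by
  refine Finset.sum_congr rfl fun i _ => H _ _ _ ?_
  simp

lemma mon_mono {y z : Idx m → ℝ≥0∞} (h : ∀ J, y J ≤ z J) (w : Word m) : mon y w ≤ mon z w := by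
  induction w with
  | nil => simp
  | cons J w ih => simp only [mon_cons]; gcongr; exact h J

lemma dmon_le (y z : Idx m → ℝ≥0∞) (w : Word m) : dmon y z w ≤ mon (fun J => y J + z J) w := by
  induction w with
  | nil => simp
  | cons J w ih =>
    rw [dmon_cons, mon_cons, add_mul, add_comm]
    gcongr
    · exact mon_mono (fun J => le_self_add) w

/-- The sum of the monomials of degree `k`. -/
lemma tsum_mon_length (y : Idx m → ℝ≥0∞) (k : ℕ) :
    ∑' w : Word m, (if w.length = k then mon y w else 0) = (∑' J, y J) ^ k := by
  induction k with
  | zero =>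
    rw [tsum_eq_single []]
    · simp
    · intro w hw
      rw [if_neg (by simpa using hw)]
  | succ k ih =>
    have hinj : Function.Injective fun x : Idx m × Word m => x.1 :: x.2 := by
      rintro ⟨I, v⟩ ⟨J, w⟩ h
      simpa using h
    rw [← hinj.tsum_eq, ENNReal.tsum_prod', pow_succ', ← ih, ← ENNReal.tsum_mul_right]
    · refine tsum_congr fun J => ?_
      rw [← ENNReal.tsum_mul_left]
      refine tsum_congr fun w => ?_
      simp [mul_ite]
    · intro w hw
      rcases w with _ | ⟨J, w⟩
      · simp at hw
      · exact ⟨(J, w), rfl⟩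

/-- The sum of all monomials is a geometric series. -/
lemma tsum_mon (y : Idx m → ℝ≥0∞) : ∑' w : Word m, mon y w = (1 - ∑' J, y J)⁻¹ := by
  rw [← ENNReal.tsum_geometric]
  simp_rw [← tsum_mon_length]
  rw [ENNReal.tsum_comm]
  refine tsum_congr fun w => ?_
  rw [tsum_eq_single w.length fun k hk => if_neg (Ne.symm hk), if_pos rfl]

lemma tsum_mon_le_two {y : Idx m → ℝ≥0∞} (h : ∑' J, y J ≤ 2⁻¹) : ∑' w : Word m, mon y w ≤ 2 := by
  rw [tsum_mon, ENNReal.inv_le_iff_inv_le, ← ENNReal.one_sub_inv_two]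
  exact tsub_le_tsub_left h 1

open Classical in
lemma tsum_ite_mom_le (μ : Fin m → ℤ) :
    ∑' J : Idx m, (if (J.2 : ℤ) • J.1 = μ then (1 : ℝ≥0∞) else 0) ≤ 2 := by
  have h := tsum_eq_sum_jn [((μ, 1) : Idx m)]
    (fun J : Idx m => if (J.2 : ℤ) • J.1 = μ then (1 : ℝ≥0∞) else 0) (by
      intro J hJ
      by_contra hne
      exact hJ (if_neg fun h => hne (by simp [h])))
  rw [h]
  refine (Finset.sum_le_card_nsmul _ _ 1 fun σ _ => ?_).trans ?_
  · split_ifs <;> simp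
  · simp

open Classical in
/-- Young's inequality for products whose momentum is prescribed. -/
lemma l2_tsum_dmon_le (α β : Idx m → ℝ≥0∞) :
    l2 (fun J : Idx m => ∑' w : Word m, if mom w = (J.2 : ℤ) • J.1 then dmon β α w else 0) ≤
      2 * l2 α * (∑' w : Word m, mon β w) ^ 2 := by
  -- Schur's test on triples `(p, I, r)`: the kernel `c` is split into two square roots for
  -- Cauchy–Schwarz. The momentum constraint `e` leaves at most two choices of `I` for given `p, r,
  -- J`, and at most two choices of `J` for a given triple.
  set c : Word m × Idx m × Word m → ℝ≥0∞ := fun x => mon β x.1 * mon β x.2.2 with hc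
  set e : Idx m → Word m × Idx m × Word m → ℝ≥0∞ := fun J x =>
    if mom (x.1 ++ x.2.1 :: x.2.2) = (J.2 : ℤ) • J.1 then 1 else 0 with he
  have e_sq : ∀ J x, e J x ^ 2 = e J x := fun J x => by
    simp only [he]
    split_ifs <;> simp
  have root : ∀ a : ℝ≥0∞, (a ^ (1 / 2 : ℝ)) ^ 2 = a := fun a => by
    rw [← ENNReal.rpow_natCast, ← ENNReal.rpow_mul]; norm_num
  have h1 : ∀ J : Idx m, (∑' w : Word m, if mom w = (J.2 : ℤ) • J.1 then dmon β α w else 0) =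
      ∑' x, (e J x * c x ^ (1 / 2 : ℝ)) * (c x ^ (1 / 2 : ℝ) * (e J x * α x.2.1)) := by
    intro J
    have : ∀ w : Word m, (if mom w = (J.2 : ℤ) • J.1 then dmon β α w else 0) =
        posSum (fun p I r => e J (p, I, r) * (mon β p * α I * mon β r)) w := by
      intro w
      by_cases hw : mom w = (J.2 : ℤ) • J.1
      · rw [if_pos hw, dmon]
        refine posSum_congr fun p I r h => ?_
        simp only [he]
        rw [h, if_pos hw, one_mul]
      · rw [if_neg hw, posSum_congr (h := fun _ _ _ => 0)]
        · simp [posSum]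
        · intro p I r h
          simp only [he]
          rw [h, if_neg hw, zero_mul]
    rw [tsum_congr this, tsum_posSum]
    refine tsum_congr fun x => ?_
    calc _ = e J x * (c x * α x.2.1) := by simp only [hc]; ring
      _ = e J x ^ 2 * ((c x ^ (1 / 2 : ℝ)) ^ 2 * α x.2.1) := by rw [e_sq, root]
      _ = _ := by ring
  have h2 : ∀ (p r : Word m) (J : Idx m), ∑' I, e J (p, I, r) ≤ 2 := by
    intro p r J
    refine (ENNReal.tsum_le_tsum fun I => ?_).trans
      (tsum_ite_mom_le ((J.2 : ℤ) • J.1 - mom p - mom r))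
    simp only [he, mom_append, mom_cons]
    split_ifs with g₁ g₂
    · exact le_rfl
    · exact absurd (by rw [← g₁]; abel) g₂
    · simp
    · simp
  have h3 : ∀ x, ∑' J, e J x ≤ 2 := by
    intro x
    refine (ENNReal.tsum_le_tsum fun J => ?_).trans
      (tsum_ite_mom_le (mom (x.1 ++ x.2.1 :: x.2.2)))
    simp only [he]
    split_ifs with g₁ g₂
    · exact le_rfl
    · exact absurd g₁.symm g₂
    · simp
    · simp
  set S := ∑' w : Word m, mon β w with hS
  have h4 : ∀ J, ∑' x, (e J x * c x ^ (1 / 2 : ℝ)) ^ 2 ≤ 2 * S ^ 2 := by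
    intro J
    calc ∑' x, (e J x * c x ^ (1 / 2 : ℝ)) ^ 2 = ∑' x, e J x * c x := by
          refine tsum_congr fun x => ?_
          rw [mul_pow, root, e_sq]
      _ = ∑' p, ∑' r, ∑' I, e J (p, I, r) * (mon β p * mon β r) := by
          rw [ENNReal.tsum_prod']
          refine tsum_congr fun p => ?_
          rw [ENNReal.tsum_prod', ENNReal.tsum_comm]
      _ ≤ ∑' p, ∑' r, 2 * (mon β p * mon β r) := by
          gcongr with p r
          rw [ENNReal.tsum_mul_right]
          gcongr
          exact h2 p r J
      _ = 2 * S ^ 2 := by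
          simp_rw [ENNReal.tsum_mul_left, ENNReal.tsum_mul_right]
          rw [sq]
  have h5 : ∑' J, ∑' x, (c x ^ (1 / 2 : ℝ) * (e J x * α x.2.1)) ^ 2 ≤ 2 * S ^ 2 * l2 α ^ 2 := by
    calc _ = ∑' x, (∑' J, e J x) * (c x * α x.2.1 ^ 2) := by
          rw [ENNReal.tsum_comm]
          refine tsum_congr fun x => ?_
          rw [← ENNReal.tsum_mul_right]
          refine tsum_congr fun J => ?_
          rw [mul_pow, mul_pow, root, e_sq]
          ring
      _ ≤ ∑' x, 2 * (c x * α x.2.1 ^ 2) := by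
          gcongr with x
          exact h3 x
      _ = 2 * ∑' p, ∑' I, ∑' r, mon β p * mon β r * α I ^ 2 := by
          rw [ENNReal.tsum_mul_left, ENNReal.tsum_prod']
          congr 1
          refine tsum_congr fun p => ?_
          rw [ENNReal.tsum_prod']
      _ = 2 * S ^ 2 * l2 α ^ 2 := by
          simp_rw [ENNReal.tsum_mul_right, ENNReal.tsum_mul_left, ENNReal.tsum_mul_right]
          rw [l2_sq, sq]
          ring
  rw [l2_le_iff]
  calc _ ≤ ∑' J, (2 * S ^ 2) * ∑' x, (c x ^ (1 / 2 : ℝ) * (e J x * α x.2.1)) ^ 2 := by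
        gcongr with J
        rw [h1]
        exact (tsum_mul_sq_le _ _).trans (mul_le_mul' (h4 J) le_rfl)
    _ ≤ (2 * S ^ 2) * (2 * S ^ 2 * l2 α ^ 2) := by
        rw [ENNReal.tsum_mul_left]
        gcongr
    _ = _ := by ring

/-- A weight `a` for which products with prescribed momentum are bounded in the weighted `ℓ²`. -/
structure Tame (a : Idx m → ℝ) (b : Idx m → ℝ≥0∞) (K : ℝ≥0∞) : Prop where
  one_le : ∀ J, 1 ≤ a J
  bar : ∀ J, a (bar J) = a J
  one_le_b : ∀ J, 1 ≤ b J
  -- One letter carries the weight `a` and all others carry `b`. A constant that is exponential in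
  -- the degree is harmless, because it only shrinks the admissible radius.
  tame : ∀ (J : Idx m) (w : Word m), mom w = (J.2 : ℤ) • J.1 → w ≠ [] →
    ENNReal.ofReal (a J) ≤ K ^ w.length * dmon b (fun I => ENNReal.ofReal (a I)) w
  l2_le : l2 (fun J => b J / ENNReal.ofReal (a J)) ≤ 1

/-- The weighted `ℓ²` norm, with values in `[0, ∞]`. -/
def nrm (a : Idx m → ℝ) (y : Idx m → ℝ≥0∞) : ℝ≥0∞ := l2 (fun J => ENNReal.ofReal (a J) * y J)

lemma nrm_mono {a : Idx m → ℝ} {y z : Idx m → ℝ≥0∞} (h : ∀ J, y J ≤ z J) : nrm a y ≤ nrm a z :=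
  l2_mono fun J => by gcongr; exact h J

lemma nrm_add_le (a : Idx m → ℝ) (y z : Idx m → ℝ≥0∞) :
    nrm a (fun J => y J + z J) ≤ nrm a y + nrm a z := by
  unfold nrm
  simp_rw [mul_add]
  exact l2_add_le _ _

lemma nrm_const_mul (a : Idx m → ℝ) (c : ℝ≥0∞) (y : Idx m → ℝ≥0∞) :
    nrm a (fun J => c * y J) = c * nrm a y := by
  unfold nrm
  rw [← l2_const_mul]
  congr 1
  funext J
  ring

/-- By Cauchy–Schwarz the factors with the lighter weight `b` are summable. This puts the side
factors of a monomial into `ℓ¹`, as Young's inequality requires. -/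
lemma tsum_mul_le_nrm {a : Idx m → ℝ} (ha : ∀ J, 1 ≤ a J) (b y : Idx m → ℝ≥0∞) :
    ∑' J, b J * y J ≤ l2 (fun J => b J / ENNReal.ofReal (a J)) * nrm a y := by
  refine le_trans (le_of_eq (tsum_congr fun J => ?_)) (tsum_mul_le_l2 _ _)
  have h0 : ENNReal.ofReal (a J) ≠ 0 := by
    rw [Ne, ENNReal.ofReal_eq_zero, not_le]
    linarith [ha J]
  rw [← mul_assoc, ENNReal.div_mul_cancel h0 ENNReal.ofReal_ne_top]

section Tame

variable {a : Idx m → ℝ} {b : Idx m → ℝ≥0∞} {K : ℝ≥0∞}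

lemma Tame.tsum_b_le (ha : Tame a b K) (y : Idx m → ℝ≥0∞) : ∑' J, b J * y J ≤ nrm a y :=
  (tsum_mul_le_nrm ha.one_le b y).trans (mul_le_of_le_one_left' ha.l2_le)

lemma Tame.tsum_le (ha : Tame a b K) (y : Idx m → ℝ≥0∞) : ∑' J, y J ≤ nrm a y :=
  (ENNReal.tsum_le_tsum fun J => le_mul_of_one_le_left' (ha.one_le_b J)).trans (ha.tsum_b_le y)

/-- Series of monomials with bounded coefficients. -/
lemma Tame.tsum_mon_le (ha : Tame a b K) {θ : ℝ≥0∞} {y : Idx m → ℝ≥0∞}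
    (h : θ * nrm a y ≤ 2⁻¹) : ∑' w : Word m, θ ^ w.length * mon y w ≤ 2 := by
  simp_rw [← mon_smul]
  refine tsum_mon_le_two ?_
  rw [ENNReal.tsum_mul_left]
  exact (mul_le_mul' le_rfl (ha.tsum_le y)).trans h

end Tame

/-- The basic estimate for vector fields in the weighted spaces. -/
lemma nrm_tsum_le {a : Idx m → ℝ} {b : Idx m → ℝ≥0∞} (ha : ∀ J, 1 ≤ a J)
    (hl2 : l2 (fun J => b J / ENNReal.ofReal (a J)) ≤ 1)
    {v : Idx m → Word m → ℝ≥0∞} {ε θ : ℝ≥0∞}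
    (hv : ∀ J w, v J w ≠ 0 → mom w = (J.2 : ℤ) • J.1 ∧ ENNReal.ofReal (a J) * v J w ≤
      ε * (θ ^ w.length * dmon b (fun I => ENNReal.ofReal (a I)) w))
    {y : Idx m → ℝ≥0∞} (h : θ * nrm a y ≤ 2⁻¹) :
    nrm a (fun J => ∑' w, v J w * mon y w) ≤ 8 * ε * θ * nrm a y := by
  classical
  set β : Idx m → ℝ≥0∞ := fun J => θ * (b J * y J)
  set α : Idx m → ℝ≥0∞ := fun J => θ * (ENNReal.ofReal (a J) * y J)
  have hβ : ∑' w, mon β w ≤ 2 := by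
    refine tsum_mon_le_two ?_
    rw [ENNReal.tsum_mul_left]
    exact (mul_le_mul' le_rfl ((tsum_mul_le_nrm ha b y).trans (mul_le_of_le_one_left' hl2))).trans h
  have key : ∀ J : Idx m, ENNReal.ofReal (a J) * ∑' w, v J w * mon y w ≤
      ε * ∑' w : Word m, if mom w = (J.2 : ℤ) • J.1 then dmon β α w else 0 := by
    intro J
    rw [← ENNReal.tsum_mul_left, ← ENNReal.tsum_mul_left]
    refine ENNReal.tsum_le_tsum fun w => ?_
    by_cases hz : v J w = 0
    · simp [hz]
    obtain ⟨h1, h2⟩ := hv J w hz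
    rw [if_pos h1, ← mul_assoc]
    refine (mul_le_mul' h2 le_rfl).trans_eq ?_
    rw [mul_assoc, mul_assoc, dmon_mul_mon, ← dmon_smul]
  calc nrm a (fun J => ∑' w, v J w * mon y w) ≤ ε * (2 * l2 α * (∑' w : Word m, mon β w) ^ 2) := by
        refine (l2_mono key).trans ?_
        rw [l2_const_mul]
        gcongr
        exact l2_tsum_dmon_le α β
    _ ≤ ε * (2 * (θ * nrm a y) * 2 ^ 2) := by
        gcongr
        exact (l2_const_mul _ _).le
    _ = _ := by ring

/-! ### Values of series, Taylor expansion and holomorphy -/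

/-- The value of a series. -/
def ev (F : Ser m) (u : Seq m) : ℂ := ∑' w, F w * mon u w

/-- The derivative of a series at `u` in the direction `h`. -/
def dev (F : Ser m) (u h : Seq m) : ℂ := ∑' w, F w * dmon u h w

/-- The majorant of a series. -/
def maj (F : Ser m) (y : Idx m → ℝ≥0∞) : ℝ≥0∞ := ∑' w, ‖F w‖ₑ * mon y w

section taylor

variable {u h : Seq m} {k y : Idx m → ℝ≥0∞} {t : ℝ≥0∞}

lemma enorm_mon_le (hu : ∀ J, ‖u J‖ₑ ≤ y J) (w : Word m) : ‖mon u w‖ₑ ≤ mon y w := by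
  induction w with
  | nil => simp
  | cons J w ih => rw [mon_cons, mon_cons, enorm_mul]; gcongr; exact hu J

/-- This and the next Taylor bounds go by induction on the word. The increment is measured by a
fixed scale `k` and a relative size `t`. The order in `h` appears as a power of `t` in front of one
monomial of the majorant, with no loss depending on the degree. -/
lemma enorm_dmon_le (hy : ∀ J, ‖u J‖ₑ + k J ≤ y J) (hh : ∀ J, ‖h J‖ₑ ≤ t * k J) (w : Word m) :
    ‖dmon u h w‖ₑ ≤ t * mon y w := by
  induction w with
  | nil => simp
  | cons J w ih =>
    rw [dmon_cons, mon_cons]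
    calc _ ≤ ‖h J‖ₑ * ‖mon u w‖ₑ + ‖u J‖ₑ * ‖dmon u h w‖ₑ := by
          rw [← enorm_mul, ← enorm_mul]; exact enorm_add_le _ _
      _ ≤ (t * k J) * mon y w + ‖u J‖ₑ * (t * mon y w) := by
          gcongr
          · exact hh J
          · exact enorm_mon_le (fun J => le_self_add.trans (hy J)) w
      _ = t * ((‖u J‖ₑ + k J) * mon y w) := by ring
      _ ≤ _ := by gcongr; exact hy J

lemma enorm_add_le_of_le_one (hy : ∀ J, ‖u J‖ₑ + k J ≤ y J) (hh : ∀ J, ‖h J‖ₑ ≤ t * k J)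
    (ht : t ≤ 1) (J : Idx m) : ‖u J + h J‖ₑ ≤ y J :=
  (enorm_add_le _ _).trans ((add_le_add le_rfl
    ((hh J).trans (mul_le_of_le_one_left' ht))).trans (hy J))

lemma enorm_mon_add_sub_le (hy : ∀ J, ‖u J‖ₑ + k J ≤ y J) (hh : ∀ J, ‖h J‖ₑ ≤ t * k J)
    (ht : t ≤ 1) (w : Word m) : ‖mon (u + h) w - mon u w‖ₑ ≤ t * mon y w := by
  induction w with
  | nil => simp
  | cons J w ih =>
    rw [mon_cons, mon_cons, mon_cons]
    calc _ = ‖h J * mon (u + h) w + u J * (mon (u + h) w - mon u w)‖ₑ := by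
          congr 1; rw [Pi.add_apply]; ring
      _ ≤ ‖h J‖ₑ * ‖mon (u + h) w‖ₑ + ‖u J‖ₑ * ‖mon (u + h) w - mon u w‖ₑ := by
          rw [← enorm_mul, ← enorm_mul]; exact enorm_add_le _ _
      _ ≤ (t * k J) * mon y w + ‖u J‖ₑ * (t * mon y w) := by
          gcongr
          · exact hh J
          · exact enorm_mon_le (fun J => enorm_add_le_of_le_one hy hh ht J) w
      _ = t * ((‖u J‖ₑ + k J) * mon y w) := by ring
      _ ≤ _ := by gcongr; exact hy J

lemma enorm_mon_taylor_le (hy : ∀ J, ‖u J‖ₑ + k J ≤ y J) (hh : ∀ J, ‖h J‖ₑ ≤ t * k J)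
    (ht : t ≤ 1) (w : Word m) :
    ‖mon (u + h) w - mon u w - dmon u h w‖ₑ ≤ t ^ 2 * mon y w := by
  induction w with
  | nil => simp
  | cons J w ih =>
    rw [mon_cons, mon_cons, mon_cons, dmon_cons]
    calc _ = ‖h J * (mon (u + h) w - mon u w) +
            u J * (mon (u + h) w - mon u w - dmon u h w)‖ₑ := by
          congr 1; rw [Pi.add_apply]; ring
      _ ≤ ‖h J‖ₑ * ‖mon (u + h) w - mon u w‖ₑ +
            ‖u J‖ₑ * ‖mon (u + h) w - mon u w - dmon u h w‖ₑ := by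
          rw [← enorm_mul, ← enorm_mul]; exact enorm_add_le _ _
      _ ≤ (t * k J) * (t * mon y w) + ‖u J‖ₑ * (t ^ 2 * mon y w) := by
          gcongr
          · exact hh J
          · exact enorm_mon_add_sub_le hy hh ht w
      _ = t ^ 2 * ((‖u J‖ₑ + k J) * mon y w) := by ring
      _ ≤ _ := by gcongr; exact hy J

lemma summable_mul_of_le {F g : Ser m} {c : ℝ≥0∞} (hc : c ≠ ∞)
    (hg : ∀ w, ‖g w‖ₑ ≤ c * mon y w) (hF : maj F y ≠ ∞) : Summable fun w => F w * g w := by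
  refine Summable.of_enorm (ne_top_of_le_ne_top (ENNReal.mul_ne_top hc hF) ?_)
  rw [maj, ← ENNReal.tsum_mul_left]
  refine ENNReal.tsum_le_tsum fun w => ?_
  rw [enorm_mul]
  calc _ ≤ ‖F w‖ₑ * (c * mon y w) := by gcongr; exact hg w
    _ = _ := by ring

lemma enorm_tsum_mul_le {F g : Ser m} {c : ℝ≥0∞} (hg : ∀ w, ‖g w‖ₑ ≤ c * mon y w) :
    ‖∑' w, F w * g w‖ₑ ≤ c * maj F y := by
  refine enorm_tsum_le_tsum_enorm.trans ?_
  rw [maj, ← ENNReal.tsum_mul_left]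
  refine ENNReal.tsum_le_tsum fun w => ?_
  rw [enorm_mul]
  calc _ ≤ ‖F w‖ₑ * (c * mon y w) := by gcongr; exact hg w
    _ = _ := by ring

lemma summable_ev {F : Ser m} (hu : ∀ J, ‖u J‖ₑ ≤ y J) (hF : maj F y ≠ ∞) :
    Summable fun w => F w * mon u w :=
  summable_mul_of_le ENNReal.one_ne_top (fun w => (enorm_mon_le hu w).trans_eq (one_mul _).symm) hF

lemma summable_dev {F : Ser m} (hy : ∀ J, ‖u J‖ₑ + k J ≤ y J) (hh : ∀ J, ‖h J‖ₑ ≤ t * k J)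
    (ht : t ≠ ∞) (hF : maj F y ≠ ∞) : Summable fun w => F w * dmon u h w :=
  summable_mul_of_le ht (enorm_dmon_le hy hh) hF

lemma enorm_ev_le {F : Ser m} (hu : ∀ J, ‖u J‖ₑ ≤ y J) : ‖ev F u‖ₑ ≤ maj F y :=
  (enorm_tsum_mul_le fun w => (enorm_mon_le hu w).trans_eq (one_mul _).symm).trans_eq (one_mul _)

lemma enorm_dev_le {F : Ser m} (hy : ∀ J, ‖u J‖ₑ + k J ≤ y J) (hh : ∀ J, ‖h J‖ₑ ≤ t * k J) :
    ‖dev F u h‖ₑ ≤ t * maj F y := enorm_tsum_mul_le (enorm_dmon_le hy hh)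

lemma enorm_ev_taylor_le {F : Ser m} (hy : ∀ J, ‖u J‖ₑ + k J ≤ y J)
    (hh : ∀ J, ‖h J‖ₑ ≤ t * k J) (ht : t ≤ 1) (hF : maj F y ≠ ∞) :
    ‖ev F (u + h) - ev F u - dev F u h‖ₑ ≤ t ^ 2 * maj F y := by
  have h1 := summable_ev (F := F) (u := u + h) (fun J => enorm_add_le_of_le_one hy hh ht J) hF
  have h2 := summable_ev (F := F) (u := u) (fun J => le_self_add.trans (hy J)) hF
  have h3 := summable_dev (F := F) hy hh (ne_top_of_le_ne_top ENNReal.one_ne_top ht) hF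
  rw [ev, ev, dev, ← h1.tsum_sub h2, ← (h1.sub h2).tsum_sub h3]
  simp_rw [← mul_sub]
  exact enorm_tsum_mul_le (enorm_mon_taylor_le hy hh ht)

end taylor

lemma dmon_add_right (u h h' : Seq m) (w : Word m) :
    dmon u (h + h') w = dmon u h w + dmon u h' w := by
  induction w with
  | nil => simp
  | cons J w ih => simp only [dmon_cons, ih, Pi.add_apply]; ring

lemma dmon_smul_right (u h : Seq m) (c : ℂ) (w : Word m) :
    dmon u (c • h) w = c * dmon u h w := by
  induction w with
  | nil => simp
  | cons J w ih => simp only [dmon_cons, ih, Pi.smul_apply, smul_eq_mul]; ring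

/-- The space `ℓ²` of the coordinates. -/
abbrev L2 (m : ℕ) : Type := lp (fun _ : Idx m => ℂ) 2

lemma enorm_sq_eq_ofReal (z : ℂ) : ‖z‖ₑ ^ 2 = ENNReal.ofReal (‖z‖ ^ 2) := by
  rw [← ofReal_norm, ENNReal.ofReal_pow (norm_nonneg _)]

lemma enorm_eq_l2 (x : L2 m) : ‖x‖ₑ = l2 (fun J => ‖x J‖ₑ) := by
  have h1 := lp.hasSum_norm (p := 2) (by norm_num) x
  norm_num at h1
  have h2 : ‖x‖ₑ ^ 2 = l2 (fun J => ‖x J‖ₑ) ^ 2 := by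
    rw [l2_sq, ← ofReal_norm, ← ENNReal.ofReal_pow (norm_nonneg _), ← h1.tsum_eq,
      ENNReal.ofReal_tsum_of_nonneg (fun J => by positivity) h1.summable]
    exact tsum_congr fun J => (enorm_sq_eq_ofReal _).symm
  exact (ENNReal.pow_right_strictMono two_ne_zero).injective h2

lemma memLp_of_l2_ne_top {z : Idx m → ℂ} (h : l2 (fun J => ‖z J‖ₑ) ≠ ∞) : Memℓp z 2 := by
  refine memℓp_gen ?_
  have h1 : ∑' J, ENNReal.ofReal (‖z J‖ ^ 2) ≠ ∞ := by
    simp_rw [← enorm_sq_eq_ofReal]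
    rw [← l2_sq]
    exact ENNReal.pow_ne_top h
  have := ENNReal.summable_toReal h1
  simpa [ENNReal.toReal_ofReal, sq_nonneg] using this

/-- The isometry of `ℓ²` onto the weighted space. -/
def emb (a : Idx m → ℝ) (x : L2 m) : Seq m := fun J => ((a J)⁻¹ : ℝ) * x J

/-- The inverse of `emb`, with value `0` outside of the weighted space. -/
def coord (a : Idx m → ℝ) (u : Seq m) : L2 m :=
  open Classical in
  if h : Memℓp (fun J => (a J : ℂ) * u J) 2 then ⟨fun J => (a J : ℂ) * u J, h⟩ else 0

lemma emb_add (a : Idx m → ℝ) (x y : L2 m) : emb a (x + y) = emb a x + emb a y := by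
  funext J
  simp [emb, mul_add]

lemma emb_sub (a : Idx m → ℝ) (x y : L2 m) : emb a (x - y) = emb a x - emb a y := by
  funext J
  simp [emb, mul_sub]

lemma emb_smul (a : Idx m → ℝ) (c : ℂ) (x : L2 m) : emb a (c • x) = c • emb a x := by
  funext J
  simp [emb, mul_left_comm]

lemma ofReal_mul_enorm_emb {a : Idx m → ℝ} (ha : ∀ J, 1 ≤ a J) (x : L2 m) (J : Idx m) :
    ENNReal.ofReal (a J) * ‖emb a x J‖ₑ = ‖x J‖ₑ := by
  have h : 0 < a J := by linarith [ha J]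
  rw [← Real.enorm_of_nonneg h.le, ← enorm_norm (emb a x J), ← enorm_mul, ← enorm_norm (x J)]
  congr 1
  rw [emb, norm_mul, Complex.norm_real, norm_inv, Real.norm_of_nonneg h.le, ← mul_assoc,
    mul_inv_cancel₀ h.ne', one_mul]

lemma nrm_emb {a : Idx m → ℝ} (ha : ∀ J, 1 ≤ a J) (x : L2 m) :
    nrm a (fun J => ‖emb a x J‖ₑ) = ‖x‖ₑ := by
  rw [enorm_eq_l2, nrm]
  congr 1
  exact funext fun J => ofReal_mul_enorm_emb ha x J

lemma emb_injective {a : Idx m → ℝ} (ha : ∀ J, 1 ≤ a J) : Function.Injective (emb a) := by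
  intro x y h
  rw [← sub_eq_zero, ← enorm_eq_zero, ← nrm_emb ha, emb_sub, h, sub_self]
  simp [nrm, l2]

lemma memLp_of_nrm_ne_top {a : Idx m → ℝ} (ha : ∀ J, 1 ≤ a J) {u : Seq m}
    (h : nrm a (fun J => ‖u J‖ₑ) ≠ ∞) : Memℓp (fun J => (a J : ℂ) * u J) 2 := by
  refine memLp_of_l2_ne_top ?_
  convert h using 1
  rw [nrm]
  congr 1
  funext J
  rw [enorm_mul, ← Real.enorm_of_nonneg (by linarith [ha J])]
  congr 1
  rw [← enorm_norm, Complex.norm_real, enorm_norm]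

lemma emb_coord {a : Idx m → ℝ} (ha : ∀ J, 1 ≤ a J) {u : Seq m}
    (h : nrm a (fun J => ‖u J‖ₑ) ≠ ∞) : emb a (coord a u) = u := by
  rw [coord, dif_pos (memLp_of_nrm_ne_top ha h)]
  funext J
  have h0 : (a J : ℂ) ≠ 0 := by exact_mod_cast (by linarith [ha J] : (0 : ℝ) < a J).ne'
  simp only [emb, Complex.ofReal_inv]
  rw [← mul_assoc, inv_mul_cancel₀ h0, one_mul]

lemma enorm_coord {a : Idx m → ℝ} (ha : ∀ J, 1 ≤ a J) {u : Seq m}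
    (h : nrm a (fun J => ‖u J‖ₑ) ≠ ∞) : ‖coord a u‖ₑ = nrm a (fun J => ‖u J‖ₑ) := by
  rw [← nrm_emb ha, emb_coord ha h]

lemma norm_le_of_enorm_le {x : L2 m} {C : ℝ} (hC : 0 ≤ C) (h : ‖x‖ₑ ≤ ENNReal.ofReal C) :
    ‖x‖ ≤ C := by
  rwa [← ofReal_norm, ENNReal.ofReal_le_ofReal_iff hC] at h

lemma enorm_le_ofReal {E : Type*} [SeminormedAddGroup E] {x : E} {C : ℝ} (h : ‖x‖ ≤ C) :
    ‖x‖ₑ ≤ ENNReal.ofReal C := by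
  rw [← ofReal_norm]
  exact ENNReal.ofReal_le_ofReal h

/-- The majorant of `x` and `h` used for Taylor expansions at `x`. -/
lemma exists_majorant {a : Idx m → ℝ} (ha : ∀ J, 1 ≤ a J) {R ρ : ℝ} (hρ : 0 < ρ) {x : L2 m}
    (hx : ‖x‖ + ρ ≤ R) (h : L2 m) : ∃ k : Idx m → ℝ≥0∞,
      (∀ J, ‖emb a h J‖ₑ ≤ ENNReal.ofReal (‖h‖ / ρ) * k J) ∧
      nrm a (fun J => ‖emb a x J‖ₑ + k J) ≤ ENNReal.ofReal R := by
  by_cases hz : h = 0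
  · refine ⟨0, fun J => by simp [hz, emb], ?_⟩
    simp only [Pi.zero_apply, add_zero]
    rw [nrm_emb ha]
    exact enorm_le_ofReal (by linarith)
  have hh : 0 < ‖h‖ := norm_pos_iff.2 hz
  -- The scale is `h` stretched to norm `ρ`, the distance allowed by the radius `R`; the relative
  -- size is then `‖h‖ / ρ`, as in a Cauchy estimate.
  refine ⟨fun J => ENNReal.ofReal (ρ / ‖h‖) * ‖emb a h J‖ₑ, fun J => ?_, ?_⟩
  · rw [← mul_assoc, ← ENNReal.ofReal_mul (by positivity), div_mul_div_cancel₀ hρ.ne',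
      div_self hh.ne', ENNReal.ofReal_one, one_mul]
  · refine (nrm_add_le _ _ _).trans ?_
    rw [nrm_const_mul, nrm_emb ha, nrm_emb ha, ← ofReal_norm, ← ofReal_norm,
      ← ENNReal.ofReal_mul (by positivity), div_mul_cancel₀ _ hh.ne',
      ← ENNReal.ofReal_add (norm_nonneg _) hρ.le]
    exact ENNReal.ofReal_le_ofReal hx

/-- A series of functions on the weighted space, bounded together with its majorant. -/
def BddOn (a : Idx m → ℝ) (F : Ser m) (R : ℝ) (C : ℝ≥0∞) : Prop :=
  ∀ y, nrm a y ≤ ENNReal.ofReal R → maj F y ≤ C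

/-- A vector field given by series, bounded together with its majorant. -/
def VBddOn (a : Idx m → ℝ) (V : Idx m → Ser m) (R : ℝ) (C : ℝ≥0∞) : Prop :=
  ∀ y, nrm a y ≤ ENNReal.ofReal R → nrm a (fun J => maj (V J) y) ≤ C

section

variable {a : Idx m → ℝ} {F : Ser m} {V : Idx m → Ser m} {R : ℝ} {C : ℝ≥0∞}

lemma VBddOn.bddOn (ha : ∀ J, 1 ≤ a J) (hV : VBddOn a V R C) (J : Idx m) : BddOn a (V J) R C := by
  intro y hy
  refine le_trans ?_ ((le_l2 _ J).trans (hV y hy))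
  exact le_mul_of_one_le_left' (by simpa using ha J)

lemma dev_add (ha : ∀ J, 1 ≤ a J) (hF : BddOn a F R C) (hC : C ≠ ∞) {x : L2 m} (hx : ‖x‖ < R)
    (h h' : L2 m) :
    dev F (emb a x) (emb a (h + h')) = dev F (emb a x) (emb a h) + dev F (emb a x) (emb a h') := by
  have hs : ∀ h : L2 m, Summable fun w => F w * dmon (emb a x) (emb a h) w := fun h => by
    obtain ⟨k, h1, h2⟩ := exists_majorant ha (sub_pos.2 hx) (by linarith) h (x := x) (R := R)
    exact summable_dev (fun J => le_rfl) h1 ENNReal.ofReal_ne_top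
      (ne_top_of_le_ne_top hC (hF _ h2))
  rw [dev, dev, dev, ← (hs h).tsum_add (hs h')]
  refine tsum_congr fun w => ?_
  rw [emb_add, dmon_add_right, mul_add]

lemma dev_smul (c : ℂ) (u h : Seq m) : dev F u (c • h) = c * dev F u h := by
  rw [dev, dev, ← tsum_mul_left]
  refine tsum_congr fun w => ?_
  rw [dmon_smul_right]
  ring

lemma norm_dev_le (ha : ∀ J, 1 ≤ a J) (hF : BddOn a F R C) (hC : C ≠ ∞) {x : L2 m} {ρ : ℝ}
    (hρ : 0 < ρ) (hx : ‖x‖ + ρ ≤ R) (h : L2 m) :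
    ‖dev F (emb a x) (emb a h)‖ ≤ C.toReal / ρ * ‖h‖ := by
  obtain ⟨k, h1, h2⟩ := exists_majorant ha hρ hx h
  have h3 : ‖dev F (emb a x) (emb a h)‖ₑ ≤ ENNReal.ofReal (‖h‖ / ρ) * C :=
    (enorm_dev_le (fun J => le_rfl) h1).trans (by gcongr; exact hF _ h2)
  rw [← ofReal_norm, ← ENNReal.ofReal_toReal hC, ← ENNReal.ofReal_mul (by positivity),
    ENNReal.ofReal_le_ofReal_iff (by positivity)] at h3
  exact h3.trans_eq (by ring)

/-- The derivative of a series as a continuous linear functional. -/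
lemma hasFDerivAt_ev (ha : ∀ J, 1 ≤ a J) (hF : BddOn a F R C) (hC : C ≠ ∞) {x : L2 m}
    (hx : ‖x‖ < R) : ∃ D : L2 m →L[ℂ] ℂ, (∀ h, D h = dev F (emb a x) (emb a h)) ∧
      HasFDerivAt (fun x => ev F (emb a x)) D x := by
  set ρ := R - ‖x‖
  have hρ : 0 < ρ := sub_pos.2 hx
  have hxρ : ‖x‖ + ρ ≤ R := by simp [ρ]
  refine ⟨LinearMap.mkContinuous
    { toFun := fun h => dev F (emb a x) (emb a h)
      map_add' := dev_add ha hF hC hx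
      map_smul' := fun c h => by rw [emb_smul, dev_smul]; rfl }
    (C.toReal / ρ) (norm_dev_le ha hF hC hρ hxρ), fun h => rfl, ?_⟩
  rw [hasFDerivAt_iff_isLittleO_nhds_zero]
  refine Asymptotics.IsBigO.trans_isLittleO (g := fun h : L2 m => ‖h‖ ^ 2)
    (Asymptotics.IsBigO.of_bound (C.toReal / ρ ^ 2) ?_) ?_
  · filter_upwards [Metric.ball_mem_nhds (0 : L2 m) hρ] with h hh
    rw [mem_ball_zero_iff] at hh
    obtain ⟨k, h1, h2⟩ := exists_majorant ha hρ hxρ h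
    have hC' := hF _ h2
    have h3 := enorm_ev_taylor_le (F := F) (fun J => le_rfl) h1
      (by simpa using (div_le_one hρ).2 hh.le) (ne_top_of_le_ne_top hC hC')
    have h4 := h3.trans (mul_le_mul' le_rfl hC')
    rw [← ofReal_norm, ← ENNReal.ofReal_toReal hC, ← ENNReal.ofReal_pow (by positivity),
      ← ENNReal.ofReal_mul (by positivity), ENNReal.ofReal_le_ofReal_iff (by positivity)] at h4
    rw [emb_add]
    refine h4.trans_eq ?_
    rw [Real.norm_of_nonneg (by positivity)]
    field_simp
  · have := Asymptotics.isLittleO_norm_pow_id (E' := L2 m) one_lt_two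
    exact this

/-- The map on the coordinates given by a family of series. -/
def vmap (a : Idx m → ℝ) (V : Idx m → Ser m) (x : L2 m) : L2 m :=
  coord a (fun J => ev (V J) (emb a x))

lemma enorm_ev_vec_le (ha : ∀ J, 1 ≤ a J) (hV : VBddOn a V R C) {x : L2 m} (hx : ‖x‖ ≤ R) :
    nrm a (fun J => ‖ev (V J) (emb a x)‖ₑ) ≤ C := by
  refine (nrm_mono fun J => enorm_ev_le fun J => le_rfl).trans (hV _ ?_)
  rw [nrm_emb ha]
  exact enorm_le_ofReal hx

lemma emb_vmap (ha : ∀ J, 1 ≤ a J) (hV : VBddOn a V R C) (hC : C ≠ ∞) {x : L2 m} (hx : ‖x‖ ≤ R) :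
    emb a (vmap a V x) = fun J => ev (V J) (emb a x) :=
  emb_coord ha (ne_top_of_le_ne_top hC (enorm_ev_vec_le ha hV hx))

/-- Taylor expansion of first order, with quadratic remainder. -/
lemma exists_fderiv_vmap (ha : ∀ J, 1 ≤ a J) (hV : VBddOn a V R C) (hC : C ≠ ∞) {x : L2 m} {ρ : ℝ}
    (hρ : 0 < ρ) (hx : ‖x‖ + ρ ≤ R) : ∃ D : L2 m →L[ℂ] L2 m, ‖D‖ ≤ C.toReal / ρ ∧
      (∀ h, ‖h‖ ≤ ρ → ‖vmap a V (x + h) - vmap a V x - D h‖ ≤ C.toReal / ρ ^ 2 * ‖h‖ ^ 2) ∧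
      HasFDerivAt (vmap a V) D x := by
  have hxR : ‖x‖ < R := by linarith
  have hb : ∀ h : L2 m, nrm a (fun J => ‖dev (V J) (emb a x) (emb a h)‖ₑ) ≤
      ENNReal.ofReal (‖h‖ / ρ) * C := by
    intro h
    obtain ⟨k, h1, h2⟩ := exists_majorant ha hρ hx h
    refine (nrm_mono fun J => enorm_dev_le (fun J => le_rfl) h1).trans ?_
    rw [nrm_const_mul]
    gcongr
    exact hV _ h2
  have hne : ∀ h : L2 m, nrm a (fun J => ‖dev (V J) (emb a x) (emb a h)‖ₑ) ≠ ∞ := fun h =>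
    ne_top_of_le_ne_top (ENNReal.mul_ne_top ENNReal.ofReal_ne_top hC) (hb h)
  set L : L2 m → L2 m := fun h => coord a (fun J => dev (V J) (emb a x) (emb a h))
  have hL : ∀ h, emb a (L h) = fun J => dev (V J) (emb a x) (emb a h) := fun h =>
    emb_coord ha (hne h)
  have hLb : ∀ h, ‖L h‖ ≤ C.toReal / ρ * ‖h‖ := by
    intro h
    refine norm_le_of_enorm_le (by positivity) ?_
    rw [enorm_coord ha (hne h)]
    refine (hb h).trans_eq ?_
    rw [← ENNReal.ofReal_toReal hC, ← ENNReal.ofReal_mul (by positivity)]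
    simp only [ENNReal.toReal_ofReal, ENNReal.toReal_nonneg]
    congr 1
    ring
  have hquad : ∀ h, ‖h‖ ≤ ρ →
      ‖vmap a V (x + h) - vmap a V x - L h‖ ≤ C.toReal / ρ ^ 2 * ‖h‖ ^ 2 := by
    intro h hh
    refine norm_le_of_enorm_le (by positivity) ?_
    rw [← nrm_emb ha, emb_sub, emb_sub, hL, emb_vmap ha hV hC hxR.le,
      emb_vmap ha hV hC ((norm_add_le x h).trans (by linarith)), emb_add]
    obtain ⟨k, h1, h2⟩ := exists_majorant ha hρ hx h
    refine (nrm_mono (z := fun J => ENNReal.ofReal (‖h‖ / ρ) ^ 2 *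
      maj (V J) (fun J => ‖emb a x J‖ₑ + k J)) fun J => ?_).trans ?_
    · exact enorm_ev_taylor_le (F := V J) (fun J => le_rfl) h1
        (by simpa using (div_le_one hρ).2 hh)
        (ne_top_of_le_ne_top hC (hV.bddOn ha J _ h2))
    · rw [nrm_const_mul]
      refine (mul_le_mul' le_rfl (hV _ h2)).trans_eq ?_
      rw [← ENNReal.ofReal_toReal hC, ← ENNReal.ofReal_pow (by positivity),
        ← ENNReal.ofReal_mul (by positivity)]
      simp only [ENNReal.toReal_ofReal, ENNReal.toReal_nonneg]
      congr 1
      field_simp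
  refine ⟨LinearMap.mkContinuous
    { toFun := L
      map_add' := fun h h' => emb_injective ha (by
        rw [emb_add, hL, hL, hL]
        funext J
        exact dev_add ha (hV.bddOn ha J) hC hxR h h')
      map_smul' := fun c h => emb_injective ha (by
        rw [RingHom.id_apply, emb_smul, hL, hL]
        funext J
        rw [emb_smul, dev_smul]
        rfl) } (C.toReal / ρ) hLb,
    LinearMap.mkContinuous_norm_le _ (by positivity) _, hquad, ?_⟩
  rw [hasFDerivAt_iff_isLittleO_nhds_zero]
  refine Asymptotics.IsBigO.trans_isLittleO (g := fun h : L2 m => ‖h‖ ^ 2)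
    (Asymptotics.IsBigO.of_bound (C.toReal / ρ ^ 2) ?_)
    (Asymptotics.isLittleO_norm_pow_id (E' := L2 m) one_lt_two)
  filter_upwards [Metric.ball_mem_nhds (0 : L2 m) hρ] with h hh
  rw [Real.norm_of_nonneg (by positivity)]
  exact hquad h (mem_ball_zero_iff.1 hh).le

end

/-! ### Flow lines and Taylor's formula along them -/

open Set in
/-- A vector field with small Lipschitz constant has flow lines up to time `1`. -/
lemma exists_flow_line {E : Type*} [NormedAddCommGroup E] [NormedSpace ℝ E] [CompleteSpace E]
    {X : E → E} {R : ℝ} {K : NNReal} (hX : LipschitzOnWith K X (Metric.ball 0 R))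
    (hX' : ∀ x ∈ Metric.ball (0 : E) R, ‖X x‖ ≤ ‖x‖ / 4) {x : E} (hx : 2 * ‖x‖ < R) :
    ∃ φ : ℝ → E, φ 0 = x ∧ (∀ t, ‖φ t - x‖ ≤ ‖x‖ / 2) ∧
      ∀ t ∈ Icc (0 : ℝ) 1, HasDerivWithinAt φ (X (φ t)) (Icc 0 1) t := by
  have hsub : Metric.closedBall x (‖x‖ / 2) ⊆ Metric.ball 0 R := by
    intro y hy
    rw [mem_closedBall_iff_norm] at hy
    rw [mem_ball_zero_iff]
    have := norm_add_le x (y - x)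
    rw [add_sub_cancel] at this
    linarith [norm_nonneg x]
  have hn : ∀ y ∈ Metric.closedBall x (‖x‖ / 2), ‖y‖ ≤ 3 / 2 * ‖x‖ := by
    intro y hy
    rw [mem_closedBall_iff_norm] at hy
    have := norm_add_le x (y - x)
    rw [add_sub_cancel] at this
    linarith
  have hcoe : ((‖x‖₊ / 2 : NNReal) : ℝ) = ‖x‖ / 2 := by simp
  -- On the ball of radius `‖x‖ / 2` about `x` the field is at most `(3 / 8) ‖x‖`, so a solution
  -- cannot leave this ball before time 1.
  have hf : IsPicardLindelof (fun _ : ℝ => X) (tmin := 0) (tmax := 1) ⟨0, by simp⟩ x (‖x‖₊ / 2) 0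
      (‖x‖₊ / 2) K := by
    refine ⟨fun t _ => ?_, fun y _ => continuousOn_const, fun t _ y hy => ?_, ?_⟩
    · rw [hcoe]
      exact hX.mono hsub
    · rw [hcoe] at hy ⊢
      have h1 := hX' y (hsub hy)
      have h2 := hn y hy
      linarith [norm_nonneg x]
    · simp
  have hx0 : x ∈ Metric.closedBall x ((0 : NNReal) : ℝ) := by simp
  obtain ⟨α, hα⟩ := ODE.FunSpace.exists_isFixedPt_next hf hx0
  have hmem : ∀ t, α.compProj t ∈ Metric.closedBall x (‖x‖ / 2) := fun t => by
    have := α.compProj_mem_closedBall hf.mul_max_le (t := t)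
    rwa [hcoe] at this
  refine ⟨α.compProj, ?_, fun t => mem_closedBall_iff_norm.1 (hmem t), fun t ht => ?_⟩
  · have := ODE.FunSpace.next_apply₀ hf hx0 α
    rw [hα] at this
    exact (ODE.FunSpace.compProj_val (t := ⟨0, by simp⟩)).trans this
  · refine (ODE.hasDerivWithinAt_picard_Icc (f := fun _ : ℝ => X) (t₀ := 0) (by simp)
      hf.continuousOn_uncurry α.continuous_compProj.continuousOn
      (fun _ _ => α.compProj_mem_closedBall hf.mul_max_le) x ht).congr_of_mem ?_ ht
    intro s hs
    nth_rw 1 [← hα]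
    rw [ODE.FunSpace.compProj_of_mem hs, ODE.FunSpace.next_apply]

open Set in
/-- Taylor's formula for a sequence of functions each of which is the derivative of the
previous one. -/
lemma hasSum_of_deriv_chain {g : ℕ → ℝ → ℂ} {C : ℝ}
    (hg : ∀ n, ∀ t ∈ Icc (0 : ℝ) 1, HasDerivWithinAt (g n) (g (n + 1) t) (Icc 0 1) t)
    (hC : ∀ n, ∀ t ∈ Icc (0 : ℝ) 1, ‖g n t‖ ≤ n.factorial * ((1 / 2) ^ n * C)) :
    HasSum (fun n => g n 0 / n.factorial) (g 0 1) := by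
  have h0 : (0 : ℝ) ∈ Icc (0 : ℝ) 1 := by simp
  have hs : Summable fun n => g n 0 / (n.factorial : ℂ) := by
    refine Summable.of_norm_bounded ((summable_geometric_two).mul_right C) fun n => ?_
    rw [norm_div, Complex.norm_natCast, div_le_iff₀ (by positivity)]
    exact (hC n 0 h0).trans_eq (by ring)
  -- The Taylor polynomial from time `t` to time 1 equals `g 0 1` at `t = 1` and the partial sum at
  -- `t = 0`. Its derivative telescopes to the last term, which bounds the remainder without
  -- integrals.
  have hsum : ∀ k : ℕ, ∀ t ∈ Icc (0 : ℝ) 1, HasDerivWithinAt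
      (fun t : ℝ => ∑ n ∈ Finset.range (k + 1), ((1 - t : ℝ) : ℂ) ^ n / n.factorial * g n t)
      (((1 - t : ℝ) : ℂ) ^ k / k.factorial * g (k + 1) t) (Icc 0 1) t := by
    intro k t ht
    induction k with
    | zero => simpa using hg 0 t ht
    | succ k ih =>
      have h1 : HasDerivWithinAt (fun t : ℝ => ((1 - t : ℝ) : ℂ)) (-1) (Icc 0 1) t := by
        have := ((hasDerivAt_id t).const_sub 1).ofReal_comp.hasDerivWithinAt (s := Icc 0 1)
        simpa using this
      have h2 := ((h1.pow (k + 1)).div_const ((k + 1).factorial : ℂ)).mul (hg (k + 1) t ht)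
      have h3 := ih.add h2
      refine (h3.congr_deriv ?_).congr_of_mem (fun s _ => ?_) ht
      · have hk : ((k + 1).factorial : ℂ) = (k + 1) * k.factorial := by
          rw [Nat.factorial_succ]; push_cast; ring
        have hk1 : (k + 1 : ℂ) ≠ 0 := by exact_mod_cast Nat.succ_ne_zero k
        have hk2 : (k.factorial : ℂ) ≠ 0 := by exact_mod_cast k.factorial_ne_zero
        simp only [Nat.add_sub_cancel, hk, Pi.pow_apply]
        push_cast
        field_simp
        ring
      · rw [Finset.sum_range_succ]
        rfl
  have hle : ∀ k : ℕ, ‖g 0 1 - ∑ n ∈ Finset.range (k + 1), g n 0 / n.factorial‖ ≤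
      (k + 1) * (1 / 2) ^ (k + 1) * C := by
    intro k
    have h1 := norm_image_sub_le_of_norm_deriv_le_segment_01' (hsum k)
      (C := (k + 1) * (1 / 2) ^ (k + 1) * C) (fun t ht => ?_)
    · have e₁ : ∑ n ∈ Finset.range (k + 1), ((1 - 1 : ℝ) : ℂ) ^ n / n.factorial * g n 1 = g 0 1 := by
        rw [Finset.sum_range_succ']
        simp
      have e₂ : ∑ n ∈ Finset.range (k + 1), ((1 - 0 : ℝ) : ℂ) ^ n / n.factorial * g n 0 =
          ∑ n ∈ Finset.range (k + 1), g n 0 / n.factorial := by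
        refine Finset.sum_congr rfl fun n _ => ?_
        simp [div_eq_inv_mul]
      rwa [e₁, e₂] at h1
    · have ht' := Ico_subset_Icc_self ht
      have hC' := hC (k + 1) t ht'
      have hb : ‖((1 - t : ℝ) : ℂ) ^ k‖ ≤ 1 := by
        rw [norm_pow, Complex.norm_real, Real.norm_of_nonneg (by linarith [ht.2])]
        exact pow_le_one₀ (by linarith [ht.2]) (by linarith [ht.1])
      rw [norm_mul, norm_div, Complex.norm_natCast]
      calc _ ≤ 1 / (k.factorial : ℝ) * ((k + 1).factorial * ((1 / 2) ^ (k + 1) * C)) := by gcongr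
        _ = _ := by
          rw [Nat.factorial_succ]
          push_cast
          field_simp
  have hlim : Filter.Tendsto (fun k : ℕ => ((k : ℝ) + 1) * (1 / 2) ^ (k + 1) * C) Filter.atTop
      (nhds 0) := by
    have h1 := tendsto_self_mul_const_pow_of_lt_one (r := (1 / 2 : ℝ)) (by norm_num) (by norm_num)
    have h2 := ((Filter.tendsto_add_atTop_iff_nat 1).2 h1).mul_const C
    simpa using h2
  have h1 := (Filter.tendsto_add_atTop_iff_nat 1).2 hs.hasSum.tendsto_sum_nat
  have h2 : Filter.Tendsto (fun k : ℕ => ∑ n ∈ Finset.range (k + 1), g n 0 / (n.factorial : ℂ))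
      Filter.atTop (nhds (g 0 1)) := by
    rw [tendsto_iff_norm_sub_tendsto_zero]
    refine squeeze_zero (fun _ => norm_nonneg _) (fun k => ?_) hlim
    rw [norm_sub_rev]
    exact hle k
  rw [← tendsto_nhds_unique h1 h2]
  exact hs.hasSum

/-! ### Lie derivatives as derivatives along vector fields -/

lemma _root_.HasSum.of_eq {ι R : Type*} [AddCommMonoid R] [TopologicalSpace R] {f g : ι → R} {a : R}
    (hf : HasSum f a) (h : ∀ x, f x = g x) : HasSum g a := funext h ▸ hf

/-- The coefficients of the partial derivative with respect to `u_I`. -/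
def pcoef {R : Type*} [AddCommMonoid R] (F : Word m → R) (I : Idx m) (b : Word m) : R :=
  splitSum (fun p r => F (p ++ I :: r)) b

lemma hamCoeff_eq (χ : Ser m) (J : Idx m) (b : Word m) :
    hamCoeff χ J b = -(sgn J * Complex.I) * pcoef χ (bar J) b := rfl

lemma ev_const_mul (c : ℂ) (F : Ser m) (u : Seq m) : ev (fun w => c * F w) u = c * ev F u := by
  simp_rw [ev, mul_assoc]
  exact tsum_mul_left

lemma ev_hamCoeff (χ : Ser m) (J : Idx m) (u : Seq m) :
    ev (hamCoeff χ J) u = -(sgn J * Complex.I) * ev (pcoef χ (bar J)) u := ev_const_mul _ _ _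

lemma posSum_mul_right {R : Type*} [CommSemiring R] (F : Word m → R) (u k : Idx m → R)
    (w : Word m) : posSum (fun p I r => F (p ++ I :: r) * (mon u p * k I * mon u r)) w =
      F w * dmon u k w := by
  rw [dmon, posSum, posSum, Finset.mul_sum]
  refine Finset.sum_congr rfl fun i _ => ?_
  congr 2
  simp

lemma splitSum_mul_right {R : Type*} [CommSemiring R] (g : Word m → Word m → R) (u : Idx m → R)
    (w : Word m) : splitSum (fun p r => g p r * (mon u p * mon u r)) w =
      splitSum g w * mon u w := by
  rw [splitSum, splitSum, Finset.sum_mul]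
  refine Finset.sum_congr rfl fun i _ => ?_
  rw [← mon_append, List.take_append_drop]

lemma tsum_mul_dmon (v : Word m → ℝ≥0∞) (y k : Idx m → ℝ≥0∞) :
    ∑' w, v w * dmon y k w = ∑' x : Word m × Idx m × Word m,
      v (x.1 ++ x.2.1 :: x.2.2) * (mon y x.1 * k x.2.1 * mon y x.2.2) := by
  rw [← tsum_posSum (fun p I r => v (p ++ I :: r) * (mon y p * k I * mon y r))]
  exact tsum_congr fun w => (posSum_mul_right v y k w).symm

lemma tsum_mul_pcoef (v : Word m → ℝ≥0∞) (y k : Idx m → ℝ≥0∞) :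
    ∑' I, k I * ∑' b, pcoef v I b * mon y b = ∑' w, v w * dmon y k w := by
  rw [tsum_mul_dmon]
  conv_rhs =>
    rw [ENNReal.tsum_prod']
    enter [1, p]
    rw [ENNReal.tsum_prod']
  conv_rhs => rw [ENNReal.tsum_comm]
  refine tsum_congr fun I => ?_
  have h : ∀ b, pcoef v I b * mon y b =
      splitSum (fun p r => v (p ++ I :: r) * (mon y p * mon y r)) b := fun b =>
    (splitSum_mul_right _ _ _).symm
  simp_rw [h]
  rw [tsum_splitSum, ENNReal.tsum_prod', ← ENNReal.tsum_mul_left]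
  refine tsum_congr fun p => ?_
  rw [← ENNReal.tsum_mul_left]
  exact tsum_congr fun r => by ring

lemma enorm_mon (u : Seq m) (w : Word m) : ‖mon u w‖ₑ = mon (fun J => ‖u J‖ₑ) w := by
  induction w with
  | nil => simp
  | cons J w ih => rw [mon_cons, mon_cons, enorm_mul, ih]

/-- The directional derivative is the sum of the partial derivatives. -/
lemma hasSum_dev {F : Ser m} {u k : Seq m}
    (hfin : ∑' w, ‖F w‖ₑ * dmon (fun J => ‖u J‖ₑ) (fun J => ‖k J‖ₑ) w ≠ ∞) :
    HasSum (fun I => k I * ev (pcoef F I) u) (dev F u k) := by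
  set T : Word m × Idx m × Word m → ℂ := fun x =>
    F (x.1 ++ x.2.1 :: x.2.2) * (mon u x.1 * k x.2.1 * mon u x.2.2)
  have hT : Summable T := by
    refine Summable.of_enorm ?_
    rw [tsum_mul_dmon] at hfin
    convert hfin using 1
    refine tsum_congr fun x => ?_
    simp only [T, enorm_mul, enorm_mon]
  obtain ⟨t, ht⟩ := hT
  have h1 : HasSum (fun w => F w * dmon u k w) t := by
    exact (hasSum_posSum (g := fun p I r => F (p ++ I :: r) * (mon u p * k I * mon u r))
      ht).of_eq fun w => posSum_mul_right F u k w
  rw [dev, h1.tsum_eq]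
  let e : Idx m × Word m × Word m ≃ Word m × Idx m × Word m :=
    { toFun := fun x => (x.2.1, x.1, x.2.2)
      invFun := fun x => (x.2.1, x.1, x.2.2)
      left_inv := fun _ => rfl
      right_inv := fun _ => rfl }
  have h2 : HasSum (T ∘ e) t := (e.hasSum_iff).2 ht
  refine h2.prod_fiberwise fun I => ?_
  -- The partial derivative series is summable only because it is a fibre of the full sum divided by
  -- `k I`. For `k I = 0` nothing is known about it, but the product vanishes anyway.
  by_cases hk : k I = 0
  · simp only [hk, zero_mul]
    refine hasSum_zero.of_eq fun x => ?_
    simp [T, e, hk]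
  · have h3 : Summable fun x : Word m × Word m => (T ∘ e) (I, x) := h2.summable.prod_factor I
    have h4 : Summable fun x : Word m × Word m =>
        F (x.1 ++ I :: x.2) * (mon u x.1 * mon u x.2) := by
      have := h3.mul_left (k I)⁻¹
      refine this.congr fun x => ?_
      simp only [T, e, Function.comp, Equiv.coe_fn_mk]
      field_simp
    have h5 := (hasSum_splitSum (g := fun p r => F (p ++ I :: r) * (mon u p * mon u r)) h4.hasSum)
    have h6 : ev (pcoef F I) u = ∑' x : Word m × Word m,
        F (x.1 ++ I :: x.2) * (mon u x.1 * mon u x.2) := by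
      rw [← h5.tsum_eq, ev]
      exact tsum_congr fun w => (splitSum_mul_right _ _ _).symm
    rw [h6]
    refine (h4.hasSum.mul_left (k I)).of_eq fun x => ?_
    simp only [T, e, Function.comp, Equiv.coe_fn_mk]
    ring

/-- Words with a pair of words are pairs of words, the second of which has a marked gap. -/
def splitEquiv₂ : (Word m × Word m × Word m) ≃ Σ q : Word m × Word m, Fin (q.2.length + 1) where
  toFun p := ⟨(p.1, p.2.1 ++ p.2.2), ⟨p.2.1.length, by simp⟩⟩
  invFun x := (x.1.1, x.1.2.take x.2, x.1.2.drop x.2)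
  left_inv p := by simp
  right_inv x := by
    obtain ⟨⟨v, w⟩, i, hi⟩ := x
    refine Sigma.ext (by simp) ?_
    rw [Fin.heq_ext_iff (by simp)]
    simp at hi ⊢
    omega

lemma hasSum_splitSum₂ {g : Word m → Word m → Word m → ℂ} {a : ℂ}
    (h : HasSum (fun x : Word m × Word m × Word m => g x.1 x.2.1 x.2.2) a) :
    HasSum (fun q : Word m × Word m => splitSum (g q.1) q.2) a := by
  have h' := (splitEquiv₂.symm.hasSum_iff
    (f := fun x : Word m × Word m × Word m => g x.1 x.2.1 x.2.2)).2 h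
  exact h'.sigma fun q => hasSum_fintype _

/-- A rearrangement of the four-fold sum in the Lie derivative. -/
lemma hasSum_lie_of_hasSum {χ F : Ser m} (hχ : SuppOn 3 0 χ) {u : Seq m} {t : ℂ}
    (h : HasSum (fun x : (Word m × Idx m × Word m) × Word m =>
      F (x.1.1 ++ x.1.2.1 :: x.1.2.2) * (mon u x.1.1 *
        (hamCoeff χ x.1.2.1 x.2 * mon u x.2) * mon u x.1.2.2)) t) :
    HasSum (fun w => lie χ F w * mon u w) t := by
  let e : (Word m × Word m × Word m) × Idx m ≃ (Word m × Idx m × Word m) × Word m :=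
    { toFun := fun x => ((x.1.1, x.2, x.1.2.2), x.1.2.1)
      invFun := fun x => ((x.1.1, x.2, x.1.2.2), x.1.2.1)
      left_inv := fun _ => rfl
      right_inv := fun _ => rfl }
  let S : (Word m × Word m × Word m) × Idx m → ℂ := fun x =>
    (F (x.1.1 ++ x.2 :: x.1.2.2) * hamCoeff χ x.2 x.1.2.1) *
      (mon u x.1.2.1 * mon u x.1.2.2) * mon u x.1.1
  have h2 : HasSum S t := ((e.hasSum_iff).2 h).of_eq fun x => by
    simp only [Function.comp, e, Equiv.coe_fn_mk, S]
    ring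
  have h3 : HasSum (fun x : Word m × Word m × Word m =>
      (∑ σ : ℤˣ, F (x.1 ++ jn x.2.1 σ :: x.2.2) * hamCoeff χ (jn x.2.1 σ) x.2.1) *
        (mon u x.2.1 * mon u x.2.2) * mon u x.1) t := by
    refine h2.prod_fiberwise fun x => ?_
    -- For a fixed factorization of the word, momentum conservation reduces the sum over the
    -- replaced index to its two candidates.
    have h4 := (h2.summable.prod_factor x).hasSum
    rw [tsum_eq_sum_jn x.2.1 (fun c => S (x, c))] at h4
    · rw [Finset.sum_mul, Finset.sum_mul]
      exact h4
    · intro J hJ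
      refine hχ.mom_of_hamCoeff_ne_zero fun h0 => hJ ?_
      simp only [S, h0, mul_zero, zero_mul]
  have h4 := hasSum_splitSum₂ (g := fun p b r =>
      (∑ σ : ℤˣ, F (p ++ jn b σ :: r) * hamCoeff χ (jn b σ) b) *
        (mon u b * mon u r) * mon u p) h3
  have h5 := hasSum_splitSum (g := fun p v => splitSum (fun b r =>
      (∑ σ : ℤˣ, F (p ++ jn b σ :: r) * hamCoeff χ (jn b σ) b) *
        (mon u b * mon u r) * mon u p) v) h4
  refine h5.of_eq fun w => ?_
  symm
  rw [lie, ← splitSum_mul_right]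
  refine splitSum_congr fun p v _ => ?_
  rw [mul_comm (mon u p), ← mul_assoc, ← splitSum_mul_right]
  simp [splitSum, Finset.sum_mul]

/-- The Lie derivative of a series is its derivative along the vector field. -/
lemma hasSum_lie {χ F : Ser m} (hχ : SuppOn 3 0 χ) {u : Seq m}
    (hY : ∀ J, maj (hamCoeff χ J) (fun J => ‖u J‖ₑ) ≠ ∞)
    (hfin : ∑' w, ‖F w‖ₑ * dmon (fun J => ‖u J‖ₑ)
      (fun J => maj (hamCoeff χ J) (fun J => ‖u J‖ₑ)) w ≠ ∞) :
    HasSum (fun w => lie χ F w * mon u w) (dev F u (fun J => ev (hamCoeff χ J) u)) := by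
  have hS : Summable (fun x : (Word m × Idx m × Word m) × Word m =>
      F (x.1.1 ++ x.1.2.1 :: x.1.2.2) * (mon u x.1.1 *
        (hamCoeff χ x.1.2.1 x.2 * mon u x.2) * mon u x.1.2.2)) := by
    refine Summable.of_enorm ?_
    rw [tsum_mul_dmon] at hfin
    refine ne_of_eq_of_ne ?_ hfin
    rw [ENNReal.tsum_prod']
    refine tsum_congr fun x => ?_
    simp only [enorm_mul, enorm_mon, maj]
    rw [ENNReal.tsum_mul_left, ENNReal.tsum_mul_right, ENNReal.tsum_mul_left]
  obtain ⟨t, ht⟩ := hS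
  have hX : ∀ J, HasSum (fun b => hamCoeff χ J b * mon u b) (ev (hamCoeff χ J) u) := fun J =>
    (summable_ev (fun J => le_rfl) (hY J)).hasSum
  have h1 : HasSum (fun w => F w * dmon u (fun J => ev (hamCoeff χ J) u) w) t := by
    have h2 := ht.prod_fiberwise (g := fun x : Word m × Idx m × Word m =>
      F (x.1 ++ x.2.1 :: x.2.2) * (mon u x.1 * ev (hamCoeff χ x.2.1) u * mon u x.2.2))
      fun x => (((hX x.2.1).mul_left _).mul_right _).mul_left _
    exact (hasSum_posSum (g := fun p I r => F (p ++ I :: r) *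
      (mon u p * ev (hamCoeff χ I) u * mon u r)) h2).of_eq fun w => posSum_mul_right F u _ w
  rw [dev, h1.tsum_eq]
  exact hasSum_lie_of_hasSum hχ ht

/-- Monomials are eigenvectors of diagonal linear fields. For `l J = σ ω_j` the eigenvalue is the
divisor, which is how `H₀` acts on series. -/
lemma dmon_eigen {R : Type*} [CommSemiring R] (u l : Idx m → R) (w : Word m) :
    dmon u (fun J => l J * u J) w = (w.map l).sum * mon u w := by
  induction w with
  | nil => simp
  | cons J w ih =>
    rw [dmon_cons, ih, mon_cons, List.map_cons, List.sum_cons]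
    ring

section

variable {a : Idx m → ℝ} {F : Ser m} {R : ℝ} {C : ℝ≥0∞}

lemma enorm_single (K : Idx m) :
    (fun J => ‖(Pi.single K (1 : ℂ) : Seq m) J‖ₑ) = Pi.single K (1 : ℝ≥0∞) := by
  funext J
  by_cases h : J = K
  · subst h; simp
  · simp [h]

lemma nrm_single_ne_top (K : Idx m) :
    nrm a (fun J => ‖(Pi.single K (1 : ℂ) : Seq m) J‖ₑ) ≠ ∞ := by
  rw [enorm_single, nrm, l2, tsum_eq_single K]
  · simp
  · intro J hJ
    simp [hJ]

lemma tsum_mul_dmon_ne_top (ha : ∀ J, 1 ≤ a J) (hF : BddOn a F R C) (hC : C ≠ ∞) {x : L2 m}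
    (hx : ‖x‖ < R) (h : L2 m) :
    ∑' w, ‖F w‖ₑ * dmon (fun J => ‖emb a x J‖ₑ) (fun J => ‖emb a h J‖ₑ) w ≠ ∞ := by
  obtain ⟨k, h1, h2⟩ := exists_majorant ha (sub_pos.2 hx) (by linarith) h (x := x) (R := R)
  set t := ENNReal.ofReal (‖h‖ / (R - ‖x‖))
  refine ne_top_of_le_ne_top (ENNReal.mul_ne_top (ENNReal.ofReal_ne_top (r :=
    ‖h‖ / (R - ‖x‖))) (ne_top_of_le_ne_top hC (hF _ h2))) ?_
  rw [maj, ← ENNReal.tsum_mul_left]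
  refine ENNReal.tsum_le_tsum fun w => ?_
  have h3 : dmon (fun J => ‖emb a x J‖ₑ) (fun J => ‖emb a h J‖ₑ) w ≤
      t * mon (fun J => ‖emb a x J‖ₑ + k J) w := by
    induction w with
    | nil => simp
    | cons I w ih =>
      rw [dmon_cons, mon_cons]
      calc _ ≤ (t * k I) * mon (fun J => ‖emb a x J‖ₑ + k J) w +
            ‖emb a x I‖ₑ * (t * mon (fun J => ‖emb a x J‖ₑ + k J) w) := by
            gcongr
            · exact h1 I
            · exact mon_mono (fun J => le_self_add) w
        _ = _ := by ring
  calc _ ≤ ‖F w‖ₑ * (t * mon (fun J => ‖emb a x J‖ₑ + k J) w) := by gcongr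
    _ = _ := by ring

/-- The Hamiltonian vector field of a convergent series. -/
lemma hamVec_ev (ha : ∀ J, 1 ≤ a J) (hF : BddOn a F R C) (hC : C ≠ ∞) {x : L2 m}
    (hx : ‖x‖ < R) (J : Idx m) : hamVec (ev F) (emb a x) J = ev (hamCoeff F J) (emb a x) := by
  set K := bar J
  obtain ⟨D, hD, hFD⟩ := hasFDerivAt_ev ha hF hC hx
  set s : Seq m := Pi.single K 1
  have hs : emb a (coord a s) = s := emb_coord ha (nrm_single_ne_top K)
  have hdev : dev F (emb a x) s = ev (pcoef F K) (emb a x) := by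
    have hfin := tsum_mul_dmon_ne_top ha hF hC hx (coord a s)
    rw [hs] at hfin
    have h := hasSum_dev hfin
    have h' : HasSum (fun I => s I * ev (pcoef F I) (emb a x))
        (s K * ev (pcoef F K) (emb a x)) := by
      refine hasSum_single K fun I hI => ?_
      simp [s, hI]
    rw [h.unique h']
    simp [s]
  have hder : HasDerivAt (fun z : ℂ => ev F (Function.update (emb a x) K z))
      (ev (pcoef F K) (emb a x)) (emb a x K) := by
    have h1 : HasDerivAt (fun z : ℂ => x + (z - emb a x K) • coord a s) (coord a s)
        (emb a x K) := by
      have := (((hasDerivAt_id (emb a x K)).sub_const (emb a x K)).smul_const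
        (coord a s)).const_add x
      simpa using this
    have h2 : HasFDerivAt (fun x => ev F (emb a x)) D
        (x + (emb a x K - emb a x K) • coord a s) := by simpa using hFD
    have h3 := h2.comp_hasDerivAt (emb a x K) h1
    rw [hD, hs, hdev] at h3
    refine h3.congr_of_eventuallyEq (Filter.Eventually.of_forall fun z => ?_)
    simp only [Function.comp, emb_add, emb_smul, hs]
    congr 1
    funext I
    by_cases h : I = K
    · subst h; simp [s]
    · simp [s, h]
  rw [hamVec, hder.deriv, ev_hamCoeff, neg_mul]

end

/-! ### Generators, their flows and Lie series -/

/-- The generators of the transformations: polynomials with small coefficients. -/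
structure Gen (χ : Ser m) (d : ℕ) (X M : ℝ) : Prop where
  X_nonneg : 0 ≤ X
  one_le_M : 1 ≤ M
  supp : SuppOn 3 0 χ
  degree : ∀ w, χ w ≠ 0 → w.length ≤ d
  bound : ∀ w, ‖χ w‖ ≤ X * M ^ w.length
  -- This controls the growth of the iterated Lie derivatives; the next condition makes the vector
  -- field a small multiple of its argument.
  small : 2 * d ^ 2 * (X * M ^ 2) ≤ 1 / 4
  small' : X * M ^ 2 ≤ 1 / 8

lemma Gen.neg {χ : Ser m} {d : ℕ} {X M : ℝ} (h : Gen χ d X M) : Gen (-χ) d X M where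
  X_nonneg := h.X_nonneg
  one_le_M := h.one_le_M
  supp w hw := h.supp w (by simpa using hw)
  degree w hw := h.degree w (by simpa using hw)
  bound w := by simpa using h.bound w
  small := h.small
  small' := h.small'

/-- The Lie series `∑ Lⁿ F / n!`. -/
def lieSer (χ F : Ser m) : Ser m := fun w => ∑' n : ℕ, (lie χ)^[n] F w / n.factorial

open Classical in
/-- The series with value `u_J`. -/
def coordSer (J : Idx m) : Ser m := fun w => if w = [J] then 1 else 0

/-- The transformation generated by `χ`. -/
def lieMap (χ : Ser m) (u : Seq m) : Seq m := fun J => ev (lieSer χ (coordSer J)) u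

lemma ev_coordSer (J : Idx m) (u : Seq m) : ev (coordSer J) u = u J := by
  rw [ev, tsum_eq_single [J]]
  · simp [coordSer]
  · intro w hw
    simp [coordSer, hw]

lemma suppOn_coordSer (J : Idx m) : SuppOn 1 ((J.2 : ℤ) • J.1) (coordSer J) := by
  intro w hw
  have h : w = [J] := by
    by_contra h
    exact hw (by simp [coordSer, h])
  simp [h]

lemma norm_coordSer_le {M : ℝ} (hM : 1 ≤ M) (J : Idx m) (w : Word m) :
    ‖coordSer J w‖ ≤ 1 * M ^ w.length := by
  have h1 : 1 ≤ M ^ w.length := one_le_pow₀ hM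
  rw [coordSer]
  split_ifs
  · simpa using h1
  · rw [norm_zero]
    linarith

lemma bddOn_of_norm_le {a : Idx m → ℝ} {b : Idx m → ℝ≥0∞} {K : ℝ≥0∞} (ha : Tame a b K) {F : Ser m}
    {B θ R : ℝ} (hB : 0 ≤ B) (hθ : 0 ≤ θ) (hR : θ * R ≤ 1 / 2) (hF : ∀ w, ‖F w‖ ≤ B * θ ^ w.length) :
    BddOn a F R (ENNReal.ofReal (2 * B)) := by
  intro y hy
  have h1 : ENNReal.ofReal θ * nrm a y ≤ 2⁻¹ := by
    calc _ ≤ ENNReal.ofReal θ * ENNReal.ofReal R := by gcongr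
      _ = ENNReal.ofReal (θ * R) := (ENNReal.ofReal_mul hθ).symm
      _ ≤ ENNReal.ofReal (1 / 2) := ENNReal.ofReal_le_ofReal hR
      _ = 2⁻¹ := by rw [one_div, ENNReal.ofReal_inv_of_pos two_pos, ENNReal.ofReal_ofNat]
  calc maj F y ≤ ∑' w : Word m, ENNReal.ofReal B * (ENNReal.ofReal θ ^ w.length * mon y w) := by
        refine ENNReal.tsum_le_tsum fun w => ?_
        rw [← mul_assoc, ← ENNReal.ofReal_pow hθ, ← ENNReal.ofReal_mul hB]
        gcongr
        exact enorm_le_ofReal (hF w)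
    _ ≤ ENNReal.ofReal B * 2 := by
        rw [ENNReal.tsum_mul_left]
        gcongr
        exact ha.tsum_mon_le h1
    _ = _ := by
        rw [mul_comm, ENNReal.ofReal_mul zero_le_two, ENNReal.ofReal_ofNat]

/-- The bound for vector fields in terms of the coefficients, in a form that takes into account
a lower bound `ℓ + 1` for the degree and an additional small factor `ε`. -/
lemma nrm_maj_le {a : Idx m → ℝ} {b : Idx m → ℝ≥0∞} {κ : ℝ}
    (ha : ∀ J, 1 ≤ a J) (hl2 : l2 (fun J => b J / ENNReal.ofReal (a J)) ≤ 1)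
    {V : Idx m → Ser m} {B θ q ε R : ℝ} {ℓ : ℕ} (hB : 0 ≤ B)
    (hθ : 0 ≤ θ) (hκ : 0 ≤ κ) (hq : 0 < q) (hq1 : q ≤ 1) (hε : 0 ≤ ε) (hR : θ * κ / q * R ≤ 1 / 2)
    (hV : ∀ J w, ‖V J w‖ ≤ B * θ ^ w.length)
    (hs : ∀ J w, V J w ≠ 0 → ℓ + 1 ≤ w.length ∧ mom w = (J.2 : ℤ) • J.1 ∧
      ENNReal.ofReal (a J) ≤ ENNReal.ofReal ε * (ENNReal.ofReal κ ^ w.length *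
        dmon b (fun I => ENNReal.ofReal (a I)) w))
    {y : Idx m → ℝ≥0∞} (hy : nrm a y ≤ ENNReal.ofReal R) :
    nrm a (fun J => maj (V J) y) ≤ ENNReal.ofReal (8 * B * ε * θ * κ * q ^ ℓ) * nrm a y := by
  classical
  -- only the constants of the tame estimate differ from those of the weight
  have key : ∀ J w, ENNReal.ofReal (a J) * ‖V J w‖ₑ ≠ 0 → mom w = (J.2 : ℤ) • J.1 ∧
      ENNReal.ofReal (a J) * ‖V J w‖ₑ ≤ ENNReal.ofReal (B * ε * q ^ (ℓ + 1)) *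
        (ENNReal.ofReal (θ * κ / q) ^ w.length * dmon b (fun I => ENNReal.ofReal (a I)) w) := by
    intro J w hz
    have hz' : V J w ≠ 0 := fun h => hz (by simp [h])
    obtain ⟨h1, h2, h3⟩ := hs J w hz'
    refine ⟨h2, ?_⟩
    have h4 : ‖V J w‖ₑ ≤ ENNReal.ofReal (B * q ^ (ℓ + 1) * (θ / q) ^ w.length) := by
      refine enorm_le_ofReal ((hV J w).trans ?_)
      -- The slack `q` trades radius for smallness: shrinking the ball by `q` gives the power `q ^
      -- (ℓ + 1)`, because all degrees are at least `ℓ + 1`.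
      have : θ ^ w.length = q ^ w.length * (θ / q) ^ w.length := by
        rw [← mul_pow, mul_div_cancel₀ _ hq.ne']
      rw [this, mul_assoc]
      have h5 : q ^ w.length ≤ q ^ (ℓ + 1) := pow_le_pow_of_le_one hq.le hq1 h1
      gcongr
    calc _ ≤ (ENNReal.ofReal ε * (ENNReal.ofReal κ ^ w.length *
          dmon b (fun I => ENNReal.ofReal (a I)) w)) *
          ENNReal.ofReal (B * q ^ (ℓ + 1) * (θ / q) ^ w.length) := mul_le_mul' h3 h4
      _ = ENNReal.ofReal (B * ε * q ^ (ℓ + 1)) * (ENNReal.ofReal (θ * κ / q) ^ w.length *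
          dmon b (fun I => ENNReal.ofReal (a I)) w) := by
        rw [← ENNReal.ofReal_pow hκ, ← ENNReal.ofReal_pow (by positivity), ← mul_assoc,
          ← mul_assoc, mul_right_comm, ← ENNReal.ofReal_mul hε,
          ← ENNReal.ofReal_mul (by positivity), ← ENNReal.ofReal_mul (by positivity)]
        congr 2
        rw [mul_div_right_comm, mul_pow]
        ring
  have hR' : ENNReal.ofReal (θ * κ / q) * nrm a y ≤ 2⁻¹ := by
    calc _ ≤ ENNReal.ofReal (θ * κ / q) * ENNReal.ofReal R := by gcongr
      _ = ENNReal.ofReal (θ * κ / q * R) := (ENNReal.ofReal_mul (by positivity)).symm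
      _ ≤ ENNReal.ofReal (1 / 2) := ENNReal.ofReal_le_ofReal hR
      _ = 2⁻¹ := by rw [one_div, ENNReal.ofReal_inv_of_pos two_pos, ENNReal.ofReal_ofNat]
  refine (nrm_tsum_le ha hl2 (v := fun J w => ‖V J w‖ₑ) (fun J w hz => key J w ?_)
    hR').trans_eq ?_
  · have : ENNReal.ofReal (a J) ≠ 0 := by
      rw [Ne, ENNReal.ofReal_eq_zero, not_le]
      linarith [ha J]
    exact mul_ne_zero this hz
  · congr 1
    rw [show (8 : ℝ≥0∞) = ENNReal.ofReal 8 by simp, ← ENNReal.ofReal_mul (by norm_num),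
      ← ENNReal.ofReal_mul (by positivity)]
    congr 1
    rw [pow_succ]
    field_simp

section

variable {a : Idx m → ℝ} {b : Idx m → ℝ≥0∞} {κ : ℝ} {χ F : Ser m} {d : ℕ} {X M R : ℝ}

lemma norm_hamCoeff_le' {B : ℝ} (hB : 0 ≤ B) (hM : 0 ≤ M) (hF : ∀ w, ‖F w‖ ≤ B * M ^ w.length)
    (J : Idx m) (w : Word m) : ‖hamCoeff F J w‖ ≤ B * M * (2 * M) ^ w.length := by
  refine (norm_hamCoeff_le hF J w).trans ?_
  have h : ((w.length : ℝ) + 1) ≤ 2 ^ w.length := by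
    exact_mod_cast Nat.lt_two_pow_self (n := w.length)
  calc _ ≤ (2 ^ w.length) * (B * M ^ (w.length + 1)) := by gcongr
    _ = _ := by rw [mul_pow]; ring

/-- The field starts with quadratic terms, so one power of the slack `1 / (128 κ)` survives and
cancels `κ`. A field this small compared with its argument keeps the flow lines close to their
starting points. -/
lemma Gen.nrm_hamCoeff_le (hG : Gen χ d X M) (ha : Tame a b (ENNReal.ofReal κ)) (hκ : 1 ≤ κ)
    (hR : 512 * M * κ ^ 2 * R ≤ 1) {y : Idx m → ℝ≥0∞} (hy : nrm a y ≤ ENNReal.ofReal R) :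
    nrm a (fun J => maj (hamCoeff χ J) y) ≤ ENNReal.ofReal (1 / 64) * nrm a y := by
  have hM := hG.one_le_M
  have hX := hG.X_nonneg
  refine (nrm_maj_le (ε := 1) (ℓ := 1) (q := 1 / (128 * κ)) (θ := 2 * M) (B := X * M) (κ := κ)
    ha.one_le ha.l2_le (by positivity) (by positivity) (by positivity) (by positivity)
    ?_ zero_le_one ?_ (norm_hamCoeff_le' hX (by positivity) hG.bound) (fun J w hz => ?_)
    hy).trans ?_
  · rw [div_le_one (by positivity)]
    linarith
  · refine le_trans (le_of_eq ?_) (by linarith : 512 * M * κ ^ 2 * R / 2 ≤ 1 / 2)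
    field_simp
    ring
  · have h1 := hG.supp.mom_of_hamCoeff_ne_zero hz
    have h2 := hG.supp.le_length_of_hamCoeff_ne_zero hz
    refine ⟨h2, h1, ?_⟩
    rw [ENNReal.ofReal_one, one_mul]
    exact ha.tame J w h1 (by rintro rfl; simp at h2)
  · gcongr
    calc 8 * (X * M) * 1 * (2 * M) * κ * (1 / (128 * κ)) ^ 1 = (X * M ^ 2) / 8 := by
          field_simp
          ring
      _ ≤ _ := by linarith [hG.small']

lemma Gen.vbddOn (hG : Gen χ d X M) (ha : Tame a b (ENNReal.ofReal κ)) (hκ : 1 ≤ κ)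
    (hR : 512 * M * κ ^ 2 * R ≤ 1) : VBddOn a (hamCoeff χ) R (ENNReal.ofReal (R / 64)) := by
  intro y hy
  refine (hG.nrm_hamCoeff_le ha hκ hR hy).trans ?_
  calc _ ≤ ENNReal.ofReal (1 / 64) * ENNReal.ofReal R := by gcongr
    _ = _ := by
      rw [← ENNReal.ofReal_mul (by norm_num)]
      congr 1
      ring

lemma Gen.norm_vmap_le (hG : Gen χ d X M) (ha : Tame a b (ENNReal.ofReal κ)) (hκ : 1 ≤ κ)
    (hR : 512 * M * κ ^ 2 * R ≤ 1) {x : L2 m} (hx : ‖x‖ ≤ R) :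
    ‖vmap a (hamCoeff χ) x‖ ≤ ‖x‖ / 64 := by
  refine norm_le_of_enorm_le (by positivity) ?_
  rw [← nrm_emb ha.one_le, emb_vmap ha.one_le (hG.vbddOn ha hκ hR) ENNReal.ofReal_ne_top hx]
  have hy : nrm a (fun J => ‖emb a x J‖ₑ) ≤ ENNReal.ofReal R := by
    rw [nrm_emb ha.one_le]
    exact enorm_le_ofReal hx
  refine (nrm_mono fun J => enorm_ev_le fun J => le_rfl).trans
    ((hG.nrm_hamCoeff_le ha hκ hR hy).trans_eq ?_)
  rw [nrm_emb ha.one_le, ← ofReal_norm, ← ENNReal.ofReal_mul (by norm_num)]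
  congr 1
  ring

lemma Gen.exists_fderiv (hG : Gen χ d X M) (ha : Tame a b (ENNReal.ofReal κ)) (hκ : 1 ≤ κ)
    (hR0 : 0 < R) (hR : 512 * M * κ ^ 2 * R ≤ 1) {x : L2 m} (hx : ‖x‖ ≤ R / 2) :
    ∃ D : L2 m →L[ℂ] L2 m, ‖D‖ ≤ 1 / 4 ∧
      (∀ h, ‖h‖ ≤ R / 2 → ‖vmap a (hamCoeff χ) (x + h) - vmap a (hamCoeff χ) x - D h‖ ≤
        1 / R * ‖h‖ ^ 2) ∧ HasFDerivAt (vmap a (hamCoeff χ)) D x := by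
  obtain ⟨D, h1, h2, h3⟩ := exists_fderiv_vmap ha.one_le (hG.vbddOn ha hκ hR)
    ENNReal.ofReal_ne_top (half_pos hR0) (by linarith : ‖x‖ + R / 2 ≤ R)
  rw [ENNReal.toReal_ofReal (by positivity)] at h1 h2
  refine ⟨D, h1.trans ?_, fun h hh => (h2 h hh).trans ?_, h3⟩
  · rw [div_div_eq_mul_div, div_le_div_iff₀ hR0 (by norm_num)]
    linarith
  · refine mul_le_mul_of_nonneg_right ?_ (by positivity)
    rw [div_le_div_iff₀ (by positivity) hR0]
    nlinarith

lemma Gen.lipschitzOnWith (hG : Gen χ d X M) (ha : Tame a b (ENNReal.ofReal κ)) (hκ : 1 ≤ κ)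
    (hR0 : 0 < R) (hR : 512 * M * κ ^ 2 * R ≤ 1) :
    LipschitzOnWith 1 (vmap a (hamCoeff χ)) (Metric.ball 0 (R / 2)) := by
  choose! D h1 h2 h3 using fun (x : L2 m) (hx : ‖x‖ ≤ R / 2) =>
    hG.exists_fderiv ha hκ hR0 hR hx
  refine (convex_ball (0 : L2 m) (R / 2)).lipschitzOnWith_of_nnnorm_hasFDerivWithin_le (𝕜 := ℂ)
    (f' := D) (fun x hx => (h3 x (mem_ball_zero_iff.1 hx).le).hasFDerivWithinAt) fun x hx => ?_
  have := h1 x (mem_ball_zero_iff.1 hx).le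
  rw [← NNReal.coe_le_coe]
  simp only [coe_nnnorm, NNReal.coe_one]
  linarith

lemma Gen.norm_iterate_le (hG : Gen χ d X M) {B : ℝ} (hB : 0 ≤ B)
    (hF : ∀ w, ‖F w‖ ≤ B * M ^ w.length) (n : ℕ) (w : Word m) :
    ‖(lie χ)^[n] F w‖ / n.factorial ≤ (1 / 2) ^ n * (2 * B * (2 * M) ^ w.length) :=
  norm_iterate_lie_div_factorial_le hG.X_nonneg (by linarith [hG.one_le_M]) hB hG.supp hG.bound
    hG.degree hG.small hF n w

lemma Gen.norm_lieSer_le (hG : Gen χ d X M) {B : ℝ} (hB : 0 ≤ B)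
    (hF : ∀ w, ‖F w‖ ≤ B * M ^ w.length) (w : Word m) :
    ‖lieSer χ F w‖ ≤ 4 * B * (2 * M) ^ w.length := by
  have := tsum_of_norm_bounded (f := fun n : ℕ => (lie χ)^[n] F w / (n.factorial : ℂ))
    (hasSum_geometric_two.mul_right (2 * B * (2 * M) ^ w.length)) fun n => by
      rw [norm_div, Complex.norm_natCast]
      exact hG.norm_iterate_le hB hF n w
  refine this.trans_eq ?_
  ring

lemma Gen.bddOn_iterate (hG : Gen χ d X M) (ha : Tame a b (ENNReal.ofReal κ)) (hκ : 1 ≤ κ)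
    (hR : 512 * M * κ ^ 2 * R ≤ 1) {B : ℝ} (hB : 0 ≤ B)
    (hF : ∀ w, ‖F w‖ ≤ B * M ^ w.length) (n : ℕ) :
    BddOn a ((lie χ)^[n] F) R (ENNReal.ofReal (n.factorial * ((1 / 2) ^ n * (4 * B)))) := by
  have hM := hG.one_le_M
  have h := bddOn_of_norm_le ha (F := (lie χ)^[n] F) (B := n.factorial * ((1 / 2) ^ n * (2 * B)))
    (θ := 2 * M) (R := R) (by positivity) (by positivity) ?_ fun w => ?_
  · convert h using 2
    ring
  · rcases le_total R 0 with h0 | h0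
    · nlinarith
    · nlinarith [mul_nonneg (by linarith : 0 ≤ M) h0, mul_le_mul hκ hκ zero_le_one (by linarith)]
  · have := hG.norm_iterate_le hB hF n w
    rw [div_le_iff₀ (by positivity)] at this
    exact this.trans_eq (by ring)

lemma ev_tsum {G : ℕ → Ser m} {u : Seq m}
    (h : Summable fun x : ℕ × Word m => G x.1 x.2 * mon u x.2) :
    ev (fun w => ∑' n, G n w) u = ∑' n, ev (G n) u := by
  simp_rw [ev, ← tsum_mul_right]
  exact h.tsum_comm (f := fun n w => G n w * mon u w)

lemma ev_div (F : Ser m) (c : ℂ) (u : Seq m) : ev (fun w => F w / c) u = ev F u / c := by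
  rw [ev, ev, ← tsum_div_const]
  exact tsum_congr fun w => by ring

lemma ev_lieSer_eq {u : Seq m} (h : Summable fun x : ℕ × Word m =>
    (lie χ)^[x.1] F x.2 / (x.1.factorial : ℂ) * mon u x.2) :
    ev (lieSer χ F) u = ∑' n : ℕ, ev ((lie χ)^[n] F) u / n.factorial := by
  exact (ev_tsum (G := fun n w => (lie χ)^[n] F w / n.factorial) h).trans
    (tsum_congr fun n => ev_div ((lie χ)^[n] F) n.factorial u)

lemma Gen.summable_iterate (hG : Gen χ d X M) (ha : Tame a b (ENNReal.ofReal κ)) (hκ : 1 ≤ κ)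
    (hR : 512 * M * κ ^ 2 * R ≤ 1) {B : ℝ} (hB : 0 ≤ B)
    (hF : ∀ w, ‖F w‖ ≤ B * M ^ w.length) {x : L2 m} (hx : ‖x‖ ≤ R) :
    Summable fun y : ℕ × Word m =>
      (lie χ)^[y.1] F y.2 / (y.1.factorial : ℂ) * mon (emb a x) y.2 := by
  refine Summable.of_enorm ?_
  rw [ENNReal.tsum_prod']
  have h1 : ∀ n : ℕ, ∑' w, ‖(lie χ)^[n] F w / (n.factorial : ℂ) * mon (emb a x) w‖ₑ ≤
      ENNReal.ofReal ((1 / 2) ^ n * (4 * B)) := by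
    intro n
    have h2 := hG.bddOn_iterate ha hκ hR hB hF n (fun J => ‖emb a x J‖ₑ) (by
      rw [nrm_emb ha.one_le]
      exact enorm_le_ofReal hx)
    have h3 : ∀ w, ‖(lie χ)^[n] F w / (n.factorial : ℂ) * mon (emb a x) w‖ₑ =
        ENNReal.ofReal (1 / n.factorial) *
          (‖(lie χ)^[n] F w‖ₑ * mon (fun J => ‖emb a x J‖ₑ) w) := fun w => by
      rw [enorm_mul, enorm_mon, div_eq_mul_inv, enorm_mul, mul_comm ‖_‖ₑ, mul_assoc]
      congr 1
      rw [← ofReal_norm, norm_inv, Complex.norm_natCast, one_div]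
    rw [tsum_congr h3, ENNReal.tsum_mul_left]
    refine (mul_le_mul' le_rfl h2).trans_eq ?_
    rw [← ENNReal.ofReal_mul (by positivity)]
    congr 1
    field_simp
  refine ne_top_of_le_ne_top ?_ (ENNReal.tsum_le_tsum h1)
  rw [← ENNReal.ofReal_tsum_of_nonneg (fun n => by positivity)
    (summable_geometric_two.mul_right _)]
  exact ENNReal.ofReal_ne_top

open Set in
/-- Series are differentiable along the flow lines, with the Lie derivative as derivative. -/
lemma Gen.hasDerivWithinAt_ev (hG : Gen χ d X M) (ha : Tame a b (ENNReal.ofReal κ)) (hκ : 1 ≤ κ)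
    (hR0 : 0 < R) (hR : 512 * M * κ ^ 2 * R ≤ 1) {C : ℝ≥0∞} (hC : C ≠ ∞) (hF : BddOn a F R C)
    {φ : ℝ → L2 m} {s : Set ℝ} {t : ℝ} (hφ : ‖φ t‖ ≤ R / 2)
    (hd : HasDerivWithinAt φ (vmap a (hamCoeff χ) (φ t)) s t) :
    HasDerivWithinAt (fun t => ev F (emb a (φ t))) (ev (lie χ F) (emb a (φ t))) s t := by
  obtain ⟨D, h1, h2⟩ := hasFDerivAt_ev ha.one_le hF hC (by linarith : ‖φ t‖ < R)
  have h3 := (h2.restrictScalars ℝ).comp_hasDerivWithinAt t hd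
  refine h3.congr_deriv ?_
  have hφR : ‖φ t‖ ≤ R := by linarith
  have hV := hG.vbddOn ha hκ hR
  have hy : nrm a (fun J => ‖emb a (φ t) J‖ₑ) ≤ ENNReal.ofReal (R / 2) := by
    rw [nrm_emb ha.one_le]
    exact enorm_le_ofReal hφ
  have hyR : nrm a (fun J => ‖emb a (φ t) J‖ₑ) ≤ ENNReal.ofReal R :=
    hy.trans (ENNReal.ofReal_le_ofReal (by linarith))
  rw [ContinuousLinearMap.coe_restrictScalars', h1,
    emb_vmap ha.one_le hV ENNReal.ofReal_ne_top hφR]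
  refine (hasSum_lie hG.supp (fun J => ?_) ?_).tsum_eq.symm
  · exact ne_top_of_le_ne_top ENNReal.ofReal_ne_top (hV.bddOn ha.one_le J _ hyR)
  -- The derivative along the field is majorized by `F` at the sum of the point and the field, which
  -- has norm at most `R / 2 + R / 64`.
  · refine ne_top_of_le_ne_top hC (le_trans (ENNReal.tsum_le_tsum fun w => ?_) (hF (fun J =>
      ‖emb a (φ t) J‖ₑ + maj (hamCoeff χ J) (fun J => ‖emb a (φ t) J‖ₑ)) ?_))
    · gcongr
      exact dmon_le _ _ w
    · refine (nrm_add_le _ _ _).trans ?_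
      refine (add_le_add hy (hV _ hyR)).trans ?_
      rw [← ENNReal.ofReal_add (by positivity) (by positivity)]
      exact ENNReal.ofReal_le_ofReal (by linarith)

open Set in
/-- The Lie series of `F` represents the composition of `F` with the time-one flow. -/
lemma Gen.ev_lieSer (hG : Gen χ d X M) (ha : Tame a b (ENNReal.ofReal κ)) (hκ : 1 ≤ κ)
    (hR0 : 0 < R) (hR : 512 * M * κ ^ 2 * R ≤ 1) {B : ℝ} (hB : 0 ≤ B)
    (hF : ∀ w, ‖F w‖ ≤ B * M ^ w.length) {φ : ℝ → L2 m}
    (hφ : ∀ t ∈ Icc (0 : ℝ) 1, ‖φ t‖ ≤ R / 2)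
    (hd : ∀ t ∈ Icc (0 : ℝ) 1, HasDerivWithinAt φ (vmap a (hamCoeff χ) (φ t)) (Icc 0 1) t) :
    ev (lieSer χ F) (emb a (φ 0)) = ev F (emb a (φ 1)) := by
  have h0 : (0 : ℝ) ∈ Icc (0 : ℝ) 1 := by simp
  rw [ev_lieSer_eq (hG.summable_iterate ha hκ hR hB hF ((hφ 0 h0).trans (by linarith)))]
  have hb := hG.bddOn_iterate ha hκ hR hB hF
  refine (hasSum_of_deriv_chain (g := fun n t => ev ((lie χ)^[n] F) (emb a (φ t))) (C := 4 * B)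
    (fun n t ht => ?_) fun n t ht => ?_).tsum_eq
  · have := hG.hasDerivWithinAt_ev ha hκ hR0 hR ENNReal.ofReal_ne_top (hb n) (hφ t ht) (hd t ht)
    rwa [← Function.iterate_succ_apply' (lie χ)] at this
  · have h1 : ‖ev ((lie χ)^[n] F) (emb a (φ t))‖ₑ ≤ _ :=
      (enorm_ev_le fun J => le_rfl).trans (hb n _ (by
        rw [nrm_emb ha.one_le]
        exact enorm_le_ofReal ((hφ t ht).trans (by linarith))))
    rwa [← ofReal_norm, ENNReal.ofReal_le_ofReal_iff (by positivity)] at h1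

end

/-! ### Symplecticity and inversion of the time-one map -/

open Set Filter Topology in
/-- Flows of vector fields whose derivatives are skew with respect to a bilinear form preserve
the form. -/
lemma bilin_fderiv_flow_eq {E : Type*} [NormedAddCommGroup E] [NormedSpace ℝ E]
    (B : E →L[ℝ] E →L[ℝ] ℂ) {X : E → E} {D : E → E →L[ℝ] E} {s U : Set E} {K : NNReal} {C : ℝ}
    (hC : 0 ≤ C) (hL : LipschitzOnWith K X s)
    (hD : ∀ y ∈ s, ∀ z ∈ s, ‖X z - X y - D y (z - y)‖ ≤ C * ‖z - y‖ ^ 2)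
    (hB : ∀ y ∈ s, ∀ v w, B (D y v) w + B v (D y w) = 0)
    {φ : E → ℝ → E} (hU : IsOpen U) (hφ0 : ∀ y ∈ U, φ y 0 = y)
    (hφs : ∀ y ∈ U, ∀ t ∈ Icc (0 : ℝ) 1, φ y t ∈ s)
    (hφ : ∀ y ∈ U, ∀ t ∈ Icc (0 : ℝ) 1, HasDerivWithinAt (φ y) (X (φ y t)) (Icc 0 1) t)
    {D' : E →L[ℝ] E} {x : E} (hx : x ∈ U) (hD' : HasFDerivAt (fun y => φ y 1) D' x) (v w : E) :
    B (D' v) (D' w) = B v w := by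
  have h1 : (1 : ℝ) ∈ Icc (0 : ℝ) 1 := by simp
  have h0 : (0 : ℝ) ∈ Icc (0 : ℝ) 1 := by simp
  have hdist : ∀ y ∈ U, ∀ t ∈ Icc (0 : ℝ) 1, ‖φ y t - φ x t‖ ≤ Real.exp K * ‖y - x‖ := by
    intro y hy t ht
    have hr : ∀ z ∈ U, ∀ t ∈ Ico (0 : ℝ) 1, HasDerivWithinAt (φ z) (X (φ z t)) (Ici t) t :=
      fun z hz t ht => (hφ z hz t (Ico_subset_Icc_self ht)).mono_of_mem_nhdsWithin
        (Icc_mem_nhdsGE_of_mem ht)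
    have hc : ∀ z ∈ U, ContinuousOn (φ z) (Icc 0 1) := fun z hz t ht =>
      (hφ z hz t ht).continuousWithinAt
    have := dist_le_of_trajectories_ODE_of_mem (v := fun _ => X) (s := fun _ => s)
      (fun t _ => hL) (hc y hy) (hr y hy) (fun t ht => hφs y hy t (Ico_subset_Icc_self ht))
      (hc x hx) (hr x hx) (fun t ht => hφs x hx t (Ico_subset_Icc_self ht)) le_rfl t ht
    rw [hφ0 y hy, hφ0 x hx, dist_eq_norm, dist_eq_norm] at this
    refine this.trans ?_
    rw [mul_comm]
    have h2 : (K : ℝ) * (t - 0) ≤ K := by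
      rw [sub_zero]
      exact mul_le_of_le_one_right K.2 ht.2
    gcongr
  set e := Real.exp K
  -- Differences of flow lines replace the variational equation. The linear parts of the derivative
  -- cancel by skewness, which leaves an error cubic in the increments. After division by `h ^ 2`
  -- below it tends to zero.
  have hbound : ∀ y ∈ U, ∀ z ∈ U, ‖B (φ y 1 - φ x 1) (φ z 1 - φ x 1) - B (y - x) (z - x)‖ ≤
      ‖B‖ * C * (e * ‖y - x‖) * (e * ‖z - x‖) * (e * ‖y - x‖ + e * ‖z - x‖) := by
    intro y hy z hz
    have hd : ∀ t ∈ Icc (0 : ℝ) 1, HasDerivWithinAt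
        (fun t => B (φ y t - φ x t) (φ z t - φ x t))
        (B (φ y t - φ x t) (X (φ z t) - X (φ x t)) + B (X (φ y t) - X (φ x t)) (φ z t - φ x t))
        (Icc 0 1) t := fun t ht =>
      B.hasDerivWithinAt_of_bilinear ((hφ y hy t ht).sub (hφ x hx t ht))
        ((hφ z hz t ht).sub (hφ x hx t ht))
    have := norm_image_sub_le_of_norm_deriv_le_segment_01' hd
      (C := ‖B‖ * C * (e * ‖y - x‖) * (e * ‖z - x‖) * (e * ‖y - x‖ + e * ‖z - x‖))
      fun t ht => ?_
    · simpa only [hφ0 y hy, hφ0 z hz, hφ0 x hx] using this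
    have ht' := Ico_subset_Icc_self ht
    have hxs := hφs x hx t ht'
    have hy1 := hdist y hy t ht'
    have hz1 := hdist z hz t ht'
    have hy2 := hD _ hxs _ (hφs y hy t ht')
    have hz2 := hD _ hxs _ (hφs z hz t ht')
    set p := φ y t - φ x t
    set q := φ z t - φ x t
    have heq : B p (X (φ z t) - X (φ x t)) + B (X (φ y t) - X (φ x t)) q =
        B p (X (φ z t) - X (φ x t) - D (φ x t) q) + B (X (φ y t) - X (φ x t) - D (φ x t) p) q := by
      have h3 := hB _ hxs p q
      simp only [map_sub, sub_apply]
      linear_combination h3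
    rw [heq]
    have e0 : 0 ≤ e := (Real.exp_pos _).le
    calc _ ≤ ‖B‖ * ‖p‖ * ‖X (φ z t) - X (φ x t) - D (φ x t) q‖ +
          ‖B‖ * ‖X (φ y t) - X (φ x t) - D (φ x t) p‖ * ‖q‖ :=
          (norm_add_le _ _).trans (add_le_add (B.le_opNorm₂ _ _) (B.le_opNorm₂ _ _))
      _ ≤ ‖B‖ * (e * ‖y - x‖) * (C * (e * ‖z - x‖) ^ 2) +
          ‖B‖ * (C * (e * ‖y - x‖) ^ 2) * (e * ‖z - x‖) := by
          have hy3 := hy2.trans (mul_le_mul_of_nonneg_left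
            (pow_le_pow_left₀ (norm_nonneg _) hy1 2) hC)
          have hz3 := hz2.trans (mul_le_mul_of_nonneg_left
            (pow_le_pow_left₀ (norm_nonneg _) hz1 2) hC)
          gcongr
      _ = _ := by ring
  -- scaling of the increments
  have hline : ∀ v : E, HasDerivAt (fun h : ℝ => φ (x + h • v) 1) (D' v) 0 := by
    intro v
    have h2 : HasDerivAt (fun h : ℝ => x + h • v) v 0 := by
      simpa using ((hasDerivAt_id (0 : ℝ)).smul_const v).const_add x
    have h3 : HasFDerivAt (fun y => φ y 1) D' (x + (0 : ℝ) • v) := by simpa using hD'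
    exact h3.comp_hasDerivAt 0 h2
  have hmem : ∀ v : E, ∀ᶠ h : ℝ in 𝓝[≠] 0, x + h • v ∈ U := by
    intro v
    have h2 : Tendsto (fun h : ℝ => x + h • v) (𝓝 0) (𝓝 x) := by
      have : Continuous fun h : ℝ => x + h • v := by fun_prop
      simpa using this.tendsto 0
    exact (h2.eventually (hU.mem_nhds hx)).filter_mono nhdsWithin_le_nhds
  have ht1 : Tendsto (fun h : ℝ => B (h⁻¹ • (φ (x + h • v) 1 - φ x 1))
      (h⁻¹ • (φ (x + h • w) 1 - φ x 1))) (𝓝[≠] 0) (𝓝 (B (D' v) (D' w))) := by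
    have hs : ∀ v : E, Tendsto (fun h : ℝ => h⁻¹ • (φ (x + h • v) 1 - φ x 1)) (𝓝[≠] 0)
        (𝓝 (D' v)) := by
      intro v
      simpa using (hline v).tendsto_slope_zero
    exact ((B.continuous₂).tendsto (D' v, D' w)).comp ((hs v).prodMk_nhds (hs w))
  have ht2 : Tendsto (fun h : ℝ => B (h⁻¹ • (φ (x + h • v) 1 - φ x 1))
      (h⁻¹ • (φ (x + h • w) 1 - φ x 1))) (𝓝[≠] 0) (𝓝 (B v w)) := by
    rw [tendsto_iff_norm_sub_tendsto_zero]
    refine squeeze_zero' (g := fun h : ℝ => |h| * (‖B‖ * C * (e * ‖v‖) * (e * ‖w‖) *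
      (e * ‖v‖ + e * ‖w‖))) (Eventually.of_forall fun _ => norm_nonneg _) ?_ ?_
    · filter_upwards [hmem v, hmem w, self_mem_nhdsWithin] with h hv hw hh
      have hh' : h ≠ 0 := hh
      have h3 := hbound _ hv _ hw
      simp only [add_sub_cancel_left, norm_smul, Real.norm_eq_abs] at h3
      have h4 : B (h⁻¹ • (φ (x + h • v) 1 - φ x 1)) (h⁻¹ • (φ (x + h • w) 1 - φ x 1)) - B v w =
          ((h⁻¹ ^ 2 : ℝ) : ℂ) * (B (φ (x + h • v) 1 - φ x 1) (φ (x + h • w) 1 - φ x 1) -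
            B (h • v) (h • w)) := by
        have hhc : (h : ℂ) ≠ 0 := by exact_mod_cast hh'
        simp only [map_smul, smul_apply, Complex.real_smul]
        push_cast
        field_simp
      rw [h4, norm_mul, Complex.norm_real, Real.norm_eq_abs, abs_pow, abs_inv]
      calc _ ≤ |h|⁻¹ ^ 2 * (‖B‖ * C * (e * (|h| * ‖v‖)) * (e * (|h| * ‖w‖)) *
            (e * (|h| * ‖v‖) + e * (|h| * ‖w‖))) := by gcongr
        _ = _ := by
          have : |h| ≠ 0 := abs_ne_zero.2 hh'
          field_simp
    · have : Continuous fun h : ℝ => |h| * (‖B‖ * C * (e * ‖v‖) * (e * ‖w‖) *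
        (e * ‖v‖ + e * ‖w‖)) := by fun_prop
      simpa using (this.tendsto 0).mono_left nhdsWithin_le_nhds
  exact tendsto_nhds_unique ht1 ht2

section

variable {a : Idx m → ℝ} {b : Idx m → ℝ≥0∞} {κ : ℝ} {χ : Ser m} {d : ℕ} {X M R : ℝ}

lemma tsum_comp_bar {R : Type*} [AddCommMonoid R] [TopologicalSpace R] (y : Idx m → R) : ∑' J, y (bar J) = ∑' J, y J :=
  (Function.Involutive.toPerm bar bar_bar).tsum_eq y

lemma tsum_enorm_mul_bar_le {a : Idx m → ℝ} (ha : ∀ J, 1 ≤ a J) {l : Idx m → ℂ} {C : ℝ}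
    (hC : 0 ≤ C) (hl : ∀ J, ‖l J‖ ≤ C * (a J * a (bar J))) (x y : L2 m) :
    ∑' J, ‖l J * (emb a x J * emb a y (bar J))‖ₑ ≤ ENNReal.ofReal C * (‖x‖ₑ * ‖y‖ₑ) := by
  calc _ ≤ ∑' J, ENNReal.ofReal C * (‖x J‖ₑ * ‖y (bar J)‖ₑ) := by
        refine ENNReal.tsum_le_tsum fun J => ?_
        rw [← ofReal_mul_enorm_emb ha x, ← ofReal_mul_enorm_emb ha y, enorm_mul, enorm_mul]
        have h1 : 0 ≤ a J := by linarith [ha J]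
        calc _ ≤ ENNReal.ofReal (C * (a J * a (bar J))) *
              (‖emb a x J‖ₑ * ‖emb a y (bar J)‖ₑ) := by
              gcongr
              exact enorm_le_ofReal (hl J)
          _ = _ := by
            rw [ENNReal.ofReal_mul hC, ENNReal.ofReal_mul h1]
            ring
    _ ≤ ENNReal.ofReal C * (l2 (fun J => ‖x J‖ₑ) * l2 (fun J => ‖y (bar J)‖ₑ)) := by
        rw [ENNReal.tsum_mul_left]
        gcongr
        exact tsum_mul_le_l2 _ _
    _ = _ := by
      rw [enorm_eq_l2, enorm_eq_l2]
      congr 2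
      rw [l2, l2, tsum_comp_bar fun J => ‖y J‖ₑ ^ 2]

lemma summable_mul_bar {a : Idx m → ℝ} (ha : ∀ J, 1 ≤ a J) {l : Idx m → ℂ} {C : ℝ}
    (hC : 0 ≤ C) (hl : ∀ J, ‖l J‖ ≤ C * (a J * a (bar J))) (x y : L2 m) :
    Summable fun J => l J * (emb a x J * emb a y (bar J)) :=
  Summable.of_enorm (ne_top_of_le_ne_top (ENNReal.mul_ne_top ENNReal.ofReal_ne_top
    (ENNReal.mul_ne_top enorm_ne_top enorm_ne_top)) (tsum_enorm_mul_bar_le ha hC hl x y))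

/-- The bilinear form `∑_J l_J u_J v_{J̄}` in the coordinates of `ℓ²`. -/
def pairForm (a : Idx m → ℝ) (ha : ∀ J, 1 ≤ a J) (l : Idx m → ℂ) (C : ℝ)
    (hC : 0 ≤ C) (hl : ∀ J, ‖l J‖ ≤ C * (a J * a (bar J))) : L2 m →L[ℂ] L2 m →L[ℂ] ℂ :=
  have hs := summable_mul_bar ha hC hl
  LinearMap.mkContinuous₂ (LinearMap.mk₂ ℂ
    (fun x y : L2 m => ∑' J, l J * (emb a x J * emb a y (bar J)))
    (fun x x' y => by
      rw [← (hs x y).tsum_add (hs x' y)]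
      exact tsum_congr fun J => by rw [emb_add, Pi.add_apply]; ring)
    (fun c x y => by
      rw [smul_eq_mul, ← tsum_mul_left]
      exact tsum_congr fun J => by rw [emb_smul, Pi.smul_apply, smul_eq_mul]; ring)
    (fun x y y' => by
      rw [← (hs x y).tsum_add (hs x y')]
      exact tsum_congr fun J => by rw [emb_add, Pi.add_apply]; ring)
    (fun c x y => by
      rw [smul_eq_mul, ← tsum_mul_left]
      exact tsum_congr fun J => by rw [emb_smul, Pi.smul_apply, smul_eq_mul]; ring)) C
    (fun x y => by
      rw [LinearMap.mk₂_apply, mul_assoc]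
      have h := (enorm_tsum_le_tsum_enorm
        (f := fun J => l J * (emb a x J * emb a y (bar J)))).trans
          (tsum_enorm_mul_bar_le ha hC hl x y)
      rw [← ofReal_norm, ← ofReal_norm, ← ofReal_norm, ← ENNReal.ofReal_mul (norm_nonneg _),
        ← ENNReal.ofReal_mul hC, ENNReal.ofReal_le_ofReal_iff (by positivity)] at h
      exact h)

lemma norm_sgn_le {a : Idx m → ℝ} (ha : ∀ J, 1 ≤ a J) (J : Idx m) :
    ‖sgn J‖ ≤ 1 * (a J * a (bar J)) := by
  rw [norm_sgn, one_mul]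
  exact one_le_mul_of_one_le_of_one_le (ha J) (ha _)

/-- The symplectic form in the coordinates of `ℓ²`. -/
def sympForm (a : Idx m → ℝ) (ha : ∀ J, 1 ≤ a J) : L2 m →L[ℂ] L2 m →L[ℂ] ℂ :=
  pairForm a ha sgn 1 zero_le_one (norm_sgn_le ha)

lemma pairForm_apply {a : Idx m → ℝ} (ha : ∀ J, 1 ≤ a J) {l : Idx m → ℂ} {C : ℝ}
    (hC : 0 ≤ C) (hl : ∀ J, ‖l J‖ ≤ C * (a J * a (bar J))) (x y : L2 m) :
    pairForm a ha l C hC hl x y = ∑' J, l J * (emb a x J * emb a y (bar J)) := rfl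

lemma sympForm_apply {a : Idx m → ℝ} (ha : ∀ J, 1 ≤ a J) (x y : L2 m) :
    sympForm a ha x y = ∑' J, sgn J * (emb a x J * emb a y (bar J)) := rfl

lemma tsum_idx {g : Idx m → ℂ} (hg : Summable g) :
    ∑' J, g J = ∑' j : Fin m → ℤ, (g (j, 1) + g (j, -1)) := by
  rw [hg.tsum_prod]
  refine tsum_congr fun j => ?_
  rw [tsum_fintype]
  simp [show (Finset.univ : Finset ℤˣ) = {1, -1} from rfl]

lemma sympForm_eq_symp {a : Idx m → ℝ} (ha : ∀ J, 1 ≤ a J) (x y : L2 m) :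
    sympForm a ha x y = symp (emb a x) (emb a y) := by
  rw [sympForm_apply, tsum_idx (summable_mul_bar ha zero_le_one (norm_sgn_le ha) x y), symp]
  refine tsum_congr fun j => ?_
  simp [sgn, bar, sub_eq_add_neg]

lemma sgn_bar (J : Idx m) : sgn (bar J) = -sgn J := by simp [sgn, bar]

lemma sympForm_swap {a : Idx m → ℝ} (ha : ∀ J, 1 ≤ a J) (x y : L2 m) :
    sympForm a ha x y = -sympForm a ha y x := by
  rw [sympForm_apply, sympForm_apply, ← tsum_neg,
    ← tsum_comp_bar fun J => sgn J * (emb a x J * emb a y (bar J))]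
  refine tsum_congr fun J => ?_
  rw [bar_bar, sgn_bar]
  ring

lemma sgn_mul_sgn (J : Idx m) : sgn J * sgn J = 1 := by
  rcases Int.units_eq_one_or J.2 with h | h <;> simp [sgn, h]

/-- The derivative of a Hamiltonian in terms of its vector field and the symplectic form. -/
lemma Gen.hasFDerivAt_sympForm (hG : Gen χ d X M) (ha : Tame a b (ENNReal.ofReal κ)) (hκ : 1 ≤ κ)
    (hR : 512 * M * κ ^ 2 * R ≤ 1) {x : L2 m} (hx : ‖x‖ < R) :
    HasFDerivAt (fun x => ev χ (emb a x))
      (Complex.I • sympForm a ha.one_le (vmap a (hamCoeff χ) x)) x := by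
  have hb := hG.bddOn_iterate ha hκ hR hG.X_nonneg hG.bound 0
  rw [Function.iterate_zero, id] at hb
  obtain ⟨D, hD, hFD⟩ := hasFDerivAt_ev ha.one_le hb ENNReal.ofReal_ne_top hx
  convert hFD using 1
  ext w
  have hfin := tsum_mul_dmon_ne_top ha.one_le hb ENNReal.ofReal_ne_top hx w
  rw [hD, ← (hasSum_dev hfin).tsum_eq, smul_apply, sympForm_apply, smul_eq_mul, ← tsum_mul_left,
    ← tsum_comp_bar]
  refine tsum_congr fun J => ?_
  rw [emb_vmap ha.one_le (hG.vbddOn ha hκ hR) ENNReal.ofReal_ne_top hx.le]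
  beta_reduce
  rw [ev_hamCoeff, bar_bar, sgn_bar]
  linear_combination (emb a w J * ev (pcoef χ J) (emb a x)) * (sgn_mul_sgn J - Complex.I_mul_I *
    (sgn J * sgn J))

/-- The derivative of `χ` is `I` times the symplectic form with the field in its first slot. Hence
the form evaluated at `D v` and `w` is, up to `I`, a second derivative and symmetric in `v, w`.
Antisymmetry of the form turns this into skewness of `D`. -/
lemma Gen.sympForm_skew (hG : Gen χ d X M) (ha : Tame a b (ENNReal.ofReal κ)) (hκ : 1 ≤ κ)
    (hR : 512 * M * κ ^ 2 * R ≤ 1) {x : L2 m} (hx : ‖x‖ < R) {D : L2 m →L[ℂ] L2 m}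
    (hD : HasFDerivAt (vmap a (hamCoeff χ)) D x) (v w : L2 m) :
    sympForm a ha.one_le (D v) w + sympForm a ha.one_le v (D w) = 0 := by
  have h1 : ∀ᶠ y in nhds x, HasFDerivAt (fun x => ev χ (emb a x))
      (Complex.I • sympForm a ha.one_le (vmap a (hamCoeff χ) y)) y := by
    have : Metric.ball (0 : L2 m) R ∈ nhds x :=
      Metric.isOpen_ball.mem_nhds (mem_ball_zero_iff.2 hx)
    filter_upwards [this] with y hy
    exact hG.hasFDerivAt_sympForm ha hκ hR (mem_ball_zero_iff.1 hy)
  have h2 := ((sympForm a ha.one_le).hasFDerivAt.comp x hD).const_smul Complex.I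
  have h3 := second_derivative_symmetric_of_eventually h1 h2 v w
  simp only [smul_apply, ContinuousLinearMap.comp_apply, smul_eq_mul] at h3
  rw [sympForm_swap ha.one_le v, mul_left_cancel₀ Complex.I_ne_zero h3, add_neg_cancel]

open Set in
lemma Gen.exists_flow_line (hG : Gen χ d X M) (ha : Tame a b (ENNReal.ofReal κ)) (hκ : 1 ≤ κ)
    (hR0 : 0 < R) (hR : 512 * M * κ ^ 2 * R ≤ 1) {x : L2 m} (hx : ‖x‖ < R / 8) :
    ∃ φ : ℝ → L2 m, φ 0 = x ∧ (∀ t, ‖φ t‖ ≤ 3 / 2 * ‖x‖) ∧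
      ∀ t ∈ Icc (0 : ℝ) 1, HasDerivWithinAt φ (vmap a (hamCoeff χ) (φ t)) (Icc 0 1) t := by
  obtain ⟨φ, h0, h1, h2⟩ := NormalForm.exists_flow_line (hG.lipschitzOnWith ha hκ hR0 hR)
    (fun y hy => (hG.norm_vmap_le ha hκ hR (by linarith [mem_ball_zero_iff.1 hy])).trans
      (by linarith [norm_nonneg y])) (by linarith : 2 * ‖x‖ < R / 2)
  refine ⟨φ, h0, fun t => ?_, h2⟩
  have := norm_add_le x (φ t - x)
  rw [add_sub_cancel] at this
  linarith [h1 t]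

/-- Lie derivatives of the coordinate `u_J` keep its signed momentum and have degree at least 1, so
the tame estimate applies to them. As a bounded family of series, the time-one map is holomorphic.
-/
lemma Gen.vbddOn_lieSer (hG : Gen χ d X M) (ha : Tame a b (ENNReal.ofReal κ)) (hκ : 1 ≤ κ)
    (hR : 512 * M * κ ^ 2 * R ≤ 1) :
    VBddOn a (fun J => lieSer χ (coordSer J)) R (ENNReal.ofReal (64 * M * κ * R)) := by
  intro y hy
  have hM := hG.one_le_M
  refine (nrm_maj_le (ε := 1) (ℓ := 0) (q := 1) (θ := 2 * M) (B := 4) (κ := κ)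
    ha.one_le ha.l2_le (by positivity) (by positivity) (by positivity) one_pos le_rfl
    zero_le_one ?_ (fun J w => (hG.norm_lieSer_le zero_le_one (norm_coordSer_le hM J) w).trans_eq
      (by ring)) (fun J w hz => ?_) hy).trans ?_
  · rcases le_total R 0 with h0 | h0
    · nlinarith [mul_nonneg (by linarith : 0 ≤ M) (by linarith : 0 ≤ κ)]
    · nlinarith [mul_nonneg (by linarith : 0 ≤ M) h0, mul_le_mul hκ hκ zero_le_one (by linarith)]
  · obtain ⟨n, hn⟩ : ∃ n : ℕ, (lie χ)^[n] (coordSer J) w ≠ 0 := by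
      by_contra! h
      exact hz (by simp [lieSer, h])
    obtain ⟨h1, h2⟩ := SuppOn.iterate_lie hG.supp (suppOn_coordSer J) n w hn
    have h3 : 1 ≤ w.length := by omega
    refine ⟨h3, h2, ?_⟩
    rw [ENNReal.ofReal_one, one_mul]
    exact ha.tame J w h2 (by rintro rfl; simp at h3)
  · calc _ ≤ ENNReal.ofReal (8 * 4 * 1 * (2 * M) * κ * 1 ^ 0) * ENNReal.ofReal R := by gcongr
      _ = _ := by
        rw [← ENNReal.ofReal_mul (by positivity)]
        congr 1
        ring

lemma Gen.emb_vmap_lieSer (hG : Gen χ d X M) (ha : Tame a b (ENNReal.ofReal κ)) (hκ : 1 ≤ κ)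
    (hR : 512 * M * κ ^ 2 * R ≤ 1) {x : L2 m} (hx : ‖x‖ ≤ R) :
    emb a (vmap a (fun J => lieSer χ (coordSer J)) x) = lieMap χ (emb a x) :=
  emb_vmap ha.one_le (hG.vbddOn_lieSer ha hκ hR) ENNReal.ofReal_ne_top hx

open Set in
-- The Lie series of the coordinate functions give the flow. As `lieMap` is built from coefficients
-- alone, the flows in the spaces for different weights are restrictions of one and the same map.
lemma Gen.vmap_lieSer_eq (hG : Gen χ d X M) (ha : Tame a b (ENNReal.ofReal κ)) (hκ : 1 ≤ κ)
    (hR0 : 0 < R) (hR : 512 * M * κ ^ 2 * R ≤ 1) {φ : ℝ → L2 m}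
    (hφ : ∀ t ∈ Icc (0 : ℝ) 1, ‖φ t‖ ≤ R / 2)
    (hd : ∀ t ∈ Icc (0 : ℝ) 1, HasDerivWithinAt φ (vmap a (hamCoeff χ) (φ t)) (Icc 0 1) t) :
    vmap a (fun J => lieSer χ (coordSer J)) (φ 0) = φ 1 := by
  refine emb_injective ha.one_le ?_
  rw [hG.emb_vmap_lieSer ha hκ hR ((hφ 0 (by simp)).trans (by linarith))]
  funext J
  rw [lieMap, hG.ev_lieSer ha hκ hR0 hR zero_le_one (norm_coordSer_le hG.one_le_M J) hφ hd,
    ev_coordSer]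

lemma Gen.differentiableAt (hG : Gen χ d X M) (ha : Tame a b (ENNReal.ofReal κ)) (hκ : 1 ≤ κ)
    (hR : 512 * M * κ ^ 2 * R ≤ 1) {x : L2 m} (hx : ‖x‖ < R) :
    DifferentiableAt ℂ (vmap a (fun J => lieSer χ (coordSer J))) x := by
  obtain ⟨D, -, -, hD⟩ := exists_fderiv_vmap ha.one_le (hG.vbddOn_lieSer ha hκ hR)
    ENNReal.ofReal_ne_top (sub_pos.2 hx) (by linarith : ‖x‖ + (R - ‖x‖) ≤ R)
  exact hD.differentiableAt

open Set in
/-- The transformation generated by `χ` is symplectic. -/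
lemma Gen.sympForm_fderiv (hG : Gen χ d X M) (ha : Tame a b (ENNReal.ofReal κ)) (hκ : 1 ≤ κ)
    (hR0 : 0 < R) (hR : 512 * M * κ ^ 2 * R ≤ 1) {x : L2 m} (hx : ‖x‖ < R / 8) (v w : L2 m) :
    sympForm a ha.one_le (fderiv ℂ (vmap a (fun J => lieSer χ (coordSer J))) x v)
      (fderiv ℂ (vmap a (fun J => lieSer χ (coordSer J))) x w) = sympForm a ha.one_le v w := by
  choose! φ h0 h1 h2 using fun (y : L2 m) (hy : y ∈ Metric.ball (0 : L2 m) (R / 8)) =>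
    hG.exists_flow_line ha hκ hR0 hR (mem_ball_zero_iff.1 hy)
  have h3 : ∀ y ∈ Metric.ball (0 : L2 m) (R / 8), ∀ t, ‖φ y t‖ < R / 4 := fun y hy t => by
    have := mem_ball_zero_iff.1 hy
    linarith [h1 y hy t]
  choose! D g1 g2 g3 using fun (x : L2 m) (hx : ‖x‖ ≤ R / 2) =>
    hG.exists_fderiv ha hκ hR0 hR hx
  have hx' : x ∈ Metric.ball (0 : L2 m) (R / 8) := mem_ball_zero_iff.2 hx
  have hs : ∀ y ∈ Metric.ball (0 : L2 m) (R / 4), ‖y‖ < R / 4 := fun y hy =>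
    mem_ball_zero_iff.1 hy
  have hD : HasFDerivAt (fun y => φ y 1)
      ((fderiv ℂ (vmap a (fun J => lieSer χ (coordSer J))) x).restrictScalars ℝ) x := by
    refine ((hG.differentiableAt ha hκ hR
      (by linarith)).hasFDerivAt.restrictScalars ℝ).congr_of_eventuallyEq ?_
    filter_upwards [Metric.isOpen_ball.mem_nhds hx'] with y hy
    have := hG.vmap_lieSer_eq ha hκ hR0 hR (φ := φ y) (fun t _ => by linarith [h3 y hy t])
      (h2 y hy)
    rw [← this, h0 y hy]
  exact bilin_fderiv_flow_eq ((sympForm a ha.one_le).bilinearRestrictScalars ℝ)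
    (D := fun y => (D y).restrictScalars ℝ) (s := Metric.ball 0 (R / 4)) (C := 1 / R)
    (by positivity)
    ((hG.lipschitzOnWith ha hκ hR0 hR).mono (Metric.ball_subset_ball (by linarith)))
    (fun y hy z hz => by
      have h4 := norm_sub_le z y
      have := g2 y (by linarith [hs y hy]) (z - y) (by linarith [hs y hy, hs z hz])
      rwa [add_sub_cancel] at this)
    (fun y hy v w => hG.sympForm_skew ha hκ hR (by linarith [hs y hy])
      (g3 y (by linarith [hs y hy])) v w)
    Metric.isOpen_ball h0 (fun y hy t _ => mem_ball_zero_iff.2 (h3 y hy t)) h2 hx' hD v w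

open Set in
/-- The time-one flow, as a composition with the Lie series and with an inverse. -/
lemma Gen.exists_vmap_lieSer (hG : Gen χ d X M) (ha : Tame a b (ENNReal.ofReal κ)) (hκ : 1 ≤ κ)
    (hR0 : 0 < R) (hR : 512 * M * κ ^ 2 * R ≤ 1) {x : L2 m} (hx : ‖x‖ < R / 8) :
    ∃ y : L2 m, ‖y‖ ≤ 3 / 2 * ‖x‖ ∧ lieMap χ (emb a x) = emb a y ∧
      lieMap (-χ) (emb a y) = emb a x ∧
      ∀ (F : Ser m) (B : ℝ), 0 ≤ B → (∀ w, ‖F w‖ ≤ B * M ^ w.length) →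
        ev (lieSer χ F) (emb a x) = ev F (emb a y) := by
  obtain ⟨φ, h0, h1, h2⟩ := hG.exists_flow_line ha hκ hR0 hR hx
  have hn : ∀ t, ‖φ t‖ ≤ R / 2 := fun t => (h1 t).trans (by linarith)
  have hneg : ∀ y, ‖y‖ ≤ R → vmap a (hamCoeff (-χ)) y = -vmap a (hamCoeff χ) y := by
    intro y hy
    refine emb_injective ha.one_le ?_
    rw [emb_vmap ha.one_le (hG.neg.vbddOn ha hκ hR) ENNReal.ofReal_ne_top hy,
      ← neg_one_smul ℂ (vmap a (hamCoeff χ) y), emb_smul, emb_vmap ha.one_le (hG.vbddOn ha hκ hR) ENNReal.ofReal_ne_top hy]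
    funext J
    simp [ev, hamCoeff_neg, tsum_neg]
  -- The flow line run backwards is a flow line of `-χ`; this provides the inverse without a
  -- separate existence argument.
  have hrev : ∀ t ∈ Icc (0 : ℝ) 1, HasDerivWithinAt (fun t => φ (1 - t))
      (vmap a (hamCoeff (-χ)) (φ (1 - t))) (Icc 0 1) t := by
    intro t ht
    have ht' : 1 - t ∈ Icc (0 : ℝ) 1 := ⟨by linarith [ht.2], by linarith [ht.1]⟩
    have h3 : HasDerivWithinAt (fun t : ℝ => 1 - t) (-1) (Icc 0 1) t := by
      simpa using ((hasDerivAt_id t).const_sub 1).hasDerivWithinAt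
    have h4 := (h2 (1 - t) ht').scomp t h3 fun s hs => ⟨by linarith [hs.2], by linarith [hs.1]⟩
    rw [hneg _ (by linarith [hn (1 - t)])]
    simpa [Function.comp_def] using h4
  refine ⟨φ 1, h1 1, ?_, ?_, fun F B hB hF => ?_⟩
  · rw [← hG.vmap_lieSer_eq ha hκ hR0 hR (fun t _ => hn t) h2,
      hG.emb_vmap_lieSer ha hκ hR (by rw [h0]; linarith), h0]
  · have := hG.neg.vmap_lieSer_eq ha hκ hR0 hR (φ := fun t => φ (1 - t)) (fun t _ => hn _) hrev
    simp only [sub_zero, sub_self, h0] at this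
    rw [← this, hG.neg.emb_vmap_lieSer ha hκ hR (by linarith [hn 1])]
  · rw [← h0]
    exact hG.ev_lieSer ha hκ hR0 hR hB hF (fun t _ => hn t) h2

end

/-! ### Reality of the transformation -/

section reality

lemma isReal_iff {u : Seq m} : IsReal u ↔ ∀ J, u (bar J) = conj (u J) := by
  refine ⟨fun h J => ?_, fun h j => h (j, 1)⟩
  obtain ⟨j, σ⟩ := J
  rcases Int.units_eq_one_or σ with rfl | rfl
  · exact h j
  · rw [h j, Complex.conj_conj, bar]
    simp

lemma mon_map_bar {u : Seq m} (hu : IsReal u) (w : Word m) : mon u (w.map bar) = conj (mon u w) := by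
  induction w with
  | nil => simp
  | cons J w ih => rw [List.map_cons, mon_cons, mon_cons, ih, isReal_iff.1 hu, map_mul]

lemma map_bar_map_bar (w : Word m) : (w.map bar).map bar = w := by
  simp [Function.comp_def, bar_bar]

lemma ev_star' {u : Seq m} (hu : IsReal u) (F : Ser m) : ev (star' F) u = conj (ev F u) := by
  rw [ev, ev, Complex.conj_tsum,
    ← (Function.Involutive.toPerm (List.map (bar (m := m))) map_bar_map_bar).tsum_eq]
  refine tsum_congr fun w => ?_
  change star' F (w.map bar) * mon u (w.map bar) = _
  rw [star', map_bar_map_bar, mon_map_bar hu, map_mul]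

lemma star'_lieSer (χ F : Ser m) : star' (lieSer χ F) = lieSer (star' χ) (star' F) := by
  funext w
  rw [star', lieSer, lieSer, Complex.conj_tsum]
  refine tsum_congr fun n => ?_
  rw [map_div₀, ← star'_iterate_lie, Complex.conj_natCast, star']

lemma star'_coordSer (J : Idx m) : star' (coordSer J) = coordSer (bar J) := by
  funext w
  have h : w.map bar = [J] ↔ w = [bar J] := by
    constructor
    · intro h
      rw [← map_bar_map_bar w, h]
      rfl
    · rintro rfl
      simp [bar_bar]
  by_cases hw : w = [bar J]
  · simp [star', coordSer, hw, bar_bar]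
  · simp [star', coordSer, h, hw]

lemma isReal_lieMap {χ : Ser m} (hχ : star' χ = χ) {u : Seq m} (hu : IsReal u) :
    IsReal (lieMap χ u) := by
  rw [isReal_iff]
  intro J
  rw [lieMap, lieMap, ← ev_star' hu, star'_lieSer, hχ, star'_coordSer]

end reality

/-! ### High modes and the tame estimates for the two weights -/

/-- The number of high modes of a word. -/
def highs (N : ℕ) (w : Word m) : ℕ := w.countP fun J => decide ((N : ℝ) < len J.1)

lemma highs_append (N : ℕ) (v w : Word m) : highs N (v ++ w) = highs N v + highs N w :=
  List.countP_append

lemma highs_cons (N : ℕ) (J : Idx m) (w : Word m) :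
    highs N (J :: w) = highs N w + if (N : ℝ) < len J.1 then 1 else 0 := by
  simp [highs, List.countP_cons]

lemma exists_of_highs_pos {N : ℕ} {w : Word m} (h : 0 < highs N w) : ∃ K ∈ w, (N : ℝ) < len K.1 := by
  simpa using List.countP_pos_iff.1 h

section weights

lemma len_mom_le (w : Word m) : len (mom w) ≤ (w.map fun K => len K.1).sum := by
  induction w with
  | nil => simp [len_zero]
  | cons J w ih =>
    rw [mom_cons, List.map_cons, List.sum_cons]
    refine (len_add_le _ _).trans (add_le_add (le_of_eq ?_) ih)
    exact len_units_smul _ _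

lemma exists_split_of_max {w : Word m} (hw : w ≠ []) : ∃ p I r, w = p ++ I :: r ∧
    ∀ K ∈ w, len K.1 ≤ len I.1 := by
  obtain ⟨I, hI, hmax⟩ := w.toFinset.exists_max_image (fun K => len K.1)
    (List.toFinset_nonempty_iff _ |>.2 hw)
  obtain ⟨p, r, h⟩ := List.append_of_mem (List.mem_toFinset.1 hI)
  exact ⟨p, I, r, h, fun K hK => hmax K (List.mem_toFinset.2 hK)⟩

lemma le_dmon {p : Word m} (u h : Idx m → ℝ≥0∞) (I : Idx m) (r : Word m) :
    mon u p * h I * mon u r ≤ dmon u h (p ++ I :: r) := by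
  induction p with
  | nil => simp
  | cons K p ih =>
    rw [List.cons_append, dmon_cons, mon_cons]
    calc _ = u K * (mon u p * h I * mon u r) := by ring
      _ ≤ u K * dmon u h (p ++ I :: r) := by gcongr
      _ ≤ _ := le_add_self

lemma mon_ofReal_exp (t : ℝ) (g : Idx m → ℝ) (w : Word m) :
    mon (fun J => ENNReal.ofReal (Real.exp (t * g J))) w =
      ENNReal.ofReal (Real.exp (t * (w.map g).sum)) := by
  induction w with
  | nil => simp
  | cons J w ih =>
    rw [mon_cons, ih, ← ENNReal.ofReal_mul (Real.exp_pos _).le, ← Real.exp_add, List.map_cons,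
      List.sum_cons, mul_add]

variable {f : ℝ → ℝ} {c Cf s₀ s : ℝ}

lemma WeightAssumption.wt_pos (hf : WeightAssumption f c Cf) (J : Idx m) : 0 < wt f c J :=
  hf.pos _ (le_max_right _ _)

/-- Two entries equal to `c` give `f c ≤ f (2 c) ≤ (1 + Cf) f c`. -/
lemma WeightAssumption.Cf_nonneg (hf : WeightAssumption f c Cf) : 0 ≤ Cf := by
  have h1 := hf.sub 2 (fun _ => c) 0 (fun _ => le_rfl) fun _ => le_rfl
  have h2 : f c ≤ f (c + c) := hf.mono (Set.mem_Ici.2 le_rfl)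
    (Set.mem_Ici.2 (by linarith [hf.c_pos])) (by linarith [hf.c_pos])
  have h3 := hf.pos c le_rfl
  rw [show (Finset.univ : Finset (Fin 2)).erase 0 = {1} from rfl] at h1
  simp only [Fin.sum_univ_two, Finset.sum_singleton] at h1
  by_contra! h
  nlinarith

lemma IsThreshold.pos (hf : WeightAssumption f c Cf) (hs₀ : IsThreshold m f c Cf s₀) : 0 < s₀ := by
  have h1 := hs₀.1.le_tsum (0, 1) fun _ _ => (Real.exp_pos _).le
  have h2 : Real.exp ((2 * Cf - 2) * s₀ * wt f c ((0, 1) : Idx m)) < 1 := by linarith [hs₀.2]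
  rw [Real.exp_lt_one_iff] at h2
  have h3 := hf.wt_pos ((0, 1) : Idx m)
  have h4 := hf.Cf_lt_one
  by_contra! h
  have : 0 ≤ (2 * Cf - 2) * s₀ := mul_nonneg_of_nonpos_of_nonpos (by linarith) h
  nlinarith

/-- Subadditivity of the weight along words with given momentum. -/
lemma WeightAssumption.wt_le (hf : WeightAssumption f c Cf) {p r : Word m} {I J : Idx m}
    (hmax : ∀ K ∈ p ++ I :: r, len K.1 ≤ len I.1)
    (hmom : mom (p ++ I :: r) = (J.2 : ℤ) • J.1) :
    wt f c J ≤ wt f c I + Cf * ((p ++ r).map (wt f c)).sum := by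
  set w := p ++ I :: r with hw
  have hp : p.length < w.length := by simp [hw]
  set q : Fin w.length := ⟨p.length, hp⟩
  have hq : w.get q = I := by simp [q, hw]
  set x : Fin w.length → ℝ := fun l => max (len (w.get l).1) c
  have hxq : ∀ l, x l ≤ x q := fun l => by
    simp only [x, hq]
    exact max_le_max (hmax _ (List.get_mem _ _)) le_rfl
  have hsum : ∑ l, x l = (w.map fun K => max (len K.1) c).sum :=
    Fin.sum_univ_fun_getElem w (fun K => max (len K.1) c)
  have h1 := hf.sub _ x q (fun l => le_max_right _ _) hxq
  have h2 : f (max (len J.1) c) ≤ f (∑ l, x l) := by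
    have hqs : x q ≤ ∑ l, x l := Finset.single_le_sum (f := x)
      (fun l _ => hf.c_pos.le.trans (le_max_right _ _)) (Finset.mem_univ q)
    have hc : c ≤ ∑ l, x l := (le_max_right _ _).trans hqs
    refine hf.mono (Set.mem_Ici.2 (le_max_right _ _)) (Set.mem_Ici.2 hc) (max_le ?_ hc)
    rw [← len_units_smul J.2, ← hmom, hsum]
    refine (len_mom_le w).trans ?_
    exact List.sum_le_sum fun K _ => le_max_left _ _
  have h3 : ∑ l ∈ Finset.univ.erase q, f (x l) = ((p ++ r).map (wt f c)).sum := by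
    have h4 : ∑ l, f (x l) = (w.map (wt f c)).sum := Fin.sum_univ_fun_getElem w (wt f c)
    have h5 := Finset.add_sum_erase Finset.univ (fun l => f (x l)) (Finset.mem_univ q)
    rw [h4] at h5
    simp only [x, hq, hw, List.map_append, List.map_cons, List.sum_append, List.sum_cons] at h5 ⊢
    change wt f c I + _ = _ at h5
    linarith
  rw [h3] at h1
  refine (h2.trans h1).trans_eq ?_
  simp only [x, hq, wt]

/-- The weight of `W_s` in product form. -/
def expWt (f : ℝ → ℝ) (c s : ℝ) (J : Idx m) : ℝ := Real.exp (s * wt f c J)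

/-- The weight of the factors that do not carry the norm. -/
def sideWt (f : ℝ → ℝ) (c Cf s₀ s : ℝ) (J : Idx m) : ℝ≥0∞ :=
  -- The part `s * Cf` is what subadditivity demands, and the rest is a surplus to be spent on high
  -- modes. The total is `s - (1 - Cf) s₀`, so the ratio to `expWt` is square summable exactly by
  -- the threshold condition.
  ENNReal.ofReal (Real.exp ((s * Cf + (1 - Cf) * (s - s₀)) * wt f c J))

lemma wt_sum_nonneg (hf : WeightAssumption f c Cf) (w : Word m) : 0 ≤ (w.map (wt f c)).sum :=
  List.sum_nonneg fun x hx => by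
    obtain ⟨K, -, rfl⟩ := List.mem_map.1 hx
    exact (hf.wt_pos K).le

lemma le_wt_sum (hf : WeightAssumption f c Cf) {N : ℕ} (hN : c ≤ N) {w : Word m}
    (hw : 0 < highs N w) : f N ≤ (w.map (wt f c)).sum := by
  obtain ⟨K, hK, hN'⟩ := exists_of_highs_pos hw
  have h1 : f N ≤ wt f c K :=
    hf.mono (Set.mem_Ici.2 hN) (Set.mem_Ici.2 (le_max_right _ _)) (hN'.le.trans (le_max_left _ _))
  refine h1.trans ?_
  obtain ⟨p, r, rfl⟩ := List.append_of_mem hK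
  rw [List.map_append, List.sum_append, List.map_cons, List.sum_cons]
  linarith [wt_sum_nonneg hf p, wt_sum_nonneg hf r]

/-- The letter of largest length takes the weight of the norm. Whatever surplus `E` the remaining
letters are sure to have becomes the factor `exp (-E)`. -/
lemma expWt_le_dmon (hf : WeightAssumption f c Cf) (hs : 0 ≤ s) {w : Word m} {J : Idx m}
    (hw : w ≠ []) (hmom : mom w = (J.2 : ℤ) • J.1) {E : ℝ}
    (hE : ∀ p I r, w = p ++ I :: r → E ≤ (1 - Cf) * (s - s₀) * ((p ++ r).map (wt f c)).sum) :
    ENNReal.ofReal (expWt f c s J) ≤ ENNReal.ofReal (Real.exp (-E)) *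
      dmon (sideWt f c Cf s₀ s) (fun I => ENNReal.ofReal (expWt f c s I)) w := by
  obtain ⟨p, I, r, rfl, hmax⟩ := exists_split_of_max hw
  have h1 := hf.wt_le hmax hmom
  have h2 := hE p I r rfl
  refine le_trans ?_ (mul_le_mul' le_rfl (le_dmon _ _ _ _))
  unfold sideWt expWt
  rw [mon_ofReal_exp, mon_ofReal_exp, ← ENNReal.ofReal_mul (Real.exp_pos _).le,
    ← ENNReal.ofReal_mul (by positivity), ← ENNReal.ofReal_mul (Real.exp_pos _).le]
  refine ENNReal.ofReal_le_ofReal ?_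
  rw [← Real.exp_add, ← Real.exp_add, ← Real.exp_add, Real.exp_le_exp]
  rw [List.map_append, List.sum_append] at h1 h2
  nlinarith [mul_le_mul_of_nonneg_left h1 hs]

/-- The tame estimate gains a small factor for words with two high modes. -/
lemma expWt_le_of_two_le_highs (hf : WeightAssumption f c Cf) (hs₀ : 0 ≤ s₀) (hs : s₀ ≤ s) {N : ℕ}
    (hN : c ≤ N) {w : Word m} {J : Idx m} (hw : 2 ≤ highs N w)
    (hmom : mom w = (J.2 : ℤ) • J.1) :
    ENNReal.ofReal (expWt f c s J) ≤ ENNReal.ofReal (Real.exp (-((1 - Cf) * (s - s₀) * f N))) *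
      dmon (sideWt f c Cf s₀ s) (fun I => ENNReal.ofReal (expWt f c s I)) w := by
  refine expWt_le_dmon hf (hs₀.trans hs) (by rintro rfl; simp [highs] at hw) hmom ?_
  rintro p I r rfl
  rw [highs_append, highs_cons] at hw
  -- Whichever letter carries the norm, a second high letter remains among the side factors.
  have h1 : 0 < highs N (p ++ r) := by
    rw [highs_append]
    split_ifs at hw <;> omega
  have h2 : 0 ≤ (1 - Cf) * (s - s₀) :=
    mul_nonneg (by linarith [hf.Cf_lt_one]) (sub_nonneg.2 hs)
  exact mul_le_mul_of_nonneg_left (le_wt_sum hf hN h1) h2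

lemma l2_sideWt_le (hs₀ : IsThreshold m f c Cf s₀)
    {a : Idx m → ℝ} (ha : ∀ J, expWt f c s J ≤ a J) :
    l2 (fun J => sideWt f c Cf s₀ s J / ENNReal.ofReal (a J)) ≤ 1 := by
  rw [l2_le_iff, one_pow]
  calc _ ≤ ∑' J : Idx m, ENNReal.ofReal (Real.exp ((2 * Cf - 2) * s₀ * wt f c J)) := by
        refine ENNReal.tsum_le_tsum fun J => ?_
        have h1 : sideWt f c Cf s₀ s J / ENNReal.ofReal (a J) ≤
            ENNReal.ofReal (Real.exp ((Cf - 1) * s₀ * wt f c J)) := by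
          refine ENNReal.div_le_of_le_mul ?_
          refine le_trans ?_ (mul_le_mul' le_rfl (ENNReal.ofReal_le_ofReal (ha J)))
          rw [← ENNReal.ofReal_mul (Real.exp_pos _).le, expWt, ← Real.exp_add, sideWt]
          refine ENNReal.ofReal_le_ofReal (Real.exp_le_exp.2 (le_of_eq ?_))
          ring
        calc _ ≤ ENNReal.ofReal (Real.exp ((Cf - 1) * s₀ * wt f c J)) ^ 2 := by gcongr
          _ = _ := by
            rw [← ENNReal.ofReal_pow (Real.exp_pos _).le, ← Real.exp_nat_mul]
            congr 2
            push_cast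
            ring
    _ = ENNReal.ofReal (∑' J : Idx m, Real.exp ((2 * Cf - 2) * s₀ * wt f c J)) :=
        (ENNReal.ofReal_tsum_of_nonneg (fun _ => (Real.exp_pos _).le) hs₀.1).symm
    _ ≤ 1 := ENNReal.ofReal_le_one.2 (by linarith [hs₀.2])

lemma one_le_expWt (hf : WeightAssumption f c Cf) (hs : 0 ≤ s) (J : Idx m) : 1 ≤ expWt f c s J :=
  Real.one_le_exp (mul_nonneg hs (hf.wt_pos J).le)

lemma side_exponent_nonneg (hf : WeightAssumption f c Cf) (hs₀ : 0 ≤ s₀) (hs : s₀ ≤ s) :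
    0 ≤ s * Cf + (1 - Cf) * (s - s₀) :=
  add_nonneg (mul_nonneg (hs₀.trans hs) hf.Cf_nonneg)
    (mul_nonneg (by linarith [hf.Cf_lt_one]) (sub_nonneg.2 hs))

lemma one_le_sideWt (hf : WeightAssumption f c Cf) (hs₀ : 0 ≤ s₀) (hs : s₀ ≤ s) (J : Idx m) :
    1 ≤ sideWt f c Cf s₀ s J := by
  rw [sideWt, ENNReal.one_le_ofReal]
  exact Real.one_le_exp (mul_nonneg (side_exponent_nonneg hf hs₀ hs) (hf.wt_pos J).le)

lemma tame_expWt (hf : WeightAssumption f c Cf) (hs₀ : IsThreshold m f c Cf s₀) (hs : s₀ ≤ s)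
    {κ : ℝ} (hκ : 1 ≤ κ) :
    Tame (expWt f c s) (sideWt (m := m) f c Cf s₀ s) (ENNReal.ofReal κ) where
  one_le := one_le_expWt hf ((hs₀.pos hf).le.trans hs)
  bar _ := rfl
  one_le_b := one_le_sideWt hf (hs₀.pos hf).le hs
  tame J w hmom hw := by
    have h1 := expWt_le_dmon hf ((hs₀.pos hf).le.trans hs) (s₀ := s₀) hw hmom (E := 0)
      fun p I r _ => mul_nonneg (mul_nonneg (by linarith [hf.Cf_lt_one]) (sub_nonneg.2 hs))
        (wt_sum_nonneg hf _)
    rw [neg_zero, Real.exp_zero, ENNReal.ofReal_one, one_mul] at h1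
    refine h1.trans (le_mul_of_one_le_left' ?_)
    exact one_le_pow₀ (ENNReal.one_le_ofReal.2 hκ)
  l2_le := l2_sideWt_le hs₀ fun _ => le_rfl

/-- The weight of sequences of finite energy in `W_s`. -/
def energyWt (f : ℝ → ℝ) (c s β η : ℝ) (J : Idx m) : ℝ :=
  Real.sqrt (Real.exp (2 * (s * wt f c J)) + η * max (len J.1) 1 ^ β)

variable {β η : ℝ}

lemma energyWt_sq (hη : 0 ≤ η) (J : Idx m) : energyWt f c s β η J ^ 2 =
    expWt f c s J ^ 2 + η * max (len J.1) 1 ^ β := by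
  rw [energyWt, Real.sq_sqrt (by positivity), expWt, ← Real.exp_nat_mul]
  norm_num

lemma expWt_le_energyWt (hη : 0 ≤ η) (J : Idx m) : expWt f c s J ≤ energyWt f c s β η J := by
  refine le_of_sq_le_sq ?_ (Real.sqrt_nonneg _)
  rw [energyWt_sq hη]
  have : 0 ≤ η * max (len J.1) 1 ^ β := by positivity
  linarith

/-- The exponential part is treated as before. For the polynomial part, the momentum is at most `k`
times the largest length, and `k ^ β ≤ exp (β k)` costs only a constant per letter, independent of
`η`. -/
lemma energyWt_le_dmon (hf : WeightAssumption f c Cf) (hs₀ : 0 ≤ s₀) (hs : s₀ ≤ s) (hη : 0 ≤ η)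
    (hβ : 0 ≤ β) {w : Word m} {J : Idx m} (hw : w ≠ []) (hmom : mom w = (J.2 : ℤ) • J.1) :
    ENNReal.ofReal (energyWt f c s β η J) ≤ ENNReal.ofReal (Real.exp β) ^ w.length *
      dmon (sideWt f c Cf s₀ s) (fun I => ENNReal.ofReal (energyWt f c s β η I)) w := by
  obtain ⟨p, I, r, rfl, hmax⟩ := exists_split_of_max hw
  have h1 := hf.wt_le hmax hmom
  set w := p ++ I :: r
  set k := w.length
  have hk : (1 : ℝ) ≤ k := by
    have : 1 ≤ k := List.length_pos_of_ne_nil hw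
    exact_mod_cast this
  refine le_trans ?_ (mul_le_mul' le_rfl (le_dmon _ _ _ _))
  have hG := wt_sum_nonneg hf (p ++ r)
  have hB := side_exponent_nonneg hf hs₀ hs
  have h2 : mon (sideWt f c Cf s₀ s) p * ENNReal.ofReal (energyWt f c s β η I) *
      mon (sideWt f c Cf s₀ s) r = ENNReal.ofReal (Real.exp ((s * Cf + (1 - Cf) * (s - s₀)) *
        ((p ++ r).map (wt f c)).sum)) * ENNReal.ofReal (energyWt f c s β η I) := by
    unfold sideWt
    rw [mul_right_comm, ← mon_append, mon_ofReal_exp]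
  rw [h2, ← ENNReal.ofReal_pow (Real.exp_pos _).le, ← ENNReal.ofReal_mul (Real.exp_pos _).le,
    ← ENNReal.ofReal_mul (by positivity)]
  refine ENNReal.ofReal_le_ofReal (le_of_sq_le_sq ?_
    (mul_nonneg (by positivity) (mul_nonneg (Real.exp_pos _).le (Real.sqrt_nonneg _))))
  rw [mul_pow, mul_pow, energyWt_sq hη, energyWt_sq hη]
  set G := ((p ++ r).map (wt f c)).sum
  set Q := Real.exp ((s * Cf + (1 - Cf) * (s - s₀)) * G)
  have hQ : 1 ≤ Q := Real.one_le_exp (mul_nonneg hB hG)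
  have hK : (k : ℝ) ^ β ≤ (Real.exp β ^ k) ^ 2 := by
    have h3 : (k : ℝ) ≤ Real.exp k := by linarith [Real.add_one_le_exp (k : ℝ)]
    have h4 : (k : ℝ) ^ β ≤ Real.exp β ^ k := by
      calc (k : ℝ) ^ β ≤ Real.exp k ^ β := by gcongr
        _ = _ := by rw [← Real.exp_mul, ← Real.exp_nat_mul]
    have h5 : 1 ≤ Real.exp β ^ k := one_le_pow₀ (Real.one_le_exp hβ)
    nlinarith
  have hK1 : 1 ≤ (Real.exp β ^ k) ^ 2 :=
    one_le_pow₀ (one_le_pow₀ (Real.one_le_exp hβ))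
  have h6 : expWt f c s J ≤ Q * expWt f c s I := by
    rw [expWt, expWt, ← Real.exp_add, Real.exp_le_exp]
    have h7 : 0 ≤ (1 - Cf) * (s - s₀) * G :=
      mul_nonneg (mul_nonneg (by linarith [hf.Cf_lt_one]) (sub_nonneg.2 hs)) hG
    nlinarith [mul_le_mul_of_nonneg_left h1 (hs₀.trans hs)]
  have h8 : max (len J.1) 1 ≤ k * max (len I.1) 1 := by
    have h9 : len J.1 ≤ k * len I.1 := by
      rw [← len_units_smul J.2, ← hmom]
      refine (len_mom_le w).trans ?_
      have := List.sum_le_card_nsmul (w.map fun K => len K.1) (len I.1) (by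
        intro x hx
        obtain ⟨K, hK, rfl⟩ := List.mem_map.1 hx
        exact hmax K hK)
      simpa [k] using this
    refine max_le (h9.trans (by gcongr; exact le_max_left _ _)) ?_
    exact one_le_mul_of_one_le_of_one_le hk (le_max_right _ _)
  have h10 : max (len J.1) 1 ^ β ≤ (Real.exp β ^ k) ^ 2 * max (len I.1) 1 ^ β := by
    calc _ ≤ (k * max (len I.1) 1) ^ β := by gcongr
      _ = (k : ℝ) ^ β * max (len I.1) 1 ^ β := Real.mul_rpow (by positivity) (by positivity)
      _ ≤ _ := by gcongr
  have hQ2 : 1 ≤ Q ^ 2 := one_le_pow₀ hQ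
  have h11 : expWt f c s J ^ 2 ≤ Q ^ 2 * expWt f c s I ^ 2 := by
    rw [← mul_pow]
    exact pow_le_pow_left₀ (Real.exp_pos _).le h6 2
  set K2 := (Real.exp β ^ k) ^ 2
  set ℓ := max (len I.1) 1 ^ β
  have hℓ : 0 ≤ ℓ := by positivity
  have he : 0 ≤ expWt f c s I ^ 2 := by positivity
  calc _ ≤ Q ^ 2 * expWt f c s I ^ 2 + η * (K2 * ℓ) := by gcongr
    _ ≤ K2 * (Q ^ 2 * expWt f c s I ^ 2) + Q ^ 2 * (η * (K2 * ℓ)) :=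
      add_le_add (le_mul_of_one_le_left (by positivity) hK1)
        (le_mul_of_one_le_left (by positivity) hQ2)
    _ = _ := by ring

lemma tame_energyWt (hf : WeightAssumption f c Cf) (hs₀ : IsThreshold m f c Cf s₀) (hs : s₀ ≤ s)
    (hη : 0 ≤ η) (hβ : 0 ≤ β) :
    Tame (energyWt f c s β η) (sideWt (m := m) f c Cf s₀ s) (ENNReal.ofReal (Real.exp β)) where
  one_le J := (one_le_expWt hf ((hs₀.pos hf).le.trans hs) J).trans (expWt_le_energyWt hη J)
  bar _ := rfl
  one_le_b := one_le_sideWt hf (hs₀.pos hf).le hs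
  tame _ _ hmom hw := energyWt_le_dmon hf (hs₀.pos hf).le hs hη hβ hw hmom
  l2_le := l2_sideWt_le hs₀ (expWt_le_energyWt hη)

end weights

/-! ### The quadratic Hamiltonian along the flow -/

section energy

variable {a : Idx m → ℝ} {b : Idx m → ℝ≥0∞} {κ : ℝ} {χ F : Ser m} {d : ℕ} {X M R : ℝ}

/-- The series `∑ Lⁿ F / (n + 1)!`, the mean of `F` along the flow. -/
def lieMean (χ F : Ser m) : Ser m := fun w => ∑' n : ℕ, (lie χ)^[n] F w / (n + 1).factorial

lemma norm_div_succ_factorial_le (z : ℂ) (n : ℕ) :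
    ‖z / ((n + 1).factorial : ℂ)‖ ≤ ‖z / (n.factorial : ℂ)‖ := by
  rw [norm_div, norm_div, Complex.norm_natCast, Complex.norm_natCast]
  have h1 : ((n.factorial : ℕ) : ℝ) ≤ (n + 1).factorial := by
    exact_mod_cast Nat.factorial_le n.le_succ
  gcongr

lemma Gen.ev_lieMean (hG : Gen χ d X M) (ha : Tame a b (ENNReal.ofReal κ)) (hκ : 1 ≤ κ)
    (hR : 512 * M * κ ^ 2 * R ≤ 1) {B : ℝ} (hB : 0 ≤ B)
    (hF : ∀ w, ‖F w‖ ≤ B * M ^ w.length) {x : L2 m} (hx : ‖x‖ ≤ R) :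
    ev (lieMean χ F) (emb a x) = ∑' n : ℕ, ev ((lie χ)^[n] F) (emb a x) / (n + 1).factorial := by
  have h := hG.summable_iterate ha hκ hR hB hF hx
  have h' : Summable fun y : ℕ × Word m =>
      (lie χ)^[y.1] F y.2 / ((y.1 + 1).factorial : ℂ) * mon (emb a x) y.2 := by
    refine h.norm.of_norm_bounded fun y => ?_
    rw [norm_mul, norm_mul]
    exact mul_le_mul_of_nonneg_right (norm_div_succ_factorial_le _ _) (norm_nonneg _)
  exact (ev_tsum (G := fun n w => (lie χ)^[n] F w / ((n + 1).factorial : ℂ)) h').trans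
    (tsum_congr fun n => ev_div ((lie χ)^[n] F) (n + 1).factorial (emb a x))

lemma Gen.norm (hG : Gen χ d X M) : Gen (fun w => (‖χ w‖ : ℂ)) d X M where
  X_nonneg := hG.X_nonneg
  one_le_M := hG.one_le_M
  supp w hw := hG.supp w (by simpa using hw)
  degree w hw := hG.degree w (by simpa using hw)
  bound w := by simpa using hG.bound w
  small := hG.small
  small' := hG.small'

lemma enorm_hamCoeff_norm (χ : Ser m) (J : Idx m) (w : Word m) :
    ‖hamCoeff (fun w => (‖χ w‖ : ℂ)) J w‖ₑ = pcoef (fun w => ‖χ w‖ₑ) (bar J) w := by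
  rw [hamCoeff_eq, enorm_mul, pcoef, pcoef, splitSum, splitSum, ← Complex.ofReal_sum]
  have h1 : ‖-(sgn J * Complex.I)‖ₑ = 1 := by
    rw [← ofReal_norm, norm_neg, norm_mul, norm_sgn, Complex.norm_I, one_mul, ENNReal.ofReal_one]
  rw [h1, one_mul, ← ofReal_norm, Complex.norm_real, Real.norm_eq_abs,
    abs_of_nonneg (Finset.sum_nonneg fun _ _ => norm_nonneg _),
    ENNReal.ofReal_sum_of_nonneg fun _ _ => norm_nonneg _]
  exact Finset.sum_congr rfl fun _ _ => ofReal_norm _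

variable {ω : (Fin m → ℤ) → ℝ} {C : ℝ}

/-- The derivative of `H₀` along the Hamiltonian vector field of `χ`. -/
lemma Gen.hasSum_lieH0 (hG : Gen χ d X M) (ha : Tame a b (ENNReal.ofReal κ)) (hκ : 1 ≤ κ)
    (hR : 512 * M * κ ^ 2 * R ≤ 1) (hω : ∀ J : Idx m, |ω J.1| ≤ C * a J ^ 2)
    {x : L2 m} (hx : ‖x‖ ≤ R) :
    HasSum (fun J : Idx m => (ω J.1 : ℂ) * (ev (hamCoeff χ J) (emb a x) * emb a x (bar J)))
      (ev (lieH0 ω χ) (emb a x)) := by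
  set u := emb a x
  set k : Seq m := fun J => (((J.2 : ℤ) : ℝ) * ω J.1 : ℝ) * u J
  have hyR : nrm a (fun J => ‖u J‖ₑ) ≤ ENNReal.ofReal R := by
    rw [nrm_emb ha.one_le]
    exact enorm_le_ofReal hx
  -- The unbounded factor `|ω| ≤ C a²` is shared: one `a` goes to `u` and the other to the field of
  -- the series of absolute values, and Cauchy–Schwarz applies.
  have hfin : ∑' w, ‖χ w‖ₑ * dmon (fun J => ‖u J‖ₑ) (fun J => ‖k J‖ₑ) w ≠ ∞ := by
    rw [← tsum_mul_pcoef, ← tsum_comp_bar]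
    have hV := hG.norm.vbddOn ha hκ hR _ hyR
    refine ne_top_of_le_ne_top (ENNReal.mul_ne_top (ENNReal.ofReal_ne_top (r := C))
      (ENNReal.mul_ne_top (ne_top_of_le_ne_top ENNReal.ofReal_ne_top hyR)
        (ne_top_of_le_ne_top ENNReal.ofReal_ne_top hV))) (?_ : _ ≤ ENNReal.ofReal C *
          (nrm a (fun J => ‖u J‖ₑ) * nrm a _))
    calc _ ≤ ∑' J, ENNReal.ofReal C * ((ENNReal.ofReal (a J) * ‖u (bar J)‖ₑ) *
          (ENNReal.ofReal (a J) * maj (hamCoeff (fun w => (‖χ w‖ : ℂ)) J) (fun J => ‖u J‖ₑ))) := by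
          refine ENNReal.tsum_le_tsum fun J => ?_
          have h1 : ‖k (bar J)‖ₑ ≤ ENNReal.ofReal (C * a J ^ 2) * ‖u (bar J)‖ₑ := by
            rw [enorm_mul]
            gcongr
            refine enorm_le_ofReal ?_
            rw [Complex.norm_real, Real.norm_eq_abs, abs_mul]
            have h2 : |(((bar J).2 : ℤ) : ℝ)| = 1 := by
              rcases Int.units_eq_one_or (bar J).2 with h | h <;> simp [h]
            rw [h2, one_mul]
            exact hω J
          have h0 : 0 ≤ a J := by linarith [ha.one_le J]
          have hC : 0 ≤ C := by
            have := (abs_nonneg _).trans (hω J)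
            have h1 := ha.one_le J
            exact nonneg_of_mul_nonneg_left this (by positivity)
          simp only [maj, enorm_hamCoeff_norm]
          calc _ ≤ (ENNReal.ofReal (C * a J ^ 2) * ‖u (bar J)‖ₑ) * _ := mul_le_mul' h1 le_rfl
            _ = _ := by
              rw [ENNReal.ofReal_mul hC, pow_two, ENNReal.ofReal_mul h0]
              ring
      _ ≤ ENNReal.ofReal C * (l2 (fun J => ENNReal.ofReal (a J) * ‖u (bar J)‖ₑ) * _) := by
          rw [ENNReal.tsum_mul_left]
          gcongr
          exact tsum_mul_le_l2 _ _
      _ = _ := by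
          congr 2
          rw [nrm, l2, l2, ← tsum_comp_bar]
          simp only [bar_bar, ha.bar]
  have h := (hasSum_dev hfin).mul_left Complex.I
  have hev : Complex.I * dev χ u k = ev (lieH0 ω χ) u := by
    rw [dev, ev, ← tsum_mul_left]
    refine tsum_congr fun w => ?_
    have : dmon u k w = ((wdiv ω w : ℝ) : ℂ) * mon u w := by
      have := dmon_eigen u (fun J : Idx m => ((((J.2 : ℤ) : ℝ) * ω J.1 : ℝ) : ℂ)) w
      rw [show k = fun J => ((((J.2 : ℤ) : ℝ) * ω J.1 : ℝ) : ℂ) * u J from rfl, this, wdiv]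
      congr 1
      rw [← Complex.ofRealHom_eq_coe, map_list_sum, List.map_map]
      rfl
    rw [this, lieH0]
    ring
  rw [← hev]
  have h' := (Equiv.hasSum_iff (Function.Involutive.toPerm (bar (m := m)) bar_bar)).2 h
  refine h'.of_eq fun J => ?_
  change Complex.I * (k (bar J) * ev (pcoef χ (bar J)) u) = _
  rw [ev_hamCoeff]
  simp only [k, bar, sgn]
  push_cast
  ring

open Set in
/-- The change of `H₀` under the transformation generated by `χ`. -/
lemma Gen.H0_lieMap (hG : Gen χ d X M) (ha : Tame a b (ENNReal.ofReal κ)) (hκ : 1 ≤ κ)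
    (hR0 : 0 < R) (hR : 512 * M * κ ^ 2 * R ≤ 1) (hC : 0 ≤ C)
    (hω : ∀ J : Idx m, |ω J.1| ≤ C * a J ^ 2) {B : ℝ} (hB : 0 ≤ B)
    (hW : ∀ w, ‖lieH0 ω χ w‖ ≤ B * M ^ w.length) {x : L2 m} (hx : ‖x‖ < R / 8) :
    H0 ω (lieMap χ (emb a x)) = H0 ω (emb a x) + ev (lieMean χ (lieH0 ω χ)) (emb a x) := by
  obtain ⟨φ, h0, h1, h2⟩ := hG.exists_flow_line ha hκ hR0 hR hx
  have hn : ∀ t, ‖φ t‖ ≤ R / 2 := fun t => (h1 t).trans (by linarith)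
  have hnR : ∀ t, ‖φ t‖ ≤ R := fun t => (hn t).trans (by linarith)
  have hl : ∀ J : Idx m, ‖(ω J.1 : ℂ) / 2‖ ≤ C * (a J * a (bar J)) := by
    intro J
    rw [ha.bar, ← pow_two, norm_div, Complex.norm_real, Real.norm_eq_abs]
    have := hω J
    have h3 := abs_nonneg (ω J.1)
    simp only [Complex.norm_ofNat]
    linarith
  set Q := pairForm a ha.one_le (fun J : Idx m => (ω J.1 : ℂ) / 2) C hC hl
  have hQ : ∀ y, H0 ω (emb a y) = Q y y := by
    intro y
    rw [pairForm_apply, tsum_idx (summable_mul_bar ha.one_le hC hl y y), H0]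
    refine tsum_congr fun j => ?_
    simp only [bar, neg_neg]
    ring
  have hQ' : ∀ t ∈ Icc (0 : ℝ) 1, HasDerivWithinAt (fun t => Q (φ t) (φ t))
      (ev (lieH0 ω χ) (emb a (φ t))) (Icc 0 1) t := by
    intro t ht
    have h3 := (Q.bilinearRestrictScalars ℝ).hasDerivWithinAt_of_bilinear (h2 t ht) (h2 t ht)
    refine h3.congr_deriv ?_
    change Q (φ t) _ + Q _ (φ t) = _
    have h4 := hG.hasSum_lieH0 ha hκ hR hω (hnR t)
    have h5 : ∀ x y, Q x y = Q y x := fun x y => by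
      rw [pairForm_apply, pairForm_apply,
        ← tsum_comp_bar fun J : Idx m => (ω J.1 : ℂ) / 2 * (emb a x J * emb a y (bar J))]
      refine tsum_congr fun J => ?_
      simp only [bar_bar]
      simp only [bar]
      ring
    rw [h5 (φ t), ← two_mul, pairForm_apply, ← tsum_mul_left, ← h4.tsum_eq]
    refine tsum_congr fun J => ?_
    rw [emb_vmap ha.one_le (hG.vbddOn ha hκ hR) ENNReal.ofReal_ne_top (hnR t)]
    ring
  have hb := hG.bddOn_iterate ha hκ hR hB hW
  -- `H₀` is treated as a bounded quadratic form of the energy space. Only from its first derivative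
  -- on is the chain given by series, which shifts the factorials of the Lie mean by one.
  set g : ℕ → ℝ → ℂ := fun n t => match n with
    | 0 => Q (φ t) (φ t)
    | n + 1 => ev ((lie χ)^[n] (lieH0 ω χ)) (emb a (φ t))
  have hsum := hasSum_of_deriv_chain (g := g) (C := ‖Q‖ * R * R + 8 * B)
    (fun n t ht => by
      cases n with
      | zero => exact hQ' t ht
      | succ n =>
        have := hG.hasDerivWithinAt_ev ha hκ hR0 hR ENNReal.ofReal_ne_top (hb n) (hn t) (h2 t ht)
        rwa [← Function.iterate_succ_apply' (lie χ)] at this)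
    (fun n t ht => by
      cases n with
      | zero =>
        have h3 := Q.le_opNorm₂ (φ t) (φ t)
        have h4 : ‖Q‖ * ‖φ t‖ * ‖φ t‖ ≤ ‖Q‖ * R * R := by
          have := hnR t
          gcongr
        simp only [Nat.factorial_zero, Nat.cast_one, pow_zero, one_mul, g]
        linarith
      | succ n =>
        have h3 : ‖ev ((lie χ)^[n] (lieH0 ω χ)) (emb a (φ t))‖ₑ ≤ _ :=
          (enorm_ev_le fun J => le_rfl).trans (hb n _ (by
            rw [nrm_emb ha.one_le]
            exact enorm_le_ofReal (hnR t)))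
        rw [← ofReal_norm, ENNReal.ofReal_le_ofReal_iff (by positivity)] at h3
        refine h3.trans ?_
        have h4 : ((n.factorial : ℕ) : ℝ) ≤ (n + 1).factorial := by
          exact_mod_cast Nat.factorial_le n.le_succ
        have h5 : (1 / 2 : ℝ) ^ n * (4 * B) ≤
            (1 / 2) ^ (n + 1) * (‖Q‖ * R * R + 8 * B) := by
          have h6 : 0 ≤ (1 / 2 : ℝ) ^ n * (‖Q‖ * R * R) := by positivity
          rw [pow_succ]
          linarith
        gcongr)
  have hv := hG.vmap_lieSer_eq ha hκ hR0 hR (fun t _ => hn t) h2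
  rw [h0] at hv
  rw [← hG.emb_vmap_lieSer ha hκ hR (by linarith), hv, hQ, hQ,
    hG.ev_lieMean ha hκ hR hB hW (by linarith)]
  have h3 := hsum.tsum_eq
  rw [hsum.summable.tsum_eq_zero_add] at h3
  simp only [g, Nat.factorial_zero, Nat.cast_one, div_one, h0] at h3
  exact h3.symm

end energy

/-! ### Balls of the weighted spaces and finite energy -/

section balls

variable {f : ℝ → ℝ} {c Cf s₀ s : ℝ}

lemma wNorm_eq (f : ℝ → ℝ) (c s : ℝ) (u : Seq m) :
    wNorm f c s u = nrm (expWt f c s) (fun J => ‖u J‖ₑ) := by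
  rw [wNorm, nrm, l2]
  congr 1
  refine tsum_congr fun J => ?_
  rw [mul_pow, ← ofReal_norm, ← ENNReal.ofReal_pow (norm_nonneg _), expWt,
    ← ENNReal.ofReal_pow (Real.exp_pos _).le, ← ENNReal.ofReal_mul (by positivity),
    ← Real.exp_nat_mul, mul_comm]
  congr 3
  push_cast
  ring

lemma fromL2_eq (f : ℝ → ℝ) (c s : ℝ) (x : L2 m) : fromL2 f c s x = emb (expWt f c s) x := by
  funext J
  rw [fromL2, emb, expWt, ← Real.exp_neg]

variable {r : ℝ}

lemma emb_mem_wBall_iff (ha : ∀ J : Idx m, 1 ≤ expWt f c s J) {x : L2 m} :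
    emb (expWt f c s) x ∈ wBall f c s r ↔ ‖x‖ < r := by
  rw [wBall, Set.mem_ofPred_eq, wNorm_eq, nrm_emb ha, ← ofReal_norm, ENNReal.ofReal_lt_ofReal_iff']
  exact ⟨fun h => h.1, fun h => ⟨h, (norm_nonneg x).trans_lt h⟩⟩

lemma exists_emb_eq {a : Idx m → ℝ} (ha : ∀ J, 1 ≤ a J) {u : Seq m}
    (h : nrm a (fun J => ‖u J‖ₑ) < ENNReal.ofReal r) : ∃ x : L2 m, ‖x‖ < r ∧ u = emb a x := by
  have h1 : nrm a (fun J => ‖u J‖ₑ) ≠ ∞ := h.ne_top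
  refine ⟨coord a u, ?_, (emb_coord ha h1).symm⟩
  rw [← enorm_coord ha h1, ← ofReal_norm, ENNReal.ofReal_lt_ofReal_iff'] at h
  exact h.1

lemma exists_of_mem_wBall (ha : ∀ J : Idx m, 1 ≤ expWt f c s J) {u : Seq m}
    (hu : u ∈ wBall f c s r) : ∃ x : L2 m, ‖x‖ < r ∧ u = emb (expWt f c s) x :=
  exists_emb_eq ha (by rwa [wBall, Set.mem_ofPred_eq, wNorm_eq] at hu)

lemma Gen.isCanonicalOn {χ : Ser m} {d : ℕ} {X M R κ : ℝ} (hG : Gen χ d X M)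
    (hf : WeightAssumption f c Cf) (hs₀ : IsThreshold m f c Cf s₀) (hs : s₀ ≤ s)
    (hκ : 1 ≤ κ) (hR0 : 0 < R) (hR : 512 * M * κ ^ 2 * R ≤ 1) (hr : r ≤ R / 8) :
    IsCanonicalOn f c s r (lieMap χ) := by
  have ha := tame_expWt hf hs₀ hs hκ
  have hx : ∀ x ∈ Metric.ball (0 : L2 m) r, ‖x‖ < R / 8 := fun x hx =>
    (mem_ball_zero_iff.1 hx).trans_le hr
  refine ⟨vmap (expWt f c s) (fun J => lieSer χ (coordSer J)), fun x hx' => ?_, fun x hx' => ?_,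
    fun x hx' v w => ?_⟩
  · exact (hG.differentiableAt ha hκ hR (by linarith [hx x hx'])).differentiableWithinAt
  · rw [fromL2_eq, fromL2_eq, hG.emb_vmap_lieSer ha hκ hR (by linarith [hx x hx'])]
  · simp only [fromL2_eq]
    have := hG.sympForm_fderiv ha hκ hR0 hR (hx x hx') v w
    rwa [sympForm_eq_symp, sympForm_eq_symp] at this

variable {ω : (Fin m → ℤ) → ℝ} {β : ℝ}

lemma abs_le_energyWt_sq {C η : ℝ} (hC : 0 ≤ C) (hω : ∀ j, |ω j| ≤ C * max (len j) 1 ^ β)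
    (hη : 0 < η) (J : Idx m) : |ω J.1| ≤ C / η * energyWt f c s β η J ^ 2 := by
  have h2 : η * max (len J.1) 1 ^ β ≤ energyWt f c s β η J ^ 2 := by
    rw [energyWt_sq hη.le]
    have := sq_nonneg (expWt f c s J)
    linarith
  rw [div_mul_eq_mul_div, le_div_iff₀ hη]
  nlinarith [hω J.1, mul_le_mul_of_nonneg_left h2 hC]

lemma finiteEnergy_emb {C η : ℝ} (hC : 0 ≤ C) (hω : ∀ j, |ω j| ≤ C * max (len j) 1 ^ β)
    (hη : 0 < η) (ha : ∀ J : Idx m, 1 ≤ energyWt f c s β η J) (x : L2 m) :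
    FiniteEnergy ω (emb (energyWt f c s β η) x) := by
  have h1 : Summable fun J => ‖x J‖ ^ 2 := by
    simpa using (lp.memℓp x).summable (by norm_num : 0 < (2 : ℝ≥0∞).toReal)
  refine Summable.of_nonneg_of_le (fun J => by positivity) (fun J => ?_) (h1.mul_left (C / η))
  have ha0 : 0 < energyWt f c s β η J := by linarith [ha J]
  have h3 := abs_le_energyWt_sq (f := f) (c := c) (s := s) hC hω hη J
  rw [emb, norm_mul, Complex.norm_real, Real.norm_eq_abs, abs_of_pos (inv_pos.2 ha0), mul_pow,
    inv_pow]
  calc _ ≤ C / η * energyWt f c s β η J ^ 2 * ((energyWt f c s β η J ^ 2)⁻¹ * ‖x J‖ ^ 2) := by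
        gcongr
    _ = _ := by field_simp

/-- A sequence of finite energy in a ball of `W_s` lies in the ball of a stronger norm. -/
lemma exists_energy_emb {C : ℝ} (hC : 0 ≤ C) (hω : ∀ j, max (len j) 1 ^ β ≤ C * (|ω j| + 1))
    (ha : ∀ J : Idx m, 1 ≤ expWt f c s J) {u : Seq m} (hu : u ∈ wBall f c s r)
    (hE : FiniteEnergy ω u) : ∃ η : ℝ, 0 < η ∧ ∃ x : L2 m, ‖x‖ < r ∧
      u = emb (energyWt f c s β η) x := by
  obtain ⟨x, hx, hux⟩ := exists_of_mem_wBall ha hu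
  have h1 : HasSum (fun J => expWt f c s J ^ 2 * ‖u J‖ ^ 2) (‖x‖ ^ 2) := by
    have h2 := lp.hasSum_norm (by norm_num : 0 < (2 : ℝ≥0∞).toReal) x
    simp only [ENNReal.toReal_ofNat, Real.rpow_ofNat] at h2
    refine h2.of_eq fun J => ?_
    have ha0 : 0 < expWt f c s J := by linarith [ha J]
    rw [hux, emb, norm_mul, Complex.norm_real, Real.norm_eq_abs, abs_of_pos (inv_pos.2 ha0),
      mul_pow, inv_pow]
    field_simp
  have h2 : Summable fun J : Idx m => max (len J.1) 1 ^ β * ‖u J‖ ^ 2 := by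
    refine Summable.of_nonneg_of_le (fun J => by positivity) (fun J => ?_)
      ((hE.add h1.summable).mul_left C)
    have h3 : ‖u J‖ ^ 2 ≤ expWt f c s J ^ 2 * ‖u J‖ ^ 2 :=
      le_mul_of_one_le_left (by positivity) (one_le_pow₀ (ha J))
    calc _ ≤ C * (|ω J.1| + 1) * ‖u J‖ ^ 2 := by gcongr; exact hω _
      _ = C * (|ω J.1| * ‖u J‖ ^ 2 + ‖u J‖ ^ 2) := by ring
      _ ≤ _ := by gcongr
  set E := ∑' J : Idx m, max (len J.1) 1 ^ β * ‖u J‖ ^ 2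
  have hE0 : 0 ≤ E := tsum_nonneg fun J => by positivity
  have hr : 0 < r := (norm_nonneg x).trans_lt hx
  have hgap : 0 < r ^ 2 - ‖x‖ ^ 2 := by nlinarith [norm_nonneg x]
  -- The energy uses up less than half of the gap between `‖x‖ ^ 2` and `r ^ 2`, so the radius `r`
  -- is kept. A small `η` costs nothing, since the tame constants do not involve it.
  set η := (r ^ 2 - ‖x‖ ^ 2) / (2 * (E + 1))
  have hη : 0 < η := by positivity
  refine ⟨η, hη, exists_emb_eq (fun J => (ha J).trans (expWt_le_energyWt hη.le J)) ?_⟩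
  have h3 : HasSum (fun J => energyWt f c s β η J ^ 2 * ‖u J‖ ^ 2) (‖x‖ ^ 2 + η * E) := by
    refine (h1.add (h2.hasSum.mul_left η)).of_eq fun J => ?_
    rw [energyWt_sq hη.le]
    ring
  have h4 : ‖x‖ ^ 2 + η * E < r ^ 2 := by
    have : η * E < r ^ 2 - ‖x‖ ^ 2 := by
      rw [div_mul_eq_mul_div, div_lt_iff₀ (by positivity)]
      nlinarith
    linarith
  have h5 : nrm (energyWt f c s β η) (fun J => ‖u J‖ₑ) ^ 2 = ENNReal.ofReal (‖x‖ ^ 2 + η * E) := by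
    rw [nrm, l2_sq, ← h3.tsum_eq, ENNReal.ofReal_tsum_of_nonneg (fun J => by positivity)
      h3.summable]
    refine tsum_congr fun J => ?_
    have h6 : 0 ≤ energyWt f c s β η J := Real.sqrt_nonneg _
    rw [mul_pow, ENNReal.ofReal_mul (by positivity), ENNReal.ofReal_pow h6,
      ENNReal.ofReal_pow (norm_nonneg _), ofReal_norm]
  have h6 : nrm (energyWt f c s β η) (fun J => ‖u J‖ₑ) ^ 2 < ENNReal.ofReal r ^ 2 := by
    rw [h5, ← ENNReal.ofReal_pow hr.le]
    exact (ENNReal.ofReal_lt_ofReal_iff (by positivity)).2 h4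
  exact (ENNReal.pow_right_strictMono two_ne_zero).lt_iff_lt.1 h6

end balls

/-! ### Translation between multi-indices and words -/

section conversion

/-- The series of a family of coefficients. -/
def toSer (P : Coeff m) : Ser m := fun w => P w.length w.get

/-- The coefficients of a series. -/
def ofSer (F : Ser m) : Coeff m := fun _ J => F (List.ofFn J)

lemma sigma_ofFn {k : ℕ} (J : Fin k → Idx m) :
    (⟨(List.ofFn J).length, (List.ofFn J).get⟩ : Σ k, Fin k → Idx m) = ⟨k, J⟩ :=
  List.equivSigmaTuple.right_inv (⟨k, J⟩ : Σ k, Fin k → Idx m)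

lemma pred_ofFn (Q : ∀ {k : ℕ}, (Fin k → Idx m) → Prop) {k : ℕ} (J : Fin k → Idx m) :
    Q (List.ofFn J).get ↔ Q J :=
  iff_of_eq (congrArg (fun x : Σ k, Fin k → Idx m => Q x.2) (sigma_ofFn J))

lemma toSer_ofSer (F : Ser m) : toSer (ofSer F) = F := by
  funext w
  simp only [toSer, ofSer]
  rw [List.ofFn_get]

lemma toSer_ofFn (P : Coeff m) {k : ℕ} (J : Fin k → Idx m) : toSer P (List.ofFn J) = P k J :=
  congrArg (fun x : Σ k, Fin k → Idx m => P x.1 x.2) (sigma_ofFn J)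

lemma term_equiv (P : Coeff m) (u : Seq m) (w : Word m) :
    term P u (List.equivSigmaTuple w) = toSer P w * mon u w := by
  change P w.length w.get * _ = _
  congr 1
  exact Fin.prod_univ_fun_getElem w u

lemma eval_eq (P : Coeff m) (u : Seq m) : eval P u = ev (toSer P) u := by
  rw [eval, ev, ← List.equivSigmaTuple.tsum_eq]
  exact tsum_congr fun w => term_equiv P u w

lemma converges_iff (P : Coeff m) (u : Seq m) :
    Converges P u ↔ Summable fun w => toSer P w * mon u w := by
  rw [Converges, ← List.equivSigmaTuple.summable_iff]
  exact summable_congr fun w => term_equiv P u w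

lemma mom_ofFn {k : ℕ} (J : Fin k → Idx m) : mom (List.ofFn J) = momentum J := by
  rw [mom, List.map_ofFn, List.sum_ofFn]
  rfl

lemma mom_eq_momentum (w : Word m) : mom w = momentum w.get := by
  rw [← mom_ofFn, List.ofFn_get]

lemma wdiv_eq_divisor (ω : (Fin m → ℤ) → ℝ) (w : Word m) : wdiv ω w = divisor ω w.get :=
  (Fin.sum_univ_fun_getElem w fun J => ((J.2 : ℤ) : ℝ) * ω J.1).symm

lemma highs_eq_card (N : ℕ) (w : Word m) : highs N w =
    (Finset.univ.filter fun l => (N : ℝ) < len (w.get l).1).card := by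
  induction w with
  | nil => simp [highs]
  | cons J w ih =>
    rw [highs_cons, ih, add_comm]
    exact (Fin.card_filter_univ_succ (n := w.length)
      fun l => (N : ℝ) < len ((J :: w).get l).1).symm ▸ by
        simp only [List.get_eq_getElem, Fin.val_zero, List.getElem_cons_zero,
          Fin.val_succ, List.getElem_cons_succ]
        split_ifs <;> omega

lemma map_bar_eq_ofFn (w : Word m) : w.map bar = List.ofFn fun l => bar (w.get l) := by
  conv_lhs => rw [← List.ofFn_get w, List.map_ofFn]
  rfl

lemma pred_map_bar (Q : ∀ {k : ℕ}, (Fin k → Idx m) → Prop) (w : Word m) :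
    Q (w.map bar).get ↔ Q (fun l => bar (w.get l)) := by
  rw [map_bar_eq_ofFn]
  exact pred_ofFn Q _

lemma divisor_bar (ω : (Fin m → ℤ) → ℝ) {k : ℕ} (J : Fin k → Idx m) :
    divisor ω (fun l => bar (J l)) = -divisor ω J := by
  simp [divisor, bar, Finset.sum_neg_distrib]

lemma isR0_bar (ω : (Fin m → ℤ) → ℝ) (N : ℕ) (w : Word m) :
    IsR0 ω N (w.map bar).get ↔ IsR0 ω N w.get := by
  rw [pred_map_bar (fun J => IsR0 ω N J), IsR0, IsR0, divisor_bar, neg_eq_zero]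
  rfl

variable {ω : (Fin m → ℤ) → ℝ} {A : Type*} {blk : Idx m → A} {C₀ C₁ C₂ β δ γ τ p : ℝ}

/-- An index and its conjugate have the same frequency, so the separation of blocks leaves no room
between them. This makes R2 invariant under conjugation and the normal form real. -/
lemma FrequencyAssumption.blk_bar (hω : FrequencyAssumption ω blk C₀ C₁ C₂ β δ γ τ p) {J : Idx m}
    (hJ : 0 < len J.1) : blk (bar J) = blk J := by
  by_contra h
  have h1 := hω.separation _ _ h
  have h2 : 0 < len J.1 ^ δ := Real.rpow_pos_of_pos hJ δ
  have h3 := hω.C₂_pos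
  simp only [bar, sub_self, abs_zero] at h1
  nlinarith

lemma FrequencyAssumption.isR2_bar_of (hω : FrequencyAssumption ω blk C₀ C₁ C₂ β δ γ τ p) {N : ℕ}
    {k : ℕ} {J : Fin k → Idx m} (h : IsR2 blk N J) : IsR2 blk N fun l => bar (J l) := by
  obtain ⟨a, b, hab, hN, hs, hb⟩ := h
  have ha : 0 < len (J a).1 := (Nat.cast_nonneg N).trans_lt ((hN a).2 (Or.inl rfl))
  have hb' : 0 < len (J b).1 := (Nat.cast_nonneg N).trans_lt ((hN b).2 (Or.inr rfl))
  refine ⟨a, b, hab, hN, ?_, ?_⟩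
  · simp [bar, hs]
  · rw [hω.blk_bar ha, hω.blk_bar hb', hb]

lemma FrequencyAssumption.isR2_bar (hω : FrequencyAssumption ω blk C₀ C₁ C₂ β δ γ τ p) (N : ℕ)
    (w : Word m) : IsR2 blk N (w.map bar).get ↔ IsR2 blk N w.get := by
  rw [pred_map_bar (fun J => IsR2 blk N J)]
  refine ⟨fun h => ?_, hω.isR2_bar_of⟩
  have := hω.isR2_bar_of h
  simpa only [bar_bar] using this

lemma IsR0.highs_eq_zero {N : ℕ} {w : Word m} (h : IsR0 ω N w.get) : highs N w = 0 := by
  rw [highs_eq_card, Finset.card_eq_zero, Finset.filter_eq_empty_iff]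
  exact fun l _ => (h.1 l).not_gt

lemma IsR2.highs_eq_two {N : ℕ} {w : Word m} (h : IsR2 blk N w.get) : highs N w = 2 := by
  classical
  obtain ⟨a, b, hab, hN, -⟩ := h
  rw [highs_eq_card, ← Finset.card_pair hab]
  congr 1
  ext l
  rw [Finset.mem_filter_univ, hN]
  simp

lemma highs_map_bar (N : ℕ) (w : Word m) : highs N (w.map bar) = highs N w := by
  rw [highs, List.countP_map]
  rfl

lemma InP.suppOn {P : Coeff m} {d : ℕ∞} (hP : InP P 3 d) : SuppOn 3 0 (toSer P) := fun w hw =>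
  ⟨(hP.degree _ _ hw).1, (mom_eq_momentum w).trans (hP.moment _ _ hw)⟩

lemma InP.star'_toSer {P : Coeff m} {d₁ : ℕ} {d : ℕ∞} (hP : InP P d₁ d) :
    star' (toSer P) = toSer P := by
  funext w
  rw [star', map_bar_eq_ofFn, toSer_ofFn, ← hP.reality, Complex.conj_conj]
  rfl

lemma inP_ofSer {F : Ser m} {d : ℕ∞} {B θ : ℝ} (hs : SuppOn 3 0 F) (hr : star' F = F)
    (hd : ∀ w, F w ≠ 0 → (w.length : ℕ∞) ≤ d) (hB : 0 ≤ B) (hθ : 0 ≤ θ)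
    (hF : ∀ w, ‖F w‖ ≤ B * θ ^ w.length) : InP (ofSer F) 3 d where
  degree k J h := ⟨by simpa using (hs _ h).1, by simpa using hd _ h⟩
  moment k J h := (mom_ofFn J).symm.trans (hs _ h).2
  reality k J := by
    have := congrFun hr (List.ofFn fun l => bar (J l))
    rw [ofSer, ofSer, ← this, star', List.map_ofFn]
    simp [Function.comp_def, bar_bar]
  bounded := by
    -- In positive degree the prefactor is absorbed by `B ≤ (B + 1) ^ k`; the coefficients of degree
    -- below 3 vanish.
    refine ⟨(B + 1) * θ, fun k J => ?_⟩
    rw [ofSer]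
    by_cases h : F (List.ofFn J) = 0
    · rw [h, norm_zero]
      positivity
    · have h1 := (hs _ h).1
      have h2 := hF (List.ofFn J)
      simp only [List.length_ofFn] at h1 h2
      refine h2.trans ?_
      rw [mul_pow]
      have h3 : B ≤ (B + 1) ^ k := by
        calc B ≤ B + 1 := by linarith
          _ ≤ _ := le_self_pow₀ (by linarith) (by omega)
      gcongr

end conversion

/-! ### The transformed Hamiltonian -/

section transformed

variable {ω : (Fin m → ℤ) → ℝ} {χ F P : Ser m} {d : ℕ} {X M : ℝ}

lemma SuppOn.lieSer (hχ : SuppOn 3 0 χ) (hF : SuppOn 3 0 F) : SuppOn 3 0 (lieSer χ F) := by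
  intro w hw
  obtain ⟨n, hn⟩ : ∃ n : ℕ, (NormalForm.lie χ)^[n] F w ≠ 0 := by
    by_contra! h
    exact hw (by simp [NormalForm.lieSer, h])
  exact hχ.iterate_lie hF n w hn

lemma SuppOn.lieMean (hχ : SuppOn 3 0 χ) (hF : SuppOn 3 0 F) : SuppOn 3 0 (lieMean χ F) := by
  intro w hw
  obtain ⟨n, hn⟩ : ∃ n : ℕ, (NormalForm.lie χ)^[n] F w ≠ 0 := by
    by_contra! h
    exact hw (by simp [NormalForm.lieMean, h])
  exact hχ.iterate_lie hF n w hn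

lemma star'_lieMean (χ F : Ser m) : star' (lieMean χ F) = lieMean (star' χ) (star' F) := by
  funext w
  rw [star', lieMean, lieMean, Complex.conj_tsum]
  refine tsum_congr fun n => ?_
  rw [map_div₀, ← star'_iterate_lie, Complex.conj_natCast, star']

lemma Gen.summable_coeff (hG : Gen χ d X M) {B : ℝ} (hB : 0 ≤ B)
    (hF : ∀ w, ‖F w‖ ≤ B * M ^ w.length) (w : Word m) :
    Summable fun n : ℕ => (lie χ)^[n] F w / (n.factorial : ℂ) := by
  refine Summable.of_norm_bounded (summable_geometric_two.mul_right (2 * B * (2 * M) ^ w.length))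
    fun n => ?_
  rw [norm_div, Complex.norm_natCast]
  exact hG.norm_iterate_le hB hF n w

lemma Gen.summable_coeff' (hG : Gen χ d X M) {B : ℝ} (hB : 0 ≤ B)
    (hF : ∀ w, ‖F w‖ ≤ B * M ^ w.length) (w : Word m) :
    Summable fun n : ℕ => (lie χ)^[n] F w / ((n + 1).factorial : ℂ) :=
  (hG.summable_coeff hB hF w).norm.of_norm_bounded fun _ => norm_div_succ_factorial_le _ _

lemma Gen.norm_lieMean_le (hG : Gen χ d X M) {B : ℝ} (hB : 0 ≤ B)
    (hF : ∀ w, ‖F w‖ ≤ B * M ^ w.length) (w : Word m) :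
    ‖lieMean χ F w‖ ≤ 4 * B * (2 * M) ^ w.length := by
  have := tsum_of_norm_bounded (f := fun n : ℕ => (lie χ)^[n] F w / ((n + 1).factorial : ℂ))
    (hasSum_geometric_two.mul_right (2 * B * (2 * M) ^ w.length)) fun n => by
      refine (norm_div_succ_factorial_le _ _).trans ?_
      rw [norm_div, Complex.norm_natCast]
      exact hG.norm_iterate_le hB hF n w
  refine this.trans_eq ?_
  ring

/-- The transformed Hamiltonian without its quadratic part. -/
def transformed (ω : (Fin m → ℤ) → ℝ) (P χ : Ser m) : Ser m := fun w =>
  lieSer χ P w + lieMean χ (lieH0 ω χ) w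

lemma SuppOn.transformed (hP : SuppOn 3 0 P) (hχ : SuppOn 3 0 χ) :
    SuppOn 3 0 (transformed ω P χ) := by
  intro w hw
  by_cases h : NormalForm.lieSer χ P w = 0
  · refine hχ.lieMean (hχ.lieH0 (ω := ω)) w fun h' => hw ?_
    rw [NormalForm.transformed, h, h', add_zero]
  · exact hχ.lieSer hP w h

lemma star'_transformed (hP : star' P = P) (hχ : star' χ = χ) :
    star' (transformed ω P χ) = transformed ω P χ := by
  have h1 := star'_lieSer χ P
  have h2 := star'_lieMean χ (lieH0 ω χ)
  rw [hχ, hP] at h1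
  rw [hχ, star'_lieH0 hχ] at h2
  funext w
  have h3 := congrFun h1 w
  have h4 := congrFun h2 w
  simp only [star'] at h3 h4
  simp [star', transformed, h3, h4]

/-- The terms of order zero, `P` and `lieH0 ω χ`, are split off from the two Lie sums. In this form
a solved homological equation says that the coefficient vanishes. -/
lemma Gen.transformed_eq (hG : Gen χ d X M) {B : ℝ} (hB : 0 ≤ B)
    (hP : ∀ w, ‖P w‖ ≤ B * M ^ w.length) (hW : ∀ w, ‖lieH0 ω χ w‖ ≤ B * M ^ w.length)
    (w : Word m) : transformed ω P χ w = known ω P χ w + lieH0 ω χ w := by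
  have h1 := hG.summable_coeff hB hP w
  have h2 := hG.summable_coeff' hB hW w
  rw [transformed, lieSer, lieMean, h1.tsum_eq_zero_add, h2.tsum_eq_zero_add, known,
    Summable.tsum_add ((summable_nat_add_iff 1).2 h1) ((summable_nat_add_iff 1).2 h2)]
  simp only [Function.iterate_zero, id, Nat.factorial_zero, Nat.cast_one, div_one, zero_add,
    Nat.factorial_one]
  ring

lemma Gen.norm_transformed_le (hG : Gen χ d X M) {B : ℝ} (hB : 0 ≤ B)
    (hP : ∀ w, ‖P w‖ ≤ B * M ^ w.length) (hW : ∀ w, ‖lieH0 ω χ w‖ ≤ B * M ^ w.length)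
    (w : Word m) : ‖transformed ω P χ w‖ ≤ 8 * B * (2 * M) ^ w.length := by
  refine (norm_add_le _ _).trans ((add_le_add (hG.norm_lieSer_le hB hP w)
    (hG.norm_lieMean_le hB hW w)).trans_eq ?_)
  ring

end transformed

/-! ### Choice of the generator -/

section solve

variable {ω : (Fin m → ℤ) → ℝ} {A : Type*} {blk : Idx m → A} {C₀ C₁ C₂ β δ γ τ p : ℝ}

/-- A generator that removes the nonresonant monomials up to degree `d`. -/
lemma FrequencyAssumption.exists_gen (hω : FrequencyAssumption ω blk C₀ C₁ C₂ β δ γ τ p) {N d : ℕ}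
    {D : ℝ} (hd : 1 ≤ d) (hD : 1 ≤ D)
    (hdiv : ∀ (k : ℕ) (J : Fin k → Idx m), k ≤ d → momentum J = 0 →
      (Finset.univ.filter fun l => (N : ℝ) < len (J l).1).card ≤ 2 →
      ¬IsR0 ω N J → ¬IsR2 blk N J → 1 ≤ D * |divisor ω J|)
    {P : Ser m} {a : ℝ} (ha : 1 ≤ a) (hP : SuppOn 3 0 P) (hPr : star' P = P)
    (hPb : ∀ w, ‖P w‖ ≤ a ^ w.length) :
    ∃ (χ : Ser m) (X B : ℝ), Gen χ d X (64 * a ^ 3 * D * d ^ 3) ∧ star' χ = χ ∧ 0 ≤ B ∧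
      B * (64 * a ^ 3 * D * d ^ 3) ^ 2 ≤ 1 / 32 ∧
      (∀ w, ‖P w‖ ≤ B * (64 * a ^ 3 * D * d ^ 3) ^ w.length) ∧
      (∀ w, ‖lieH0 ω χ w‖ ≤ B * (64 * a ^ 3 * D * d ^ 3) ^ w.length) ∧
      ∀ w, transformed ω P χ w ≠ 0 → w.length ≤ d → IsR0 ω N w.get ∨ IsR2 blk N w.get ∨
        3 ≤ highs N w := by
  set M : ℝ := 64 * a ^ 3 * D * d ^ 3 with hM
  have hd' : (1 : ℝ) ≤ d := by exact_mod_cast hd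
  have hd3 : (1 : ℝ) ≤ (d : ℝ) ^ 3 := one_le_pow₀ hd'
  have ha3 : 1 ≤ a ^ 3 := one_le_pow₀ ha
  have haM : a ^ 3 ≤ M := by
    rw [hM]
    have h1 : 1 ≤ D * (d : ℝ) ^ 3 := one_le_mul_of_one_le_of_one_le hD hd3
    nlinarith
  have hM1 : 1 ≤ M := ha3.trans haM
  have haM' : a ≤ M := (le_self_pow₀ ha (by norm_num)).trans haM
  -- `D B M ^ 2 = 1 / (32 d ^ 3)` provides the smallness of the generator. Together with the value
  -- of `M` this gives `(B / 2) M ^ 3 = a ^ 3`, so that `P`, which starts in degree 3, satisfies the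
  -- bound with `B / 2`.
  set B : ℝ := 1 / (32 * D * d ^ 3 * M ^ 2) with hB
  have hB0 : 0 ≤ B := by positivity
  have hBM : B * M ^ 2 = 1 / (32 * D * d ^ 3) := by rw [hB]; field_simp
  have hX : D * B * M ^ 2 = 1 / (32 * d ^ 3) := by
    rw [mul_assoc, hBM]
    field_simp
  have hPb' : ∀ w, ‖P w‖ ≤ B / 2 * M ^ w.length := by
    intro w
    by_cases hw : P w = 0
    · rw [hw, norm_zero]
      positivity
    · obtain ⟨k, hk⟩ := Nat.exists_eq_add_of_le (hP w hw).1
      refine (hPb w).trans ?_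
      rw [hk, pow_add, pow_add]
      have h1 : B / 2 * M ^ 3 = a ^ 3 := by
        calc B / 2 * M ^ 3 = B * M ^ 2 * M / 2 := by ring
          _ = _ := by
            rw [hBM, hM]
            field_simp
            norm_num
      rw [← mul_assoc, h1]
      gcongr
  obtain ⟨χ, h1, h2, h3, h4, h5, h6, h7⟩ := exists_homological (ω := ω) (P := P)
    -- Words with three or more high modes have no divisor bound here; they are not removed but go
    -- into the remainder.
    (nr := fun w => highs N w ≤ 2 ∧ ¬IsR0 ω N w.get ∧ ¬IsR2 blk N w.get) (d := d) (D := D)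
    (M := M) (B := B) (by linarith) (by linarith) hB0
    (fun w => by rw [highs_map_bar, isR0_bar, hω.isR2_bar])
    (fun w hw hm hl => by
      rw [wdiv_eq_divisor]
      exact hdiv _ _ hl ((mom_eq_momentum w).symm.trans hm) ((highs_eq_card N w).symm.trans_le hw.1)
        hw.2.1 hw.2.2)
    (by
      rw [hX]
      have h1 : 2 * (d : ℝ) ^ 2 * (1 / (32 * d ^ 3)) * (d + 1) = (d + 1) / (16 * d) := by
        field_simp
        norm_num
      rw [h1, div_le_div_iff₀ (by positivity) (by norm_num)]
      linarith) hP hPr hPb' d le_rfl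
  have hG : Gen χ d (D * B) M := ⟨by positivity, hM1, h1, h3, h4, by
      rw [hX]
      have h1 : 2 * (d : ℝ) ^ 2 * (1 / (32 * d ^ 3)) = 1 / (16 * d) := by
        field_simp
        norm_num
      rw [h1, div_le_div_iff₀ (by positivity) (by norm_num)]
      linarith, by
      rw [hX, div_le_div_iff₀ (by positivity) (by norm_num)]
      linarith⟩
  have hPB : ∀ w, ‖P w‖ ≤ B * M ^ w.length := fun w => (hPb' w).trans (by gcongr; linarith)
  refine ⟨χ, D * B, B, hG, h2, hB0, ?_, hPB, h5, fun w hw hl => ?_⟩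
  · rw [hBM, div_le_div_iff₀ (by positivity) (by norm_num)]
    nlinarith [one_le_mul_of_one_le_of_one_le hD hd3]
  · by_contra! h
    refine hw ?_
    rw [hG.transformed_eq hB0 hPB h5, h6 w ⟨by omega, h.1, h.2.1⟩ hl, add_neg_cancel]

end solve

/-! ### The radius against the divisor bound -/

section radius

/-- The radius compensates the coefficients of the transformation. -/
lemma exists_radius_bound (f : ℝ → ℝ) {β δ τ p γ C K : ℝ} (hT : 0 < τ * (1 + β / δ)) (hp : 0 < p)
    (hγ : 0 < γ) (hC : 1 ≤ C) (hK : 0 ≤ K) : ∃ N₀ : ℕ, ∀ N : ℕ, N₀ ≤ N → ∀ d : ℕ, 2 ≤ d →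
    K * d ^ 3 * (1 + (C * d * N) ^ (τ * (1 + β / δ) * (d : ℝ) ^ p) / γ) * radius f β δ τ p d N ≤
      Real.exp (-(2 * Cfin β δ τ p * f N / d)) := by
  set T := τ * (1 + β / δ)
  refine ⟨⌈max 2 (max (2 * C) (K * (1 + 1 / γ)))⌉₊, fun N hN d hd => ?_⟩
  have hN' : max 2 (max (2 * C) (K * (1 + 1 / γ))) ≤ (N : ℝ) :=
    (Nat.le_ceil _).trans (by exact_mod_cast hN)
  simp only [max_le_iff] at hN'
  obtain ⟨hN2, hNC, hNK⟩ := hN'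
  have hd2 : (2 : ℝ) ≤ d := by exact_mod_cast hd
  set y : ℝ := d / 2 * N with hy
  have hyN : (N : ℝ) ≤ y := by
    rw [hy]
    nlinarith
  have hyd : (d : ℝ) ≤ y := by
    rw [hy]
    nlinarith
  have hy1 : 1 ≤ y := by linarith
  have hy0 : 0 < y := by linarith
  set E : ℝ := (d : ℝ) ^ p
  have hE : 1 ≤ E := Real.one_le_rpow (by linarith) hp.le
  have hrad : radius f β δ τ p d N =
      Real.exp (-(2 * Cfin β δ τ p * f N / d)) * y ^ (-(4 * E * (T + 1))) := by
    -- The factor `2 ^ (p + 2)` in `Cfin` undoes the halving of `d` and leaves a 4. The loss to be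
    -- compensated is `y ^ (4 + 2 T E)`: `y ^ 3` from `d ^ 3`, one `y` for the constants, and the
    -- rest from `C d N ≤ y ^ 2`.
    have h1 : ((d : ℝ) / 2) ^ p * Cfin β δ τ p = 4 * E * (T + 1) := by
      rw [Cfin, Real.div_rpow (by linarith) (by norm_num), Real.rpow_add (by norm_num)]
      have : (2 : ℝ) ^ p ≠ 0 := by positivity
      norm_num
      field_simp
      ring
    rw [radius, Real.mul_rpow (Real.exp_pos _).le (by positivity), ← Real.exp_mul,
      ← Real.rpow_mul hy0.le, neg_mul, neg_mul, h1]
    congr 2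
    field_simp
  rw [hrad, mul_left_comm]
  refine mul_le_of_le_one_right (Real.exp_pos _).le ?_
  rw [Real.rpow_neg hy0.le, ← div_eq_mul_inv, div_le_one (by positivity)]
  have h2 : (C * d * N) ^ (T * E) ≤ y ^ (2 * (T * E)) := by
    have h3 : C * d * N ≤ y ^ 2 := by
      rw [show C * d * N = 2 * C * y by rw [hy]; ring, pow_two]
      exact mul_le_mul_of_nonneg_right (by linarith) hy0.le
    calc _ ≤ (y ^ 2) ^ (T * E) := by gcongr
      _ = _ := by rw [← Real.rpow_natCast, ← Real.rpow_mul hy0.le]; norm_num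
  set U := y ^ (2 * (T * E))
  have hU : 1 ≤ U := Real.one_le_rpow hy1 (by positivity)
  calc K * d ^ 3 * (1 + (C * d * N) ^ (T * E) / γ) ≤ K * y ^ 3 * (U + U / γ) := by gcongr
    _ = K * (1 + 1 / γ) * (y ^ 3 * U) := by ring
    _ ≤ y * (y ^ 3 * U) := by
      gcongr
      linarith
    _ = y ^ (4 + 2 * (T * E)) := by
      rw [Real.rpow_add hy0]
      norm_num
      ring
    _ ≤ y ^ (4 * E * (T + 1)) := by
      refine Real.rpow_le_rpow_of_exponent_le hy1 ?_
      nlinarith [mul_pos hT (by linarith : 0 < E)]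

end radius

/-! ### Restriction of series to classes of monomials -/

section cut

open Classical in
/-- The part of a series with monomials in `Q`. -/
def cut (Q : Word m → Prop) (F : Ser m) : Ser m := fun w => if Q w then F w else 0

variable {Q : Word m → Prop} {F : Ser m}

lemma cut_ne_zero {w : Word m} (h : cut Q F w ≠ 0) : Q w ∧ F w ≠ 0 := by
  rw [cut] at h
  split_ifs at h with hQ
  · exact ⟨hQ, h⟩
  · exact absurd rfl h

lemma norm_cut_le (Q : Word m → Prop) (F : Ser m) (w : Word m) : ‖cut Q F w‖ ≤ ‖F w‖ := by
  rw [cut]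
  split_ifs
  · exact le_rfl
  · simp

lemma SuppOn.cut {ℓ : ℕ} {μ : Fin m → ℤ} (hF : SuppOn ℓ μ F) : SuppOn ℓ μ (cut Q F) := fun w hw =>
  hF w (cut_ne_zero hw).2

lemma star'_cut (hQ : ∀ w : Word m, Q (w.map bar) ↔ Q w) (hF : star' F = F) :
    star' (cut Q F) = cut Q F := by
  funext w
  have := congrFun hF w
  rw [star'] at this
  by_cases h : Q w
  · simp [star', cut, hQ, h, this]
  · simp [star', cut, hQ, h]

lemma inP_cut {d : ℕ∞} {B θ : ℝ} (hs : SuppOn 3 0 F) (hr : star' F = F)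
    (hQ : ∀ w : Word m, Q (w.map bar) ↔ Q w) (hd : ∀ w, Q w → (w.length : ℕ∞) ≤ d) (hB : 0 ≤ B)
    (hθ : 0 ≤ θ) (hF : ∀ w, ‖F w‖ ≤ B * θ ^ w.length) : InP (ofSer (cut Q F)) 3 d :=
  inP_ofSer hs.cut (star'_cut hQ hr) (fun w hw => hd w (cut_ne_zero hw).1) hB hθ
    fun w => (norm_cut_le Q F w).trans (hF w)

end cut

/-! ### Estimates for the remainder and the low components -/

section estimates

variable {f : ℝ → ℝ} {c Cf s₀ s : ℝ} {B M r : ℝ} {N : ℕ}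

/-- Vector fields with at least two high modes in each monomial. -/
lemma nrm_maj_le_of_two_le_highs (hf : WeightAssumption f c Cf) (hs₀ : IsThreshold m f c Cf s₀)
    (hs : s₀ ≤ s) (hN : c ≤ N) {V : Idx m → Ser m} (hB : 0 ≤ B) (hM : 0 ≤ M)
    (hBM : B * M ^ 2 ≤ 1 / 32) (hr : 256 * M * r ≤ 1)
    (hV : ∀ J w, ‖V J w‖ ≤ 16 * B * M * (4 * M) ^ w.length)
    (hVs : ∀ J w, V J w ≠ 0 → 2 ≤ w.length ∧ mom w = (J.2 : ℤ) • J.1 ∧ 2 ≤ highs N w)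
    {y : Idx m → ℝ≥0∞} (hy : nrm (expWt f c s) y ≤ ENNReal.ofReal r) :
    nrm (expWt f c s) (fun J => maj (V J) y) ≤
      ENNReal.ofReal (Real.exp (-((1 - Cf) * (s - s₀) * f N)) / 2) * nrm (expWt f c s) y := by
  have hs0 := (hs₀.pos hf).le
  refine (nrm_maj_le (κ := 1) (q := 1 / 32) (ℓ := 1)
    (ε := Real.exp (-((1 - Cf) * (s - s₀) * f N))) (one_le_expWt hf (hs0.trans hs))
    (l2_sideWt_le (s := s) hs₀ fun _ => le_rfl) (by positivity) (by positivity) zero_le_one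
    (by norm_num) (by norm_num) (Real.exp_pos _).le (by linarith) hV (fun J w hw => ?_) hy).trans ?_
  · obtain ⟨h1, h2, h3⟩ := hVs J w hw
    refine ⟨h1, h2, ?_⟩
    rw [ENNReal.ofReal_one, one_pow, one_mul]
    exact expWt_le_of_two_le_highs hf hs0 hs hN h3 h2
  · gcongr
    have h1 := Real.exp_pos (-((1 - Cf) * (s - s₀) * f N))
    set ε := Real.exp (-((1 - Cf) * (s - s₀) * f N))
    calc _ = 16 * (B * M ^ 2) * ε := by ring
      _ ≤ 16 * (1 / 32) * ε := by gcongr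
      _ = _ := by ring

/-- Vector fields of high order. -/
lemma nrm_maj_le_of_le_length (hf : WeightAssumption f c Cf) (hs₀ : IsThreshold m f c Cf s₀)
    (hs : s₀ ≤ s) {V : Idx m → Ser m} {d : ℕ} {E : ℝ} (hd : 2 ≤ d) (hE : 0 ≤ E) (hB : 0 ≤ B)
    (hM : 0 < M) (hBM : B * M ^ 2 ≤ 1 / 32) (hr0 : 0 < r)
    (hr : 4096 * M * r ≤ Real.exp (-(2 * E / d)))
    (hV : ∀ J w, ‖V J w‖ ≤ 16 * B * M * (4 * M) ^ w.length)
    (hVs : ∀ J w, V J w ≠ 0 → d ≤ w.length ∧ mom w = (J.2 : ℤ) • J.1)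
    {y : Idx m → ℝ≥0∞} (hy : nrm (expWt f c s) y ≤ ENNReal.ofReal r) :
    nrm (expWt f c s) (fun J => maj (V J) y) ≤
      ENNReal.ofReal (Real.exp (-E) / 2) * nrm (expWt f c s) y := by
  have hs0 := (hs₀.pos hf).le
  have ha := tame_expWt hf hs₀ hs le_rfl
  have hd0 : (0 : ℝ) < d := by positivity
  have he1 : Real.exp (-(2 * E / d)) ≤ 1 := by
    rw [Real.exp_le_one_iff, Left.neg_nonpos_iff]
    positivity
  -- This is the smallest slack admissible on the ball of radius `r`. A field of degree at least `d`
  -- keeps `q ^ (d - 1)`, and `2 (d - 1) / d ≥ 1` turns this into `exp (-E)`.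
  set q := 8 * M * r with hq
  have hq0 : 0 < q := by positivity
  have hqe : q ≤ Real.exp (-(2 * E / d)) / 512 := by
    rw [hq]
    linarith
  refine (nrm_maj_le (κ := 1) (q := q) (ℓ := d - 1) (ε := 1) ha.one_le ha.l2_le
    (by positivity) (by positivity) zero_le_one hq0 (by linarith) zero_le_one (by
      rw [hq]
      apply le_of_eq
      field_simp
      norm_num) hV (fun J w hw => ?_) hy).trans ?_
  · obtain ⟨h1, h2⟩ := hVs J w hw
    refine ⟨by omega, h2, ?_⟩
    rw [ENNReal.ofReal_one, one_mul, ← ENNReal.ofReal_one]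
    exact ha.tame J w h2 (by rintro rfl; simp at h1; omega)
  · gcongr
    have h1 : q ^ (d - 1) ≤ Real.exp (-E) / 512 := by
      calc q ^ (d - 1) ≤ (Real.exp (-(2 * E / d)) / 512) ^ (d - 1) := by gcongr
        _ = Real.exp (-(2 * E / d)) ^ (d - 1) * (1 / 512) ^ (d - 1) := by rw [← mul_pow]; ring
        _ ≤ Real.exp (-E) * (1 / 512) := by
          gcongr
          · rw [← Real.exp_nat_mul, Real.exp_le_exp, mul_neg, neg_le_neg_iff,
              Nat.cast_sub (by omega), mul_div_assoc', le_div_iff₀ hd0]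
            have : (2 : ℝ) ≤ d := by exact_mod_cast hd
            push_cast
            nlinarith
          · exact pow_le_of_le_one (by norm_num) (by norm_num) (by omega)
        _ = _ := by ring
    calc _ = 512 * (B * M ^ 2) * q ^ (d - 1) := by ring
      _ ≤ 512 * (1 / 32) * (Real.exp (-E) / 512) := by gcongr
      _ ≤ _ := by linarith [Real.exp_pos (-E)]

lemma norm_hamCoeff_le_of {F : Ser m} (hB : 0 ≤ B) (hM : 0 ≤ M)
    (hF : ∀ w, ‖F w‖ ≤ 8 * B * (2 * M) ^ w.length) (J : Idx m) (w : Word m) :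
    ‖hamCoeff F J w‖ ≤ 16 * B * M * (4 * M) ^ w.length := by
  refine (norm_hamCoeff_le' (by positivity) (by positivity) hF J w).trans_eq ?_
  rw [← mul_assoc 2 2 M]
  ring

/-- The vector field of the remainder. -/
lemma nrm_maj_hamCoeff_le (hf : WeightAssumption f c Cf) (hs₀ : IsThreshold m f c Cf s₀)
    (hs : s₀ ≤ s) (hN : c ≤ N) {F : Ser m} {d : ℕ} {E : ℝ} (hd : 2 ≤ d) (hE : 0 ≤ E) (hB : 0 ≤ B)
    (hM : 0 < M) (hBM : B * M ^ 2 ≤ 1 / 32) (hr0 : 0 < r)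
    (hr : 4096 * M * r ≤ Real.exp (-(2 * E / d)))
    (hF : ∀ w, ‖F w‖ ≤ 8 * B * (2 * M) ^ w.length) (hFs : SuppOn 3 0 F)
    (hFh : ∀ w, F w ≠ 0 → w.length ≤ d → 3 ≤ highs N w)
    {y : Idx m → ℝ≥0∞} (hy : nrm (expWt f c s) y ≤ ENNReal.ofReal r) :
    nrm (expWt f c s) (fun J => maj (hamCoeff F J) y) ≤
      ENNReal.ofReal ((Real.exp (-((1 - Cf) * (s - s₀) * f N)) + Real.exp (-E)) / 2) *
        nrm (expWt f c s) y := by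
  have hham := norm_hamCoeff_le_of hB hM.le hF
  -- Field monomials of degree below `d` come from monomials of `F` of degree at most `d`. These
  -- have three high modes, of which differentiation removes at most one. The longer field monomials
  -- are small because of their degree.
  have hlow := nrm_maj_le_of_two_le_highs hf hs₀ hs hN
    (V := fun J => cut (fun w => w.length < d) (hamCoeff F J)) hB hM.le hBM (by
      have he1 : Real.exp (-(2 * E / d)) ≤ 1 := by
        rw [Real.exp_le_one_iff, Left.neg_nonpos_iff]
        positivity
      nlinarith [mul_pos hM hr0]) (fun J w => (norm_cut_le _ _ w).trans (hham J w))
    (fun J w hw => by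
      obtain ⟨h1, h2⟩ := cut_ne_zero hw
      refine ⟨by simpa using hFs.le_length_of_hamCoeff_ne_zero h2,
        hFs.mom_of_hamCoeff_ne_zero h2, ?_⟩
      obtain ⟨p, r, rfl, h3⟩ := exists_of_hamCoeff_ne_zero h2
      have h4 := hFh _ h3 (by simp at h1 ⊢; omega)
      rw [highs_append, highs_cons] at h4
      rw [highs_append]
      split_ifs at h4 <;> omega) hy
  have hhigh := nrm_maj_le_of_le_length hf hs₀ hs
    (V := fun J => cut (fun w => ¬w.length < d) (hamCoeff F J)) hd hE hB hM hBM hr0 hr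
    (fun J w => (norm_cut_le _ _ w).trans (hham J w))
    (fun J w hw => by
      obtain ⟨h1, h2⟩ := cut_ne_zero hw
      exact ⟨by omega, hFs.mom_of_hamCoeff_ne_zero h2⟩) hy
  calc _ ≤ nrm (expWt f c s) (fun J => maj (cut (fun w => w.length < d) (hamCoeff F J)) y +
        maj (cut (fun w => ¬w.length < d) (hamCoeff F J)) y) := by
        refine nrm_mono fun J => ?_
        rw [maj, maj, maj, ← ENNReal.tsum_add]
        refine ENNReal.tsum_le_tsum fun w => ?_
        rw [← add_mul]
        gcongr
        by_cases h : w.length < d <;> simp [cut, h]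
    _ ≤ _ := (nrm_add_le _ _ _).trans (add_le_add hlow hhigh)
    _ = _ := by
        rw [← add_mul, ← ENNReal.ofReal_add (by positivity) (by positivity)]
        congr 2
        ring

variable {R : ℝ}

/-- The vector field of a series whose coefficients are geometrically bounded. -/
lemma hamVec_eval_emb {a : Idx m → ℝ} {b : Idx m → ℝ≥0∞} {K : ℝ≥0∞} (ha : Tame a b K) {F : Ser m}
    (hB : 0 ≤ B) (hM : 0 ≤ M) (hR : 4 * M * R ≤ 1) (hF : ∀ w, ‖F w‖ ≤ 8 * B * (2 * M) ^ w.length)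
    {x : L2 m} (hx : ‖x‖ < R) (J : Idx m) :
    hamVec (eval (ofSer F)) (emb a x) J = ev (hamCoeff F J) (emb a x) := by
  have h : eval (ofSer F) = ev F := funext fun u => by rw [eval_eq, toSer_ofSer]
  rw [h]
  exact hamVec_ev ha.one_le (bddOn_of_norm_le ha (by positivity) (by positivity) (by linarith) hF)
    ENNReal.ofReal_ne_top hx J

lemma fieldNorm_le (hf : WeightAssumption f c Cf) (hs₀ : IsThreshold m f c Cf s₀)
    (hs : s₀ ≤ s) (hN : c ≤ N) {F : Ser m} {d : ℕ} {E : ℝ} (hd : 2 ≤ d) (hE : 0 ≤ E) (hB : 0 ≤ B)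
    (hM : 0 < M) (hBM : B * M ^ 2 ≤ 1 / 32) (hr0 : 0 < r)
    (hr : 4096 * M * r ≤ Real.exp (-(2 * E / d)))
    (hF : ∀ w, ‖F w‖ ≤ 8 * B * (2 * M) ^ w.length) (hFs : SuppOn 3 0 F)
    (hFh : ∀ w, F w ≠ 0 → w.length ≤ d → 3 ≤ highs N w) :
    fieldNorm f c r s (eval (ofSer F)) ≤
      ENNReal.ofReal ((Real.exp (-((1 - Cf) * (s - s₀) * f N)) + Real.exp (-E)) / 2) := by
  have ha := tame_expWt hf hs₀ hs le_rfl
  refine ENNReal.div_le_of_le_mul (iSup₂_le fun u hu => ?_)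
  obtain ⟨x, hx, rfl⟩ := exists_of_mem_wBall ha.one_le hu
  have hy : nrm (expWt f c s) (fun J => ‖emb (expWt f c s) x J‖ₑ) ≤ ENNReal.ofReal r := by
    rw [nrm_emb ha.one_le]
    exact enorm_le_ofReal hx.le
  have he1 : Real.exp (-(2 * E / d)) ≤ 1 := by
    rw [Real.exp_le_one_iff, Left.neg_nonpos_iff]
    positivity
  rw [wNorm_eq]
  refine (nrm_mono fun J => ?_).trans ((nrm_maj_hamCoeff_le hf hs₀ hs hN hd hE hB hM hBM hr0 hr hF
    hFs hFh hy).trans (by gcongr))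
  rw [hamVec_eval_emb ha hB hM.le (by nlinarith [mul_pos hM hr0]) hF hx]
  exact enorm_ev_le fun _ => le_rfl

/-- A low component of the field comes from differentiation in a low variable, so both high modes of
the monomial survive and the gain for two high modes applies. -/
lemma wNorm_lowPart_le (hf : WeightAssumption f c Cf) (hs₀ : IsThreshold m f c Cf s₀)
    (hs : s₀ ≤ s) (hN : c ≤ N) {F : Ser m} (hB : 0 ≤ B) (hM : 0 ≤ M)
    (hBM : B * M ^ 2 ≤ 1 / 32) (hr : 256 * M * r ≤ 1) (hr1 : r ≤ 1)
    (hF : ∀ w, ‖F w‖ ≤ 8 * B * (2 * M) ^ w.length) (hFs : SuppOn 3 0 F)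
    (hFh : ∀ w, F w ≠ 0 → highs N w = 2) {u : Seq m} (hu : u ∈ wBall f c s r) :
    wNorm f c s (lowPart N (hamVec (eval (ofSer F)) u)) ≤
      ENNReal.ofReal (Real.exp (-((1 - Cf) * (s - s₀) * f N))) := by
  classical
  have ha := tame_expWt hf hs₀ hs le_rfl
  obtain ⟨x, hx, rfl⟩ := exists_of_mem_wBall ha.one_le hu
  have hy : nrm (expWt f c s) (fun J => ‖emb (expWt f c s) x J‖ₑ) ≤ ENNReal.ofReal r := by
    rw [nrm_emb ha.one_le]
    exact enorm_le_ofReal hx.le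
  have h := nrm_maj_le_of_two_le_highs hf hs₀ hs hN
    (V := fun J => cut (fun _ => len J.1 ≤ N) (hamCoeff F J)) hB hM hBM hr
    (fun J w => (norm_cut_le _ _ w).trans (norm_hamCoeff_le_of hB hM hF J w))
    (fun J w hw => by
      obtain ⟨h1, h2⟩ := cut_ne_zero hw
      refine ⟨by simpa using hFs.le_length_of_hamCoeff_ne_zero h2,
        hFs.mom_of_hamCoeff_ne_zero h2, ?_⟩
      obtain ⟨p, r, rfl, h3⟩ := exists_of_hamCoeff_ne_zero h2
      have h4 := hFh _ h3
      rw [highs_append, highs_cons, if_neg (not_lt.2 (by exact h1))] at h4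
      rw [highs_append]
      omega) hy
  rw [wNorm_eq]
  refine (nrm_mono fun J => ?_).trans (h.trans ?_)
  · rw [lowPart]
    split_ifs with hJ
    · rw [hamVec_eval_emb ha hB hM (by linarith [norm_nonneg x, mul_nonneg hM ((norm_nonneg x).trans hx.le)]) hF hx]
      refine (enorm_ev_le fun _ => le_rfl).trans_eq ?_
      congr 1
      funext w
      simp [cut, hJ]
    · simp
  · refine (mul_le_mul' le_rfl hy).trans ?_
    rw [← ENNReal.ofReal_mul (by positivity)]
    refine ENNReal.ofReal_le_ofReal ?_
    have := Real.exp_pos (-((1 - Cf) * (s - s₀) * f N))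
    nlinarith

end estimates

/-! ### The transformation on balls and the final assembly -/

section main

variable {f : ℝ → ℝ} {c Cf s₀ s r R κ : ℝ} {χ : Ser m} {d : ℕ} {X M : ℝ}

/-- The transformation generated by `χ` on the balls of `W_s`. -/
lemma Gen.lieMap_mem (hG : Gen χ d X M) (hf : WeightAssumption f c Cf)
    (hs₀ : IsThreshold m f c Cf s₀) (hs : s₀ ≤ s) (hκ : 1 ≤ κ) (hR0 : 0 < R)
    (hR : 512 * M * κ ^ 2 * R ≤ 1) (hr : r ≤ R / 8) {u : Seq m} (hu : u ∈ wBall f c s r) :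
    lieMap χ u ∈ wBall f c s (2 * r) ∧ lieMap (-χ) (lieMap χ u) = u := by
  have ha := tame_expWt hf hs₀ hs hκ
  obtain ⟨x, hx, rfl⟩ := exists_of_mem_wBall ha.one_le hu
  obtain ⟨y, hy, h1, h2, -⟩ := hG.exists_vmap_lieSer ha hκ hR0 hR (hx.trans_le hr)
  rw [h1]
  refine ⟨(emb_mem_wBall_iff ha.one_le).2 ?_, h2⟩
  linarith [norm_nonneg x]

lemma converges_of_norm_le (hf : WeightAssumption f c Cf) (hs₀ : IsThreshold m f c Cf s₀)
    (hs : s₀ ≤ s) {P : Coeff m} {B θ : ℝ} (hB : 0 ≤ B) (hθ : 0 ≤ θ) (hr : θ * r ≤ 1 / 2)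
    (hP : ∀ w, ‖toSer P w‖ ≤ B * θ ^ w.length) {u : Seq m} (hu : u ∈ wBall f c s r) :
    Converges P u := by
  have ha := tame_expWt hf hs₀ hs le_rfl
  rw [converges_iff]
  refine summable_ev (fun J => le_rfl) (ne_top_of_le_ne_top ENNReal.ofReal_ne_top
    (bddOn_of_norm_le ha hB hθ hr hP _ ?_))
  rw [← wNorm_eq]
  exact le_of_lt hu

variable {ω : (Fin m → ℤ) → ℝ} {β : ℝ}

/-- The transformed Hamiltonian at sequences of finite energy. -/
lemma Gen.hamiltonian_lieMap (hG : Gen χ d X M) (hf : WeightAssumption f c Cf)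
    (hs₀ : IsThreshold m f c Cf s₀) (hs : s₀ ≤ s) (hβ : 0 ≤ β) (hR0 : 0 < R)
    (hR : 512 * M * Real.exp β ^ 2 * R ≤ 1) (hr : r ≤ R / 8) {C : ℝ} (hC : 0 ≤ C)
    (hω : ∀ j, |ω j| ≤ C * max (len j) 1 ^ β) (hω' : ∀ j, max (len j) 1 ^ β ≤ C * (|ω j| + 1))
    {P : Ser m} {B : ℝ} (hB : 0 ≤ B) (hP : ∀ w, ‖P w‖ ≤ B * M ^ w.length)
    (hW : ∀ w, ‖lieH0 ω χ w‖ ≤ B * M ^ w.length) {u : Seq m} (hu : u ∈ wBall f c s r)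
    (hE : FiniteEnergy ω u) : FiniteEnergy ω (lieMap χ u) ∧
      H0 ω (lieMap χ u) + ev P (lieMap χ u) = H0 ω u + ev (transformed ω P χ) u := by
  have hκ : 1 ≤ Real.exp β := Real.one_le_exp hβ
  have hM := hG.one_le_M
  -- The point is moved to a space of finite energy with the same radius; the flow there preserves
  -- finite energy and `H₀` may be differentiated along it.
  obtain ⟨η, hη, x, hx, rfl⟩ := exists_energy_emb hC hω' (tame_expWt hf hs₀ hs hκ).one_le hu hE
  have ha := tame_energyWt hf hs₀ hs hη.le hβ
  have hx8 : ‖x‖ < R / 8 := hx.trans_le hr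
  obtain ⟨y, hy, h1, -, h2⟩ := hG.exists_vmap_lieSer ha hκ hR0 hR hx8
  refine ⟨h1 ▸ finiteEnergy_emb hC hω hη ha.one_le y, ?_⟩
  rw [hG.H0_lieMap ha hκ hR0 hR (by positivity : 0 ≤ C / η) (abs_le_energyWt_sq hC hω hη) hB hW hx8,
    h1, ← h2 P B hB hP, add_assoc]
  congr 1
  have hs : ∀ F : Ser m, (∀ w, ‖F w‖ ≤ 4 * B * (2 * M) ^ w.length) →
      Summable fun w => F w * mon (emb (energyWt f c s β η) x) w := by
    intro F hF
    refine summable_ev (fun J => le_rfl) (ne_top_of_le_ne_top ENNReal.ofReal_ne_top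
      (bddOn_of_norm_le ha (R := R) (by positivity) (by positivity) ?_ hF _ ?_))
    · have h3 : 0 ≤ M * R := by positivity
      nlinarith [one_le_pow₀ (n := 2) hκ]
    · rw [nrm_emb ha.one_le]
      exact enorm_le_ofReal (by linarith)
  rw [add_comm, ev, ev, ev, ← (hs _ (hG.norm_lieSer_le hB hP)).tsum_add
    (hs _ (hG.norm_lieMean_le hB hW))]
  exact tsum_congr fun w => (add_mul _ _ _).symm

end main

end NormalForm

end

theorem mainTheorem4 {m : ℕ} (hm : 1 ≤ m)
    (f : ℝ → ℝ) (c Cf s₀ : ℝ) (hf : NormalForm.WeightAssumption f c Cf)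
    (hs₀ : NormalForm.IsThreshold m f c Cf s₀)
    (ω : (Fin m → ℤ) → ℝ) {A : Type*} (blk : NormalForm.Idx m → A)
    (C₀ C₁ C₂ β δ γ τ p : ℝ)
    (hω : NormalForm.FrequencyAssumption ω blk C₀ C₁ C₂ β δ γ τ p)
    (P : NormalForm.Coeff m) (hP : NormalForm.InP P 3 ⊤) :
    ∃ D N₀ : ℕ, ∀ d : ℕ, D ≤ d → ∀ N : ℕ, N₀ ≤ N →
      (∀ j k, NormalForm.len j ≤ N → (N : ℝ) < NormalForm.len k → ω j ≠ ω k) →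
      ∃ (T Tinv : NormalForm.Seq m → NormalForm.Seq m) (Z Zlow Zhigh R : NormalForm.Coeff m),
        NormalForm.InP Z 3 d ∧ NormalForm.IsCuttingNormalForm ω blk N Z ∧
        NormalForm.InP Zlow 3 d ∧ (∀ k J, Zlow k J ≠ 0 → NormalForm.IsR0 ω N J) ∧
        NormalForm.InP Zhigh 3 d ∧ (∀ k J, Zhigh k J ≠ 0 → NormalForm.IsR2 blk N J) ∧
        Z = Zlow + Zhigh ∧
        NormalForm.InP R 3 ⊤ ∧
        ∀ s : ℝ, s₀ < s → ∀ r : ℝ, 0 < r → r ≤ NormalForm.radius f β δ τ p d N →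
          -- `T` and its inverse are canonical maps from `B_s(r)` to `B_s(2r)`
          NormalForm.IsCanonicalOn f c s r T ∧ NormalForm.IsCanonicalOn f c s r Tinv ∧
          (∀ u ∈ NormalForm.wBall f c s r,
            T u ∈ NormalForm.wBall f c s (2 * r) ∧ Tinv u ∈ NormalForm.wBall f c s (2 * r) ∧
            Tinv (T u) = u ∧ T (Tinv u) = u ∧
            (NormalForm.IsReal u → NormalForm.IsReal (T u) ∧ NormalForm.IsReal (Tinv u))) ∧
          -- the series converge, and `H ∘ T = H₀ + Z + R` wherever `H₀` is defined
          (∀ u ∈ NormalForm.wBall f c s (2 * r), NormalForm.Converges P u) ∧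
          (∀ u ∈ NormalForm.wBall f c s r,
            NormalForm.Converges Z u ∧ NormalForm.Converges Zhigh u ∧
            NormalForm.Converges R u) ∧
          (∀ u ∈ NormalForm.wBall f c s r, NormalForm.FiniteEnergy ω u →
            NormalForm.FiniteEnergy ω (T u) ∧
            NormalForm.H0 ω (T u) + NormalForm.eval P (T u) =
              NormalForm.H0 ω u + NormalForm.eval Z u + NormalForm.eval R u) ∧
          -- the two estimates
          NormalForm.fieldNorm f c r s (NormalForm.eval R) ≤
            ENNReal.ofReal
              (Real.exp (-(min (NormalForm.Cfin β δ τ p) ((1 - Cf) * (s - s₀)) * f N))) ∧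
          (⨆ u ∈ NormalForm.wBall f c s r, NormalForm.wNorm f c s
              (NormalForm.lowPart N (NormalForm.hamVec (NormalForm.eval Zhigh) u))) ≤
            ENNReal.ofReal
              (Real.exp (-(min (NormalForm.Cfin β δ τ p) ((1 - Cf) * (s - s₀)) * f N))) := by
  classical
  obtain ⟨C, N₁, hC, hdiv⟩ := hω.exists_divisor_bound
  obtain ⟨C', hC', hω1, hω2, -⟩ := hω.exists_comparable
  obtain ⟨a₀, ha₀⟩ := hP.bounded
  set a : ℝ := max |a₀| 1
  have ha : 1 ≤ a := le_max_right _ _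
  have hPa : ∀ w, ‖NormalForm.toSer P w‖ ≤ a ^ w.length := fun w => by
    refine (ha₀ _ _).trans ((le_abs_self _).trans ?_)
    rw [abs_pow]
    exact pow_le_pow_left₀ (abs_nonneg _) (le_max_left _ _) _
  have hβ : 0 ≤ β := by linarith [hω.one_lt_β]
  have hT : 0 < τ * (1 + β / δ) := by
    have h1 := hω.τ_pos
    have h2 := hω.δ_pos
    positivity
  set κ := Real.exp β
  have hκ : 1 ≤ κ := Real.one_le_exp hβ
  -- With this `K` the radius bound controls `4096 M κ ^ 2` times the radius. The tame constant `κ`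
  -- of the energy weight is included, so one radius serves both weights and all `s`.
  obtain ⟨N₂, hrad⟩ := NormalForm.exists_radius_bound f (K := 4096 * κ ^ 2 * (64 * a ^ 3)) hT
    hω.p_pos hω.γ_pos hC (by positivity)
  refine ⟨2, max N₁ (max N₂ ⌈c⌉₊), fun d hd N hN hsep => ?_⟩
  simp only [max_le_iff] at hN
  obtain ⟨hN1, hN2, hN3⟩ := hN
  have hNc : c ≤ N := (Nat.le_ceil c).trans (by exact_mod_cast hN3)
  have hN0 : (0 : ℝ) < N := hf.c_pos.trans_le hNc
  have hfN : 0 < f N := hf.pos _ hNc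
  set D : ℝ := 1 + (C * d * N) ^ (τ * (1 + β / δ) * (d : ℝ) ^ p) / γ
  have hD : 1 ≤ D := by
    have h1 : 0 ≤ (C * d * N) ^ (τ * (1 + β / δ) * (d : ℝ) ^ p) / γ :=
      div_nonneg (Real.rpow_nonneg (by positivity) _) hω.γ_pos.le
    linarith
  have hd1 : 1 ≤ d := by omega
  obtain ⟨χ, X, B, hG, hχ, hB, hBM, hPB, hW, hcut⟩ := hω.exists_gen hd1 hD
    (hdiv N hN1 hsep d hd1) ha hP.suppOn hP.star'_toSer hPa
  have hrad := hrad N hN2 d hd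
  set ρ := NormalForm.radius f β δ τ p d N
  set M : ℝ := 64 * a ^ 3 * D * d ^ 3
  set E : ℝ := NormalForm.Cfin β δ τ p * f N
  have hd0 : (0 : ℝ) < d := by exact_mod_cast hd1
  have hE : 0 ≤ E := by
    refine mul_nonneg ?_ hfN.le
    rw [NormalForm.Cfin]
    positivity
  have hM : 1 ≤ M := hG.one_le_M
  have hρ0 : 0 < ρ := Real.rpow_pos_of_pos (by positivity) _
  have hradM : 4096 * M * κ ^ 2 * ρ ≤ Real.exp (-(2 * E / d)) := by
    refine le_trans (le_of_eq ?_) (hrad.trans_eq ?_)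
    · ring
    · rw [← mul_assoc 2]
  have hexp1 : Real.exp (-(2 * E / d)) ≤ 1 := by
    rw [Real.exp_le_one_iff, Left.neg_nonpos_iff]
    positivity
  -- The flow estimates hold on the ball of radius `R / 8`, hence the choice `R = 8 ρ`.
  have hR : 512 * M * κ ^ 2 * (8 * ρ) ≤ 1 := by linarith
  have hκ2 : 1 ≤ κ ^ 2 := one_le_pow₀ hκ
  have hMρ : 4096 * M * ρ ≤ Real.exp (-(2 * E / d)) := by
    refine le_trans ?_ hradM
    have : 0 ≤ 4096 * M * ρ := by positivity
    nlinarith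
  have hρ1 : ρ ≤ 1 := by nlinarith
  set S := NormalForm.transformed ω (NormalForm.toSer P) χ
  have hSs : NormalForm.SuppOn 3 0 S := hP.suppOn.transformed hG.supp
  have hSr : NormalForm.star' S = S := NormalForm.star'_transformed hP.star'_toSer hχ
  have hSb : ∀ w, ‖S w‖ ≤ 8 * B * (2 * M) ^ w.length := hG.norm_transformed_le hB hPB hW
  set Q0 : NormalForm.Word m → Prop := fun w => w.length ≤ d ∧ NormalForm.IsR0 ω N w.get
  set Q2 : NormalForm.Word m → Prop := fun w => w.length ≤ d ∧ NormalForm.IsR2 blk N w.get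
  have hQ0 : ∀ w : NormalForm.Word m, Q0 (w.map NormalForm.bar) ↔ Q0 w := fun w => by
    simp only [Q0, List.length_map, NormalForm.isR0_bar]
  have hQ2 : ∀ w : NormalForm.Word m, Q2 (w.map NormalForm.bar) ↔ Q2 w := fun w => by
    simp only [Q2, List.length_map, hω.isR2_bar]
  have hQ : ∀ w : NormalForm.Word m, (Q0 (w.map NormalForm.bar) ∨ Q2 (w.map NormalForm.bar)) ↔
      (Q0 w ∨ Q2 w) := fun w => by rw [hQ0, hQ2]
  -- R0 words have no high mode and R2 words have two, so the two parts of the normal form do not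
  -- overlap and their sum is the whole.
  have hdisj : ∀ w, ¬(Q0 w ∧ Q2 w) := fun w h => by
    have h1 := h.1.2.highs_eq_zero
    have h2 := h.2.2.highs_eq_two
    omega
  have hB8 : 0 ≤ 8 * B := by positivity
  have hM2 : 0 ≤ 2 * M := by positivity
  set Zl := NormalForm.cut Q0 S
  set Zh := NormalForm.cut Q2 S
  set Zs := NormalForm.cut (fun w => Q0 w ∨ Q2 w) S
  set Rs := NormalForm.cut (fun w => ¬(Q0 w ∨ Q2 w)) S
  have hcutb : ∀ Q : NormalForm.Word m → Prop, ∀ w,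
      ‖NormalForm.cut Q S w‖ ≤ 8 * B * (2 * M) ^ w.length :=
    fun Q w => (NormalForm.norm_cut_le Q S w).trans (hSb w)
  have hdeg : ∀ w, Q0 w ∨ Q2 w → (w.length : ℕ∞) ≤ (d : ℕ∞) := fun w hw => by
    have : w.length ≤ d := hw.elim (fun h => h.1) fun h => h.1
    exact_mod_cast this
  have hr0 : ∀ (k : ℕ) (J : Fin k → NormalForm.Idx m), Q0 (List.ofFn J) → NormalForm.IsR0 ω N J :=
    fun k J h => (NormalForm.pred_ofFn (fun J => NormalForm.IsR0 ω N J) J).1 h.2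
  have hr2 : ∀ (k : ℕ) (J : Fin k → NormalForm.Idx m), Q2 (List.ofFn J) →
      NormalForm.IsR2 blk N J :=
    fun k J h => (NormalForm.pred_ofFn (fun J => NormalForm.IsR2 blk N J) J).1 h.2
  refine ⟨NormalForm.lieMap χ, NormalForm.lieMap (-χ), NormalForm.ofSer Zs, NormalForm.ofSer Zl,
    NormalForm.ofSer Zh, NormalForm.ofSer Rs,
    NormalForm.inP_cut hSs hSr hQ hdeg hB8 hM2 hSb,
    fun k J h => (NormalForm.cut_ne_zero (Q := fun w => Q0 w ∨ Q2 w) h).1.imp (hr0 k J) (hr2 k J),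
    NormalForm.inP_cut hSs hSr hQ0 (fun w hw => hdeg w (Or.inl hw)) hB8 hM2 hSb,
    fun k J h => hr0 k J (NormalForm.cut_ne_zero h).1,
    NormalForm.inP_cut hSs hSr hQ2 (fun w hw => hdeg w (Or.inr hw)) hB8 hM2 hSb,
    fun k J h => hr2 k J (NormalForm.cut_ne_zero h).1, ?_,
    NormalForm.inP_cut hSs hSr (fun w => not_congr (hQ w)) (fun w _ => le_top) hB8 hM2 hSb, ?_⟩
  · funext k J
    change NormalForm.cut (fun w => Q0 w ∨ Q2 w) S (List.ofFn J) =
      NormalForm.cut Q0 S (List.ofFn J) + NormalForm.cut Q2 S (List.ofFn J)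
    have h := hdisj (List.ofFn J)
    by_cases h0 : Q0 (List.ofFn J)
    · have h2 : ¬Q2 (List.ofFn J) := fun h2 => h ⟨h0, h2⟩
      simp [NormalForm.cut, h0, h2]
    · simp [NormalForm.cut, h0]
  intro s hs r hr hrρ
  have hs' := hs.le
  have hR0 : 0 < 8 * ρ := by positivity
  have hr8 : r ≤ 8 * ρ / 8 := by linarith
  have hMr : 4096 * M * r ≤ Real.exp (-(2 * E / d)) :=
    le_trans (by gcongr) hMρ
  have hconv : ∀ Q : NormalForm.Word m → Prop, ∀ u ∈ NormalForm.wBall f c s r,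
      NormalForm.Converges (NormalForm.ofSer (NormalForm.cut Q S)) u := fun Q u hu =>
    NormalForm.converges_of_norm_le hf hs₀ hs' hB8 hM2 (by linarith)
      (by rw [NormalForm.toSer_ofSer]; exact hcutb Q) hu
  have hmin1 : Real.exp (-E) ≤
      Real.exp (-(min (NormalForm.Cfin β δ τ p) ((1 - Cf) * (s - s₀)) * f N)) := by
    rw [Real.exp_le_exp, neg_le_neg_iff]
    exact mul_le_mul_of_nonneg_right (min_le_left _ _) hfN.le
  have hmin2 : Real.exp (-((1 - Cf) * (s - s₀) * f N)) ≤
      Real.exp (-(min (NormalForm.Cfin β δ τ p) ((1 - Cf) * (s - s₀)) * f N)) := by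
    rw [Real.exp_le_exp, neg_le_neg_iff]
    exact mul_le_mul_of_nonneg_right (min_le_right _ _) hfN.le
  refine ⟨hG.isCanonicalOn hf hs₀ hs' hκ hR0 hR hr8, hG.neg.isCanonicalOn hf hs₀ hs' hκ hR0 hR hr8,
    fun u hu => ?_, fun u hu => ?_, fun u hu => ⟨hconv _ u hu, hconv _ u hu, hconv _ u hu⟩,
    fun u hu hEu => ?_, ?_, iSup₂_le fun u hu => ?_⟩
  · obtain ⟨h1, h2⟩ := hG.lieMap_mem hf hs₀ hs' hκ hR0 hR hr8 hu
    obtain ⟨h3, h4⟩ := hG.neg.lieMap_mem hf hs₀ hs' hκ hR0 hR hr8 hu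
    rw [neg_neg] at h4
    refine ⟨h1, h3, h2, h4, fun hu => ⟨NormalForm.isReal_lieMap hχ hu,
      NormalForm.isReal_lieMap ?_ hu⟩⟩
    funext w
    have := congrFun hχ w
    rw [NormalForm.star'] at this
    simp [NormalForm.star', this]
  · exact NormalForm.converges_of_norm_le hf hs₀ hs' hB (by positivity) (by linarith) hPB hu
  · obtain ⟨h1, h2⟩ := hG.hamiltonian_lieMap hf hs₀ hs' hβ hR0 hR hr8 (by linarith) hω1 hω2 hB hPB
      hW hu hEu
    refine ⟨h1, ?_⟩
    have h3 := (NormalForm.converges_iff _ _).1 (hconv (fun w => Q0 w ∨ Q2 w) u hu)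
    have h4 := (NormalForm.converges_iff _ _).1 (hconv (fun w => ¬(Q0 w ∨ Q2 w)) u hu)
    rw [NormalForm.toSer_ofSer] at h3 h4
    rw [NormalForm.eval_eq P, h2, NormalForm.eval_eq, NormalForm.eval_eq, NormalForm.toSer_ofSer,
      NormalForm.toSer_ofSer, add_assoc]
    congr 1
    rw [NormalForm.ev, NormalForm.ev, NormalForm.ev, ← h3.tsum_add h4]
    refine tsum_congr fun w => ?_
    rw [← add_mul]
    congr 1
    by_cases h : Q0 w ∨ Q2 w <;> simp [NormalForm.cut, h, S]
  -- The estimate is the mean of the two exponentials, each of which is at most the one with the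
  -- minimum, so no constant is lost.
  · refine (NormalForm.fieldNorm_le hf hs₀ hs' hNc hd hE hB (by linarith) hBM hr hMr (hcutb _)
      hSs.cut fun w hw hl => ?_).trans (ENNReal.ofReal_le_ofReal (by linarith))
    obtain ⟨h1, h2⟩ := NormalForm.cut_ne_zero hw
    rcases hcut w h2 hl with h | h | h
    · exact absurd (Or.inl ⟨hl, h⟩) h1
    · exact absurd (Or.inr ⟨hl, h⟩) h1
    · exact h
  · exact (NormalForm.wNorm_lowPart_le hf hs₀ hs' hNc hB (by linarith) hBM (by
        have : 0 ≤ M * r := by positivity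
        nlinarith) (hrρ.trans hρ1) (hcutb _) hSs.cut
      (fun w hw => (NormalForm.cut_ne_zero hw).1.2.highs_eq_two) hu).trans
      (ENNReal.ofReal_le_ofReal hmin2)
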